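/- **Setting.** Let $G$ be an arbitrary finite bipartite graph with non-empty parts $U$ and $V$. A *hard-core configuration* is an independent set $x\subseteq U\cup V$ (the active vertices); $u$ and $v$ denote the configurations $U$ and $V$. Let $g_U,g_V:[0,\infty)\to[0,\infty)$ be non-decreasing with $1=o(g_U(x))$ and $g_U(x)=o(g_V(x))$ as $x\to\infty$, let $c_U,c_V,\mu_U,\mu_V>0$, and let $M=M(\lambda)\to\infty$ as $\lambda\to\infty$. For $\lambda$ large and $\tau\ge 0$ put $t=M\tau$, and let $$\lambda_U(s)=g_U\big([c_U\lambda-\mu_U s]^+\big),\qquad \lambda_V(s)=g_V(c_V\lambda+\mu_V s)\qquad(0\le s\le t),$$ with $\lambda_U(s)=\lambda_U(t)$ and $\lambda_V(s)=\lambda_V(t)$ for $s\ge t$ (this freezing does not affect the process up to time $t$). Let $\gamma(s)=(1+\lambda_U(s))|U|+(1+\lambda_V(s))|V|$, let $\xi$ be a Poisson point process on $(0,\infty)$ with rate $\gamma$, and let $\bar\xi=\xi\cup\{0\}$. The process $X$ jumps at the ticks $s\in\xi$ only, according to the stochastic matrix $K^{(s)}$ with $K^{(s)}(x,x\cup\{i\})=\lambda_U(s)/\gamma(s)$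 for $i\in U\setminus x$ and $=\lambda_V(s)/\gamma(s)$ for $i\in V\setminus x$ (if $x\cup\{i\}$ is independent), $K^{(s)}(x,x\setminus\{i\})=1/\gamma(s)$ for $i\in x$, and $K^{(s)}(x,y)=0$ for all other $y\ne x$. Let $$T_v(s)=\inf\{r\ge s: X(r)=v\},\qquad T_u^\circlearrowleft(s)=\inf\{r>s: X(r)=u,\ \xi((s,r])>0\},\qquad T_v=T_v(0),$$ $$S=\inf\{s\in\bar\xi: X(s)=u,\ T_v(s)<T_u^\circlearrowleft(s)\}.$$ Write $\delta\hat T_v(s)$, $\delta\hat T_u(s)$, $\delta\hat T^\circlearrowleft_u(s)$ for the number of ticks after $s$ until the first visit to $v$ at or after time $s$, the first visit to $u$ at or after time $s$, and the first return to $u$, respectively; $P_u$ is the law with $X(0)=u$; and $\check\varepsilon(s)$ is the probability that the time-homogeneous chain with transition matrix $K^{(s)}$ started from $u$ hits $v$ before it returns to $u$ (staying at $u$ for one step is a return). **Conditions.** Say that *parameters can be chosen at $\tau$* if there are $C,k,m\in\{1,2,\dots\}$, $\delta s>0$ and measurable sets $\Xi$ of clock realisations, all depending on $\lambda$, such that $P(\xi\in\Xi)\to1$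 and, as $\lambda\to\infty$ (with $t=M\tau$): - (i) $\check\varepsilon(t)\,C=o(1)$; - (ii) $\gamma(s+\delta s)=\gamma(s)[1+o(1)]$ uniformly in $s\in[0,t]$; - (iii) $\gamma(t)\,\check\varepsilon(t+\delta s)\,\delta s=o(1)\int_0^{t}\check\varepsilon(s)\gamma(s)\,ds$; - (iv) $P(N_t>m)=o(1)$, where $N_t$ is the number of $s\in\bar\xi\cap[0,t]$ with $\xi((s,s+\delta s))<k$; - (v) $(1-\check\varepsilon(t))^m=1-o(1)$; - (I) $E\big[\delta\hat T^\circlearrowleft_u(s)\mathbf 1_{\{\delta\hat T^\circlearrowleft_u(s)\le C+1\}}\,\big|\,\xi,\,X(s)=u,\,\delta\hat T^\circlearrowleft_u(s)<\delta\hat T_v(s)\big]=1+o(1)$ uniformly in $\xi\in\Xi$ and $s\in\bar\xi\cap[0,t]$; - (II) $C\,P\big(\delta\hat T^\circlearrowleft_u(s)>C+1\,\big|\,\xi,\,X(s)=u,\,\delta\hat T^\circlearrowleft_u(s)<\delta\hat T_v(s)\big)=o(1)$ uniformly in the same sense; - (III) $\sup_{x\notin\{u,v\}}P\big(\delta\hat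 T_u(s)>C\,\big|\,\xi,\,X(s)=x,\,\delta\hat T_u(s)<\delta\hat T_v(s)\big)=o(1)$ uniformly in the same sense (terms that condition on a null event count as $0$); - (IV) $P\big(\delta\hat T_v(s)>k\,\big|\,\xi,\,X(s)=u,\,\delta\hat T_v(s)<\delta\hat T^\circlearrowleft_u(s)\big)=o(1)$ uniformly in all $\xi$ and all $s\in\bar\xi\cap[0,t]$ with $\xi((s,s+\delta s))\ge k$. Assume moreover - (V) for every sequence $\lambda_n\to\infty$ there is a subsequence $\lambda_{n(i)}$ such that, for all but at most countably many $\tau\in[0,\infty)$, $P_u(S\le M\tau<T_v)\to0$ along $\lambda=\lambda_{n(i)}$. **Claim.** For every sequence $\lambda_n\to\infty$ there is a subsequence $\lambda_{n(i)}$ such that, for all but at most countably many $\tau\in[0,\infty)$, the following holds. Suppose that parameters can be chosen at $\tau$, that along $\lambda=\lambda_{n(i)}$ $$\check\varepsilon(M\tau)\int_0^{M\tau}\gamma(s)\,ds=O(1),$$ and that either $g_V(2x)=O(g_V(x))$ as $x\to\infty$ (for instance $g_V(x)\asymp x^{\beta_V}$), or $\gamma(M\tau)=O(\gamma(s))$ uniformly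 in $s\in[0,M\tau]$ along $\lambda=\lambda_{n(i)}$. Then, for $\lambda=\lambda_{n(i)}$ and $i\to\infty$, $$P_u(T_v>M\tau)\le[1-o(1)]\,e^{-\int_0^{M\tau}\check\varepsilon(s)\gamma(s)\,ds}+o(1),\qquad P_u(T_v>M\tau)\ge[1-o(1)]\,e^{-\int_0^{M\tau}\check\varepsilon(s)\gamma(s)\,ds}.$$ -/

import Mathlib

open Filter Topology MeasureTheory ProbabilityTheory Asymptotics
open scoped ENNReal NNReal

namespace HardCore

/-- A finite bipartite graph on the vertex set `W`, with parts `U` and `V = Uᶜ`. -/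
structure BipartiteGraph (W : Type*) [Fintype W] [DecidableEq W] where
  /-- the underlying simple graph -/
  graph : SimpleGraph W
  /-- the first part; the second part is its complement -/
  U : Finset W
  /-- every edge joins a vertex of `U` to a vertex outside `U` -/
  bipartite : graph.IsBipartiteWith (U : Set W) ((Uᶜ : Finset W) : Set W)

/-- Time-dependent activation rates: `rateU s` and `rateV s` are the rates at time `s` at which an
inactive vertex of `U`, respectively of `V`, attempts to become active. -/
structure Rates where
  /-- activation rate in `U` -/
  rateU : ℝ → ℝ≥0
  /-- activation rate in `V` -/
  rateV : ℝ → ℝ≥0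

/-- The rates `λ_U(s) = g_U([c_U λ - μ_U s]⁺)` and `λ_V(s) = g_V(c_V λ + μ_V s)` for `s ≤ t`,
frozen at their values at time `t` for `s ≥ t`. (`Real.toNNReal` is the positive part.) -/
noncomputable def frozenRates (gU gV : ℝ≥0 → ℝ≥0) (cU cV μU μV lam t : ℝ) : Rates where
  rateU s := gU (cU * lam - μU * min s t).toNNReal
  rateV s := gV (cV * lam + μV * min s t).toNNReal

section Dynamics

variable {W : Type*} [Fintype W] [DecidableEq W]

/-- The hard-core configurations, given as the sets of active vertices: independent sets. -/
def Config (B : BipartiteGraph W) : Type _ :=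
  {x : Finset W // B.graph.IsIndepSet (x : Set W)}

variable (B : BipartiteGraph W)

instance : Finite (Config B) :=
  inferInstanceAs (Finite {x : Finset W // B.graph.IsIndepSet (x : Set W)})

noncomputable instance : Fintype (Config B) := Fintype.ofFinite _

noncomputable instance : DecidableEq (Config B) := Classical.decEq _

instance : MeasurableSpace (Config B) := ⊤

instance : DiscreteMeasurableSpace (Config B) := ⟨fun _ => trivial⟩

/-- The configuration in which exactly the vertices of `U` are active. -/
def allU : Config B := ⟨B.U, by
  intro a ha b hb _ hadj
  have hd := B.bipartite.disjoint
  rcases B.bipartite.mem_of_adj hadj with h | h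
  · exact Set.disjoint_left.1 hd hb h.2
  · exact Set.disjoint_left.1 hd ha h.1⟩

/-- The configuration in which exactly the vertices of `V` are active. -/
def allV : Config B := ⟨B.Uᶜ, by
  intro a ha b hb _ hadj
  have hd := B.bipartite.disjoint
  rcases B.bipartite.mem_of_adj hadj with h | h
  · exact Set.disjoint_left.1 hd h.1 ha
  · exact Set.disjoint_left.1 hd h.2 hb⟩

variable (R : Rates)

/-- The rate `γ(s) = (1 + λ_U(s)) |U| + (1 + λ_V(s)) |V|` of the Poisson clock. -/
noncomputable def clockRate (s : ℝ) : ℝ≥0 :=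
  (1 + R.rateU s) * (B.U.card : ℝ≥0) + (1 + R.rateV s) * ((B.Uᶜ).card : ℝ≥0)

/-- The activation rate of vertex `i` at time `s`. -/
noncomputable def birthRate (s : ℝ) (i : W) : ℝ≥0 := if i ∈ B.U then R.rateU s else R.rateV s

/-- The transition probability `K^{(s)}(x, y)` for `y ≠ x`: it is `λ_U(s)/γ(s)` or `λ_V(s)/γ(s)` if
`y` arises from `x` by activating one vertex of `U` or `V`, it is `1/γ(s)` if `y` arises from `x` by
deactivating one vertex, and `0` otherwise. (At most one term of the sum is nonzero, and the value
at `y = x` is `0`.) -/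
noncomputable def moveProb (s : ℝ) (x y : Config B) : ℝ≥0 :=
  (∑ i : W, ((if i ∉ x.1 ∧ y.1 = insert i x.1 then birthRate B R s i else 0)
    + (if i ∈ x.1 ∧ y.1 = x.1.erase i then 1 else 0))) / clockRate B R s

theorem sum_indicator_le (f : Config B → Finset W) (hf : Function.Injective f) (z : Finset W)
    (c : ℝ≥0) : ∑ y : Config B, (if f y = z then c else 0) ≤ c := by
  by_cases h : ∃ y, f y = z
  · obtain ⟨y, rfl⟩ := h
    simp [hf.eq_iff]
  · push Not at h
    simp [h]

theorem sum_moveProb_le_one (s : ℝ) (x : Config B) : ∑ y : Config B, moveProb B R s x y ≤ 1 := by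
  unfold moveProb
  rw [← Finset.sum_div]
  refine div_le_one_of_le₀ ?_ (by positivity)
  rw [Finset.sum_comm]
  have h1 : ∀ i : W, ∑ y : Config B,
      ((if i ∉ x.1 ∧ y.1 = insert i x.1 then birthRate B R s i else 0)
        + (if i ∈ x.1 ∧ y.1 = x.1.erase i then 1 else 0)) ≤ 1 + birthRate B R s i := by
    intro i
    rw [Finset.sum_add_distrib]
    by_cases hi : i ∈ x.1
    · have := sum_indicator_le B (fun y => y.1) Subtype.val_injective (x.1.erase i) 1
      simp only [hi, not_true_eq_false, false_and, if_false, Finset.sum_const_zero, true_and,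
        zero_add]
      exact this.trans (le_add_of_nonneg_right (by positivity))
    · have := sum_indicator_le B (fun y => y.1) Subtype.val_injective (insert i x.1)
        (birthRate B R s i)
      simp only [hi, not_false_eq_true, true_and, false_and, if_false, Finset.sum_const_zero,
        add_zero]
      exact this.trans (le_add_of_nonneg_left (by positivity))
  refine (Finset.sum_le_sum fun i _ => h1 i).trans (le_of_eq ?_)
  rw [← Finset.sum_add_sum_compl B.U]
  have e1 : ∑ i ∈ B.U, (1 + birthRate B R s i) = ∑ i ∈ B.U, (1 + R.rateU s) :=
    Finset.sum_congr rfl fun i hi => by simp [birthRate, hi]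
  have e2 : ∑ i ∈ B.Uᶜ, (1 + birthRate B R s i) = ∑ i ∈ B.Uᶜ, (1 + R.rateV s) :=
    Finset.sum_congr rfl fun i hi => by simp [birthRate, Finset.mem_compl.1 hi]
  rw [e1, e2, Finset.sum_const, Finset.sum_const, clockRate, nsmul_eq_mul, nsmul_eq_mul]
  ring

/-- The full transition probability `K^{(s)}(x, y)`; the value at `y = x` makes the matrix
stochastic. -/
noncomputable def transProb (s : ℝ) (x y : Config B) : ℝ≥0 :=
  moveProb B R s x y + if y = x then 1 - ∑ z : Config B, moveProb B R s x z else 0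

theorem sum_transProb (s : ℝ) (x : Config B) : ∑ y : Config B, transProb B R s x y = 1 := by
  unfold transProb
  rw [Finset.sum_add_distrib, Finset.sum_ite_eq' Finset.univ x]
  simp [add_tsub_cancel_of_le (sum_moveProb_le_one B R s x)]

/-- The transition law `K^{(s)}(x, ·)`. -/
noncomputable def step (s : ℝ) (x : Config B) : PMF (Config B) :=
  PMF.ofFintype (fun y => (transProb B R s x y : ℝ≥0∞)) (by
    rw [← ENNReal.ofNNReal_finsetSum, sum_transProb, ENNReal.coe_one])

/-- The law of the discrete-time Markov chain on configurations that starts from `x` and makes its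
`(j+1)`-st step with the transition law `P j`. -/
noncomputable def chainLaw (P : ℕ → Config B → PMF (Config B)) (x : Config B) :
    Measure (ℕ → Config B) :=
  let κ : (n : ℕ) → Kernel ((i : Finset.Iic n) → (fun _ : ℕ => Config B) i) (Config B) :=
    fun n => Kernel.ofFunOfCountable fun h => (P n (h ⟨n, Finset.mem_Iic.2 le_rfl⟩)).toMeasure
  have : ∀ n, IsMarkovKernel (κ n) := fun n =>
    ⟨fun h => PMF.toMeasure.isProbabilityMeasure (P n (h ⟨n, Finset.mem_Iic.2 le_rfl⟩))⟩
  Kernel.traj (X := fun _ : ℕ => Config B) κ 0 (fun _ => x)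

/-! ### The clock

A realisation of the clock is the sequence `ξ : ℕ → ℝ` with `ξ 0 = 0` and with `ξ 1 < ξ 2 < ⋯` the
ticks, so that the range of `ξ` is the set of ticks together with the time `0`. -/

/-- `ξ` starts at `0`, is strictly increasing and is locally finite. -/
def IsClock (ξ : ℕ → ℝ) : Prop := ξ 0 = 0 ∧ StrictMono ξ ∧ Tendsto ξ atTop atTop

/-- The law of an i.i.d. sequence of exponential variables of mean one. -/
noncomputable def expNoise : Measure (ℕ → ℝ) := Measure.infinitePi fun _ : ℕ => expMeasure 1

/-- The Poisson point process with rate function `γ`, by the usual time change: the `n`-th tick is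
the first time `r` at which `∫_0^r γ` reaches the `n`-th partial sum of the exponential
sequence. -/
noncomputable def clock (e : ℕ → ℝ) (n : ℕ) : ℝ :=
  sInf {r : ℝ | 0 ≤ r ∧ ∑ i ∈ Finset.range n, e i ≤ ∫ q in (0 : ℝ)..r, (clockRate B R q : ℝ)}

/-- The conditional law, given the clock `ξ`, of the states at the times `ξ n, ξ (n+1), …` when the
state at time `ξ n` is `x`. -/
noncomputable def quenchedLaw (ξ : ℕ → ℝ) (n : ℕ) (x : Config B) : Measure (ℕ → Config B) :=
  chainLaw B (fun j => step B R (ξ (n + j + 1))) x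

/-- The probability of an event `A ξ ω`, depending on the clock `ξ` and on the sequence `ω` of the
states at the times `ξ 0, ξ 1, …`, for the process started from `u` at time `0`. -/
noncomputable def probFromU (A : (ℕ → ℝ) → (ℕ → Config B) → Prop) : ℝ≥0∞ :=
  ∫⁻ e, quenchedLaw B R (clock B R e) 0 (allU B) {ω | A (clock B R e) ω} ∂expNoise

/-! ### Hitting times counted in ticks -/

variable {B}

/-- The number of steps until the first visit to `z`, the initial state included (`⊤` if never). -/
noncomputable def hitTick (z : Config B) (ω : ℕ → Config B) : ℕ∞ :=
  sInf ((fun j : ℕ => (j : ℕ∞)) '' {j | ω j = z})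

/-- The number of steps until the first return to `z`, the initial state excluded (`⊤` if
never). -/
noncomputable def returnTick (z : Config B) (ω : ℕ → Config B) : ℕ∞ :=
  sInf ((fun j : ℕ => (j : ℕ∞)) '' {j | 1 ≤ j ∧ ω j = z})

/-! ### The continuous-time process -/

/-- The state `X(r)` at time `r`: the state after as many steps as there are ticks in `(0, r]`. -/
noncomputable def stateAt (ξ : ℕ → ℝ) (ω : ℕ → Config B) (r : ℝ) : Config B :=
  ω {n : ℕ | ξ (n + 1) ≤ r}.ncard

/-- `T_z(s) = inf {r ≥ s : X(r) = z}`. -/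
noncomputable def hitTime (z : Config B) (ξ : ℕ → ℝ) (ω : ℕ → Config B) (s : ℝ) : ℝ≥0∞ :=
  sInf (ENNReal.ofReal '' {r | s ≤ r ∧ stateAt ξ ω r = z})

/-- `T_z^↺(s) = inf {r > s : X(r) = z and there is a tick in (s, r]}`. -/
noncomputable def returnTime (z : Config B) (ξ : ℕ → ℝ) (ω : ℕ → Config B) (s : ℝ) : ℝ≥0∞ :=
  sInf (ENNReal.ofReal ''
    {r | s < r ∧ stateAt ξ ω r = z ∧ ∃ n : ℕ, s < ξ (n + 1) ∧ ξ (n + 1) ≤ r})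

variable (B)

/-- The starting time `S` of the first successful trial: the first `s`, either `0` or a tick, with
`X(s) = u` and `T_v(s) < T_u^↺(s)`. -/
noncomputable def firstSuccess (ξ : ℕ → ℝ) (ω : ℕ → Config B) : ℝ≥0∞ :=
  sInf (ENNReal.ofReal '' {s | s ∈ Set.range ξ ∧ stateAt ξ ω s = allU B ∧
    hitTime (allV B) ξ ω s < returnTime (allU B) ξ ω s})

/-- `P_u(T_v > t)`. -/
noncomputable def crossoverTail (t : ℝ) : ℝ :=
  (probFromU B R fun ξ ω => ENNReal.ofReal t < hitTime (allV B) ξ ω 0).toReal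

/-- `P_u(S ≤ t < T_v)`. -/
noncomputable def lastExcursionProb (t : ℝ) : ℝ :=
  (probFromU B R fun ξ ω => firstSuccess B ξ ω ≤ ENNReal.ofReal t ∧
    ENNReal.ofReal t < hitTime (allV B) ξ ω 0).toReal

/-- `ε̌(s) = P_u^{(s)}(T_v < T_u^↺)`, for the time-homogeneous chain with the rates
`λ_U(s)`, `λ_V(s)`. -/
noncomputable def epsCheck (s : ℝ) : ℝ :=
  (chainLaw B (fun _ => step B R s) (allU B)).real
    {ω | hitTick (allV B) ω < returnTick (allU B) ω}

/-- The number `ξ((s, s'))` of ticks strictly between the times `s ≥ 0` and `s'`. -/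
noncomputable def ticksBetween (ξ : ℕ → ℝ) (s s' : ℝ) : ℕ∞ :=
  Set.encard {n : ℕ | s < ξ (n + 1) ∧ ξ (n + 1) < s'}

/-- The number `N_t` of `s ∈ [0, t]`, either `0` or a tick, with `ξ((s, s + δ)) < k`. -/
noncomputable def sparseCount (ξ : ℕ → ℝ) (t δ : ℝ) (k : ℕ) : ℕ∞ :=
  Set.encard {n : ℕ | ξ n ≤ t ∧ ticksBetween ξ (ξ n) (ξ n + δ) < (k : ℕ∞)}

/-- The conditional law, given the clock `ξ`, of the chain started from `u` at time `ξ n`,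
conditioned on returning to `u` before hitting `v`. -/
noncomputable def failedTrialLaw (ξ : ℕ → ℝ) (n : ℕ) : Measure (ℕ → Config B) :=
  cond (quenchedLaw B R ξ n (allU B)) {ω | returnTick (allU B) ω < hitTick (allV B) ω}

/-- The conditional law, given the clock `ξ`, of the chain started from `u` at time `ξ n`,
conditioned on hitting `v` before returning to `u`. -/
noncomputable def successfulTrialLaw (ξ : ℕ → ℝ) (n : ℕ) : Measure (ℕ → Config B) :=
  cond (quenchedLaw B R ξ n (allU B)) {ω | hitTick (allV B) ω < returnTick (allU B) ω}

/-- The conditional law, given the clock `ξ`, of the chain started from `x` at time `ξ n`,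
conditioned on hitting `u` before `v`. -/
noncomputable def fallBackLaw (ξ : ℕ → ℝ) (n : ℕ) (x : Config B) : Measure (ℕ → Config B) :=
  cond (quenchedLaw B R ξ n x) {ω | hitTick (allU B) ω < hitTick (allV B) ω}

end Dynamics

section Conditions

variable {W : Type*} [Fintype W] [DecidableEq W]

/-- The requirements on parameters `C`, `k`, `m`, `δ` and on sets `Ξ` of clocks, all depending on
`lam → ∞`, for the rates `R lam` and the time horizon `t lam`: `Ξ` has high probability, the
conditions (i)–(v) on the choice of the parameters, and the short-time regularity conditions
I–IV. -/
structure GoodParameters (B : BipartiteGraph W) (R : ℝ → Rates) (t : ℝ → ℝ)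
    (C k m : ℝ → ℕ) (δ : ℝ → ℝ) (Ξ : ℝ → Set (ℕ → ℝ)) : Prop where
  C_pos : ∀ lam, 0 < C lam
  k_pos : ∀ lam, 0 < k lam
  m_pos : ∀ lam, 0 < m lam
  δ_pos : ∀ lam, 0 < δ lam
  measurable_Ξ : ∀ lam, MeasurableSet (Ξ lam)
  highProb_Ξ :
    Tendsto (fun lam => expNoise {e | clock B (R lam) e ∈ Ξ lam}) atTop (𝓝 1)
  /-- (i) `ε̌(t) C = o(1)` -/
  cond_i : Tendsto (fun lam => epsCheck B (R lam) (t lam) * C lam) atTop (𝓝 0)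
  /-- (ii) `γ(s + δ) = γ(s) [1 + o(1)]` uniformly in `s ∈ [0, t]` -/
  cond_ii : ∀ η > 0, ∀ᶠ lam in atTop, ∀ s ∈ Set.Icc 0 (t lam),
    |(clockRate B (R lam) (s + δ lam) : ℝ) - clockRate B (R lam) s|
      ≤ η * clockRate B (R lam) s
  /-- (iii) `γ(t) ε̌(t + δ) δ = o(1) ∫_0^t ε̌ γ` -/
  cond_iii : (fun lam => (clockRate B (R lam) (t lam) : ℝ)
      * epsCheck B (R lam) (t lam + δ lam) * δ lam) =o[atTop]
    fun lam => ∫ s in (0 : ℝ)..(t lam), epsCheck B (R lam) s * (clockRate B (R lam) s : ℝ)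
  /-- (iv) `P(N_t > m) = o(1)` -/
  cond_iv : Tendsto (fun lam => expNoise
    {e | (m lam : ℕ∞) < sparseCount (clock B (R lam) e) (t lam) (δ lam) (k lam)}) atTop (𝓝 0)
  /-- (v) `(1 - ε̌(t))^m = 1 - o(1)` -/
  cond_v : Tendsto (fun lam => (1 - epsCheck B (R lam) (t lam)) ^ m lam) atTop (𝓝 1)
  /-- I: truncated mean of the number of ticks in a failed trial -/
  cond_I : ∀ η > 0, ∀ᶠ lam in atTop, ∀ ξ ∈ Ξ lam, IsClock ξ → ∀ n, ξ n ≤ t lam →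
    |∫ ω, (if returnTick (allU B) ω ≤ (C lam + 1 : ℕ)
        then ((returnTick (allU B) ω).toNat : ℝ) else 0) ∂(failedTrialLaw B (R lam) ξ n) - 1| ≤ η
  /-- II: tail of the number of ticks in a failed trial -/
  cond_II : ∀ η > 0, ∀ᶠ lam in atTop, ∀ ξ ∈ Ξ lam, IsClock ξ → ∀ n, ξ n ≤ t lam →
    C lam * (failedTrialLaw B (R lam) ξ n).real
      {ω | ((C lam + 1 : ℕ) : ℕ∞) < returnTick (allU B) ω} ≤ η
  /-- III: from any `x ∉ {u, v}`, the chain conditioned to hit `u` before `v` does so quickly -/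
  cond_III : ∀ η > 0, ∀ᶠ lam in atTop, ∀ ξ ∈ Ξ lam, IsClock ξ → ∀ n, ξ n ≤ t lam →
    ∀ x : Config B, x ≠ allU B → x ≠ allV B →
      (fallBackLaw B (R lam) ξ n x).real {ω | (C lam : ℕ∞) < hitTick (allU B) ω} ≤ η
  /-- IV: successful trials that start at an `s` with `ξ((s, s + δ)) ≥ k` are short -/
  cond_IV : ∀ η > 0, ∀ᶠ lam in atTop, ∀ ξ, IsClock ξ → ∀ n, ξ n ≤ t lam →
    (k lam : ℕ∞) ≤ ticksBetween ξ (ξ n) (ξ n + δ lam) →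
      (successfulTrialLaw B (R lam) ξ n).real {ω | (k lam : ℕ∞) < hitTick (allV B) ω} ≤ η

/-- V: the last excursion is short, in the sense that every sequence going to infinity has a
subsequence along which `P_u(S ≤ M τ < T_v) = o(1)` for all but at most countably many `τ ≥ 0`.
Here `R lam τ` are the rates for the parameter `lam` and the time horizon `M lam * τ`. -/
def ShortLastExcursion (B : BipartiteGraph W) (R : ℝ → ℝ → Rates) (M : ℝ → ℝ) : Prop :=
  ∀ l : ℕ → ℝ, Tendsto l atTop atTop → ∃ φ : ℕ → ℕ, StrictMono φ ∧
    ∃ D : Set ℝ, D.Countable ∧ ∀ τ : ℝ, 0 ≤ τ → τ ∉ D →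
      Tendsto (fun i => lastExcursionProb B (R (l (φ i)) τ) (M (l (φ i)) * τ)) atTop (𝓝 0)

end Conditions

end HardCore

/-! Every visit of the chain to `u` at a tick starts a trial, which succeeds if `v` is hit before
the return to `u`. If no trial started up to time `t` succeeds, then `v` has not been hit by `t`;
conversely, if `v` has not been hit by `t`, then either no such trial succeeded or `S ≤ t < T_v`,
and condition V makes the latter negligible (`lt_hitTime_of_noSuccess`,
`noSuccess_or_firstSuccess_le`). It remains to estimate, given the clock `ξ`, the probability that
all these trials fail, and then to average over `ξ`.

Comparison of environments. The dynamics is attractive for the order "fewer active vertices in `U`,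
more in `V`", because the graph is bipartite. The escape probability `h_s` of the homogeneous chain
at time `s` is therefore increasing, and since `λ_U` decreases and `λ_V` increases, `h_s` is
subharmonic for all later rates and superharmonic for all earlier ones, away from `u` and `v`.
Moreover `γ ε̌` is the generator applied to `h_s` at `u`, so `γ ε̌` is monotone
(`clockRate_mul_epsCheck_le`). A trial started at `ξ n` thus succeeds with probability at least
`ε̌(ξ (n+1))`, while its chance of success within a given time window is controlled by the rates at
the end of the window. The bound `γ(t) = O(γ(s))`, assumed or derived from doubling
(`exists_clockRate_le_of_doubling`), turns monotonicity of `γ ε̌` into `ε̌(s) ≤ A ε̌(t)`.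

Lower bound. Charging a factor `1 - p_n` at every tick, whether or not the chain is at `u`, gives `∏
(1 - p_n)` (`le_survivalProb`). By IV, successes at ticks followed by at least `k` ticks within `δ`
are essentially confined to that window, so `p_n` is at most about `ε̌(ξ (n+1) + δ)`; by (iv) and
(v) the remaining ticks cost nothing.

Upper bound. If the chain were at `u` at every tick, `exp(-∑ ε̌(ξ (n+1)))` would be an upper bound.
Each tick spent elsewhere loses at most `A ε̌(t)`, and I, II, III make the mean number of extra
ticks per failed trial `o(1)` (`sum_failureAfterSet_le`); the total loss is `o(1) · ε̌(t) ∫ γ =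
o(1)` (`survivalProb_le`).

Averaging. Sums over the ticks concentrate: their compensated versions are martingales with variance
at most `sup h · ∫ h γ`, here of order `ε̌(t) → 0` (`measure_abs_clock_sum_sub_integral_le`). So
both exponents become `∫ ε̌ γ`, where the shift by `δ` is removed with (ii) and (iii). -/

namespace HardCore

/-! ### Path measures of time-inhomogeneous chains and first-step decomposition -/

section MarkovChain

variable {W : Type*} [Fintype W] [DecidableEq W] {B : BipartiteGraph W}

/-- The path that starts at `x` and continues with `ω`. -/
def consPath (x : Config B) (ω : ℕ → Config B) : ℕ → Config B
  | 0 => x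
  | n + 1 => ω n

@[simp] theorem consPath_zero (x : Config B) (ω : ℕ → Config B) : consPath x ω 0 = x := rfl

@[simp] theorem consPath_succ (x : Config B) (ω : ℕ → Config B) (n : ℕ) :
    consPath x ω (n + 1) = ω n := rfl

theorem measurable_consPath (x : Config B) : Measurable (consPath x) := by
  refine measurable_pi_lambda _ fun n => ?_
  cases n with
  | zero => exact measurable_const
  | succ n => exact measurable_pi_apply n

/-- The history kernels whose trajectory measure is `chainLaw`. -/
noncomputable def historyKernel (P : ℕ → Config B → PMF (Config B)) (n : ℕ) :
    Kernel ((i : Finset.Iic n) → (fun _ : ℕ => Config B) i) (Config B) :=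
  Kernel.ofFunOfCountable fun h => (P n (h ⟨n, Finset.mem_Iic.2 le_rfl⟩)).toMeasure

instance (P : ℕ → Config B → PMF (Config B)) (n : ℕ) : IsMarkovKernel (historyKernel P n) :=
  ⟨fun h => PMF.toMeasure.isProbabilityMeasure (P n (h ⟨n, Finset.mem_Iic.2 le_rfl⟩))⟩

theorem chainLaw_eq_traj (P : ℕ → Config B → PMF (Config B)) (x : Config B) :
    chainLaw B P x = Kernel.traj (X := fun _ : ℕ => Config B) (historyKernel P) 0 (fun _ => x) :=
  rfl

instance (P : ℕ → Config B → PMF (Config B)) (x : Config B) :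
    IsProbabilityMeasure (chainLaw B P x) := by
  rw [chainLaw_eq_traj]; infer_instance

theorem chainLaw_map_frestrictLe (P : ℕ → Config B → PMF (Config B)) (x : Config B) (n : ℕ) :
    (chainLaw B P x).map (Preorder.frestrictLe (π := fun _ : ℕ => Config B) n)
      = Kernel.partialTraj (X := fun _ : ℕ => Config B) (historyKernel P) 0 n (fun _ => x) := by
  rw [chainLaw_eq_traj, Kernel.traj_map_frestrictLe_apply]

/-- The cylinder of the paths that agree with `a` up to time `n`. -/
def cylinderSet (n : ℕ) (a : ℕ → Config B) : Set (ℕ → Config B) := {ω | ∀ i ≤ n, ω i = a i}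

theorem measurableSet_cylinderSet (n : ℕ) (a : ℕ → Config B) :
    MeasurableSet (cylinderSet n a) := by
  have : cylinderSet n a = ⋂ i, ⋂ (_ : i ≤ n), (fun ω : ℕ → Config B => ω i) ⁻¹' {a i} := by
    ext ω; simp [cylinderSet]
  rw [this]
  exact MeasurableSet.iInter fun i => MeasurableSet.iInter fun _ =>
    measurable_pi_apply i (MeasurableSet.singleton _)

theorem cylinderSet_eq_preimage (n : ℕ) (a : ℕ → Config B) :
    cylinderSet n a = Preorder.frestrictLe (π := fun _ : ℕ => Config B) n ⁻¹'
      {Preorder.frestrictLe (π := fun _ : ℕ => Config B) n a} := by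
  ext ω
  simp only [cylinderSet, Set.mem_ofPred_eq, Set.mem_preimage, Set.mem_singleton_iff, funext_iff,
    Preorder.frestrictLe_apply, Subtype.forall, Finset.mem_Iic]

/-- Two finite measures on path space that agree on all cylinders are equal. -/
theorem ext_of_cylinderSet {μ ν : Measure (ℕ → Config B)} [IsFiniteMeasure μ]
    [IsFiniteMeasure ν] (h : ∀ n a, μ (cylinderSet n a) = ν (cylinderSet n a)) : μ = ν := by
  have key : ∀ n, μ.map (Preorder.frestrictLe (π := fun _ : ℕ => Config B) n)
      = ν.map (Preorder.frestrictLe (π := fun _ : ℕ => Config B) n) := by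
    intro n
    refine Measure.ext_of_singleton fun z => ?_
    obtain ⟨a, rfl⟩ : ∃ a : ℕ → Config B, Preorder.frestrictLe (π := fun _ : ℕ => Config B) n a
        = z := by
      classical
      refine ⟨fun i => if hi : i ≤ n then z ⟨i, Finset.mem_Iic.2 hi⟩ else allU B, ?_⟩
      ext i
      simp [Finset.mem_Iic.1 i.2]
    rw [Measure.map_apply (Preorder.measurable_frestrictLe n) (MeasurableSet.singleton _),
      Measure.map_apply (Preorder.measurable_frestrictLe n) (MeasurableSet.singleton _),
      ← cylinderSet_eq_preimage, h]
  have hP := isProjectiveMeasureFamily_map_restrict (X := fun (i : ℕ) (ω : ℕ → Config B) => ω i)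
    (P := ν) (fun t => (measurable_pi_apply t).aemeasurable)
  have h1 := (isProjectiveLimit_nat_iff (X := fun _ : ℕ => Config B) hP μ).2 key
  exact h1.unique fun I => rfl

theorem chainLaw_cylinderSet_zero (P : ℕ → Config B → PMF (Config B)) (x : Config B)
    (a : ℕ → Config B) : chainLaw B P x (cylinderSet 0 a) = if a 0 = x then 1 else 0 := by
  rw [cylinderSet_eq_preimage, ← Measure.map_apply (Preorder.measurable_frestrictLe 0)
    (MeasurableSet.singleton _), chainLaw_map_frestrictLe, Kernel.partialTraj_self]
  rw [Kernel.id_apply, Measure.dirac_apply' _ (MeasurableSet.singleton _)]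
  by_cases h : a 0 = x
  · rw [if_pos h, Set.indicator_of_mem, Pi.one_apply]
    rw [Set.mem_singleton_iff]
    ext ⟨i, hi⟩
    obtain rfl : i = 0 := by simpa using hi
    simp [h]
  · rw [if_neg h, Set.indicator_of_notMem]
    rw [Set.mem_singleton_iff]
    intro h'
    exact h (congrFun h' ⟨0, by simp⟩).symm

/-- The one-step extension has the Dirac mass at the past as marginal on the first coordinates and
the step law as marginal on the new one. As the past is almost surely constant, these two marginals
determine the mass of a point. -/
theorem partialTraj_succ_self_singleton (P : ℕ → Config B → PMF (Config B)) (n : ℕ)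
    (a : ℕ → Config B) (z : (i : Finset.Iic n) → (fun _ : ℕ => Config B) i) :
    Kernel.partialTraj (X := fun _ : ℕ => Config B) (historyKernel P) n (n + 1) z
        {Preorder.frestrictLe (π := fun _ : ℕ => Config B) (n + 1) a}
      = Set.indicator {Preorder.frestrictLe (π := fun _ : ℕ => Config B) n a}
          (fun _ => P n (a n) (a (n + 1))) z := by
  have hS : MeasurableSet {Preorder.frestrictLe (π := fun _ : ℕ => Config B) (n + 1) a} :=
    MeasurableSet.singleton _
  set m := Kernel.partialTraj (X := fun _ : ℕ => Config B) (historyKernel P) n (n + 1) z with hm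
  have h1 : m.map (Preorder.frestrictLe₂ (π := fun _ : ℕ => Config B) n.le_succ)
      = Measure.dirac z := by
    have := Kernel.partialTraj_map_frestrictLe₂_apply (X := fun _ : ℕ => Config B)
      (κ := historyKernel P) (a := n) z n.le_succ
    rw [Kernel.partialTraj_self, Kernel.id_apply] at this
    exact this
  have h2 : m.map (fun x => x ⟨n + 1, Finset.mem_Iic.2 le_rfl⟩) = historyKernel P n z := by
    have := Kernel.map_partialTraj_succ_self (X := fun _ : ℕ => Config B)
      (κ := historyKernel P) n
    rw [← this, Kernel.map_apply _ (measurable_pi_apply _)]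
  have e1 : m (Preorder.frestrictLe₂ (π := fun _ : ℕ => Config B) n.le_succ ⁻¹' {z}ᶜ) = 0 := by
    refine (Measure.map_apply (Preorder.measurable_frestrictLe₂ (X := fun _ : ℕ => Config B) _)
      (MeasurableSet.singleton z).compl).symm.trans ?_
    rw [h1]
    simp
  have e2 : m ((fun x => x ⟨n + 1, Finset.mem_Iic.2 le_rfl⟩) ⁻¹' {a (n + 1)})
      = P n (z ⟨n, Finset.mem_Iic.2 le_rfl⟩) (a (n + 1)) := by
    rw [← Measure.map_apply (measurable_pi_apply _) (MeasurableSet.singleton _), h2]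
    exact PMF.toMeasure_apply_singleton _ _ (MeasurableSet.singleton _)
  by_cases hz : z = Preorder.frestrictLe (π := fun _ : ℕ => Config B) n a
  · rw [Set.indicator_of_mem (by exact hz)]
    have e3 : P n (z ⟨n, Finset.mem_Iic.2 le_rfl⟩) (a (n + 1)) = P n (a n) (a (n + 1)) := by
      rw [hz]; rfl
    rw [← e3, ← e2]
    refine measure_congr ?_
    have hae : ∀ᵐ x ∂m, Preorder.frestrictLe₂ (π := fun _ : ℕ => Config B) n.le_succ x = z :=
      e1
    filter_upwards [hae] with x hx
    refine propext ⟨fun h => ?_, fun h => ?_⟩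
    · have h' : x = Preorder.frestrictLe (π := fun _ : ℕ => Config B) (n + 1) a := h
      change x ⟨n + 1, _⟩ = a (n + 1)
      rw [h']; rfl
    · change x = _
      ext ⟨i, hi⟩
      rcases (Finset.mem_Iic.1 hi).lt_or_eq with hlt | rfl
      · have := congrFun (hx.trans hz) ⟨i, Finset.mem_Iic.2 (Nat.lt_succ_iff.1 hlt)⟩
        exact this
      · exact h
  · rw [Set.indicator_of_notMem (by exact hz)]
    refine measure_mono_null ?_ e1
    rintro x hx
    have h' : x = Preorder.frestrictLe (π := fun _ : ℕ => Config B) (n + 1) a := hx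
    change ¬ (_ = z)
    intro h
    apply hz
    rw [← h, h']
    rfl

theorem chainLaw_cylinderSet_succ (P : ℕ → Config B → PMF (Config B)) (x : Config B)
    (a : ℕ → Config B) (n : ℕ) : chainLaw B P x (cylinderSet (n + 1) a)
      = chainLaw B P x (cylinderSet n a) * P n (a n) (a (n + 1)) := by
  rw [cylinderSet_eq_preimage, ← Measure.map_apply (Preorder.measurable_frestrictLe _)
    (MeasurableSet.singleton _), chainLaw_map_frestrictLe,
    Kernel.partialTraj_succ_eq_comp (Nat.zero_le n), Kernel.comp_apply' _ _ _
    (MeasurableSet.singleton _)]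
  simp_rw [partialTraj_succ_self_singleton]
  rw [lintegral_indicator_const (MeasurableSet.singleton _), cylinderSet_eq_preimage,
    ← Measure.map_apply (Preorder.measurable_frestrictLe _) (MeasurableSet.singleton _),
    chainLaw_map_frestrictLe, mul_comm]

theorem chainLaw_cylinderSet (P : ℕ → Config B → PMF (Config B)) (x : Config B)
    (a : ℕ → Config B) (n : ℕ) : chainLaw B P x (cylinderSet n a)
      = (if a 0 = x then 1 else 0) * ∏ i ∈ Finset.range n, P i (a i) (a (i + 1)) := by
  induction n with
  | zero => simp [chainLaw_cylinderSet_zero]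
  | succ n ih => rw [chainLaw_cylinderSet_succ, ih, Finset.prod_range_succ, mul_assoc]

/-- The Markov property at the first step. -/
theorem chainLaw_eq_sum (P : ℕ → Config B → PMF (Config B)) (x : Config B) :
    chainLaw B P x = ∑ y, P 0 x y • (chainLaw B (fun j => P (j + 1)) y).map (consPath x) := by
  have hfin : IsFiniteMeasure
      (∑ y, P 0 x y • (chainLaw B (fun j => P (j + 1)) y).map (consPath x)) := by
    refine ⟨?_⟩
    simp only [Measure.coe_finsetSum, Finset.sum_apply, Measure.smul_apply, smul_eq_mul]
    refine ENNReal.sum_lt_top.2 fun y _ => ENNReal.mul_lt_top ?_ (measure_lt_top _ _)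
    exact lt_of_le_of_lt (PMF.coe_le_one _ _) ENNReal.one_lt_top
  refine ext_of_cylinderSet fun n a => ?_
  simp only [Measure.coe_finsetSum, Finset.sum_apply, Measure.smul_apply, smul_eq_mul,
    Measure.map_apply (measurable_consPath x) (measurableSet_cylinderSet n a)]
  rw [chainLaw_cylinderSet]
  by_cases h0 : a 0 = x
  · rw [if_pos h0, one_mul]
    cases n with
    | zero =>
      have : ∀ y, chainLaw B (fun j => P (j + 1)) y (consPath x ⁻¹' cylinderSet 0 a) = 1 := by
        intro y
        have : consPath x ⁻¹' cylinderSet 0 a = Set.univ := by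
          ext ω; simp [cylinderSet, h0]
        rw [this, measure_univ]
      simp only [this, mul_one, Finset.range_zero, Finset.prod_empty]
      have := (P 0 x).tsum_coe
      rw [tsum_fintype] at this
      exact this.symm
    | succ n =>
      have : consPath x ⁻¹' cylinderSet (n + 1) a = cylinderSet n fun i => a (i + 1) := by
        ext ω
        simp only [cylinderSet, Set.mem_preimage, Set.mem_ofPred_eq]
        constructor
        · intro h i hi
          exact h (i + 1) (by omega)
        · rintro h (_ | i) hi
          · exact h0.symm
          · exact h i (by omega)
      simp only [this, chainLaw_cylinderSet]
      rw [Finset.prod_range_succ']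
      simp [h0, mul_comm]
  · rw [if_neg h0, zero_mul]
    symm
    refine Finset.sum_eq_zero fun y _ => ?_
    have : consPath x ⁻¹' cylinderSet n a = ∅ := by
      ext ω
      simp only [cylinderSet, Set.mem_preimage, Set.mem_ofPred_eq, Set.mem_empty_iff_false,
        iff_false]
      intro h
      exact h0 (h 0 (Nat.zero_le _)).symm
    rw [this, measure_empty, mul_zero]

/-- The probability of an event for the chain with the step laws `P`. -/
noncomputable def pathProb (P : ℕ → Config B → PMF (Config B)) (E : Set (ℕ → Config B))
    (x : Config B) : ℝ :=
  (chainLaw B P x).real E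

/-- The average of `f` after one step from `x`. -/
noncomputable def stepMean (p : Config B → PMF (Config B)) (f : Config B → ℝ) (x : Config B) : ℝ :=
  ∑ y, (p x y).toReal * f y

theorem pathProb_eq_stepMean (P : ℕ → Config B → PMF (Config B)) {E : Set (ℕ → Config B)}
    (hE : MeasurableSet E) (x : Config B) : pathProb P E x
      = stepMean (P 0) (pathProb (fun j => P (j + 1)) (consPath x ⁻¹' E)) x := by
  unfold pathProb stepMean Measure.real
  conv_lhs => rw [chainLaw_eq_sum]
  simp only [Measure.coe_finsetSum, Finset.sum_apply, Measure.smul_apply, smul_eq_mul,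
    Measure.map_apply (measurable_consPath x) hE]
  rw [ENNReal.toReal_sum]
  · simp [ENNReal.toReal_mul]
  · intro y _
    exact ENNReal.mul_ne_top (PMF.apply_ne_top _ _) (measure_ne_top _ _)

end MarkovChain
end HardCore

namespace HardCore

/-! ### Hitting times counted in ticks and comparison with sub- and superharmonic functions -/

section Hitting

variable {W : Type*} [Fintype W] [DecidableEq W] {B : BipartiteGraph W}

theorem hitTick_le_iff (z : Config B) (ω : ℕ → Config B) (n : ℕ) :
    hitTick z ω ≤ n ↔ ∃ j ≤ n, ω j = z := by
  constructor
  · intro h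
    have hne : ((fun j : ℕ => (j : ℕ∞)) '' {j | ω j = z}).Nonempty := by
      by_contra hne
      rw [Set.not_nonempty_iff_eq_empty] at hne
      rw [hitTick, hne, sInf_empty] at h
      exact absurd h (by simp)
    obtain ⟨j, hj, e⟩ := csInf_mem hne
    refine ⟨j, ?_, hj⟩
    have : ((j : ℕ) : ℕ∞) ≤ n := by
      calc ((j : ℕ) : ℕ∞) = hitTick z ω := e
        _ ≤ n := h
    exact_mod_cast this
  · rintro ⟨j, hj, e⟩
    have h1 : hitTick z ω ≤ (j : ℕ∞) := csInf_le' (Set.mem_image_of_mem _ e)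
    exact h1.trans (Nat.cast_le.2 hj)

theorem returnTick_consPath (z x : Config B) (ω : ℕ → Config B) :
    returnTick z (consPath x ω) = hitTick z ω + 1 := by
  unfold returnTick hitTick
  have : {j | 1 ≤ j ∧ consPath x ω j = z} = (fun j => j + 1) '' {j | ω j = z} := by
    ext j
    cases j with
    | zero => simp
    | succ j => simp
  rw [this, Set.image_image]
  apply le_antisymm
  · by_cases hne : ((fun j : ℕ => (j : ℕ∞)) '' {j | ω j = z}).Nonempty
    · obtain ⟨j, hj, e⟩ := csInf_mem hne
      rw [← e]
      exact csInf_le' ⟨j, hj, by simp⟩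
    · rw [Set.not_nonempty_iff_eq_empty] at hne
      rw [hne, sInf_empty, top_add]
      exact le_top
  · refine le_sInf ?_
    rintro _ ⟨j, hj, rfl⟩
    simp only [Nat.cast_add, Nat.cast_one]
    exact add_le_add (csInf_le' ⟨j, hj, rfl⟩) le_rfl

theorem hitTick_consPath_self (z : Config B) (ω : ℕ → Config B) :
    hitTick z (consPath z ω) = 0 := by
  have := (hitTick_le_iff z (consPath z ω) 0).2 ⟨0, le_rfl, rfl⟩
  simpa using this

theorem hitTick_consPath_of_ne {z x : Config B} (h : x ≠ z) (ω : ℕ → Config B) :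
    hitTick z (consPath x ω) = hitTick z ω + 1 := by
  rw [← returnTick_consPath z x]
  unfold returnTick hitTick
  congr 2
  ext j
  cases j with
  | zero => simp [h]
  | succ j => simp

theorem consPath_eta (ω : ℕ → Config B) : consPath (ω 0) (fun j => ω (j + 1)) = ω := by
  ext j
  cases j <;> rfl

theorem returnTick_eq (z : Config B) (ω : ℕ → Config B) :
    returnTick z ω = hitTick z (fun j => ω (j + 1)) + 1 := by
  conv_lhs => rw [← consPath_eta ω]
  exact returnTick_consPath _ _ _

theorem measurable_hitTick (z : Config B) : Measurable (hitTick z) := by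
  refine ENat.measurable_iff.2 fun n => ?_
  have hle : ∀ n : ℕ, MeasurableSet {ω : ℕ → Config B | hitTick z ω ≤ n} := by
    intro n
    simp only [hitTick_le_iff]
    have : {ω : ℕ → Config B | ∃ j ≤ n, ω j = z}
        = ⋃ j, ⋃ (_ : j ≤ n), (fun ω : ℕ → Config B => ω j) ⁻¹' {z} := by
      ext ω; simp
    rw [this]
    exact MeasurableSet.iUnion fun j => MeasurableSet.iUnion fun _ =>
      measurable_pi_apply j (MeasurableSet.singleton _)
  cases n with
  | zero =>
    have : hitTick z ⁻¹' {((0 : ℕ) : ℕ∞)} = {ω : ℕ → Config B | hitTick z ω ≤ (0 : ℕ)} := by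
      ext ω; simp
    rw [this]; exact hle 0
  | succ n =>
    have : hitTick z ⁻¹' {((n + 1 : ℕ) : ℕ∞)} = {ω : ℕ → Config B | hitTick z ω ≤ (n + 1 : ℕ)} \
        {ω : ℕ → Config B | hitTick z ω ≤ (n : ℕ)} := by
      ext ω
      simp only [Set.mem_preimage, Set.mem_singleton_iff, Set.mem_sdiff, Set.mem_ofPred_eq, not_le]
      constructor
      · intro h; rw [h]; exact ⟨le_rfl, by exact_mod_cast Nat.lt_succ_self n⟩
      · rintro ⟨h1, h2⟩
        refine le_antisymm h1 ?_
        push_cast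
        exact Order.add_one_le_of_lt h2
    rw [this]; exact (hle _).diff (hle _)

theorem measurable_returnTick (z : Config B) : Measurable (returnTick z) := by
  have : returnTick z = (fun n : ℕ∞ => n + 1) ∘ hitTick z ∘
      fun (ω : ℕ → Config B) (j : ℕ) => ω (j + 1) := by
    ext ω; exact returnTick_eq z ω
  rw [this]
  refine (Measurable.of_discrete).comp ((measurable_hitTick z).comp ?_)
  exact measurable_pi_lambda _ fun j => measurable_pi_apply (j + 1)

theorem measurableSet_enat_rel {Ω : Type*} [MeasurableSpace Ω] {f g : Ω → ℕ∞}
    (hf : Measurable f) (hg : Measurable g) (r : ℕ∞ → ℕ∞ → Prop) :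
    MeasurableSet {ω | r (f ω) (g ω)} :=
  (hf.prodMk hg) (t := {p | r p.1 p.2}) (MeasurableSet.of_discrete)

/-- The paths that hit `a` before `b`. -/
def hitBefore (a b : Config B) : Set (ℕ → Config B) := {ω | hitTick a ω < hitTick b ω}

/-- The paths that hit `a` before `b` and within `k` steps. -/
def hitBeforeWithin (k : ℕ) (a b : Config B) : Set (ℕ → Config B) :=
  {ω | hitTick a ω ≤ k ∧ hitTick a ω < hitTick b ω}

/-- The paths that hit `a` before `b` but only after more than `c` steps. -/
def hitBeforeAfter (c : ℕ) (a b : Config B) : Set (ℕ → Config B) :=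
  {ω | (c : ℕ∞) < hitTick a ω ∧ hitTick a ω < hitTick b ω}

theorem measurableSet_hitBefore (a b : Config B) : MeasurableSet (hitBefore a b) :=
  measurableSet_enat_rel (measurable_hitTick a) (measurable_hitTick b) (fun p q => p < q)

theorem measurableSet_hitBeforeWithin (k : ℕ) (a b : Config B) :
    MeasurableSet (hitBeforeWithin k a b) :=
  measurableSet_enat_rel (measurable_hitTick a) (measurable_hitTick b) (fun p q => p ≤ k ∧ p < q)

theorem measurableSet_hitBeforeAfter (c : ℕ) (a b : Config B) :
    MeasurableSet (hitBeforeAfter c a b) :=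
  measurableSet_enat_rel (measurable_hitTick a) (measurable_hitTick b) (fun p q => c < p ∧ p < q)

section Prob

variable (P : ℕ → Config B → PMF (Config B))

theorem pathProb_nonneg (E : Set (ℕ → Config B)) (x : Config B) : 0 ≤ pathProb P E x :=
  measureReal_nonneg

theorem pathProb_le_one (E : Set (ℕ → Config B)) (x : Config B) : pathProb P E x ≤ 1 :=
  measureReal_le_one

theorem pathProb_mono {E F : Set (ℕ → Config B)} (h : E ⊆ F) (x : Config B) :
    pathProb P E x ≤ pathProb P F x := measureReal_mono h

@[simp] theorem pathProb_univ (x : Config B) : pathProb P Set.univ x = 1 := by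
  simp [pathProb]

theorem pathProb_univ' : pathProb P Set.univ = fun _ => 1 := funext (pathProb_univ P)

@[simp] theorem pathProb_empty (x : Config B) : pathProb P ∅ x = 0 := by
  simp [pathProb]

theorem sum_toReal_pmf (p : PMF (Config B)) : ∑ y, (p y).toReal = 1 := by
  have := p.tsum_coe
  rw [tsum_fintype] at this
  rw [← ENNReal.toReal_sum fun y _ => p.apply_ne_top y, this, ENNReal.toReal_one]

variable {P} in
theorem stepMean_const (p : Config B → PMF (Config B)) (c : ℝ) (x : Config B) :
    stepMean p (fun _ => c) x = c := by
  unfold stepMean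
  rw [← Finset.sum_mul, sum_toReal_pmf, one_mul]

theorem stepMean_mono (p : Config B → PMF (Config B)) {f g : Config B → ℝ} (h : ∀ y, f y ≤ g y)
    (x : Config B) : stepMean p f x ≤ stepMean p g x :=
  Finset.sum_le_sum fun y _ => mul_le_mul_of_nonneg_left (h y) ENNReal.toReal_nonneg

theorem stepMean_add (p : Config B → PMF (Config B)) (f g : Config B → ℝ) (x : Config B) :
    stepMean p (fun y => f y + g y) x = stepMean p f x + stepMean p g x := by
  simp only [stepMean, mul_add, Finset.sum_add_distrib]

theorem stepMean_const_mul (p : Config B → PMF (Config B)) (c : ℝ) (f : Config B → ℝ)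
    (x : Config B) : stepMean p (fun y => c * f y) x = c * stepMean p f x := by
  simp only [stepMean, Finset.mul_sum]
  exact Finset.sum_congr rfl fun y _ => by ring

theorem stepMean_sum (p : Config B → PMF (Config B)) {ι : Type*} (s : Finset ι)
    (f : ι → Config B → ℝ) (x : Config B) :
    stepMean p (fun y => ∑ i ∈ s, f i y) x = ∑ i ∈ s, stepMean p (f i) x := by
  simp only [stepMean, Finset.mul_sum]
  exact Finset.sum_comm

theorem stepMean_nonneg (p : Config B → PMF (Config B)) {f : Config B → ℝ} (h : ∀ y, 0 ≤ f y)
    (x : Config B) : 0 ≤ stepMean p f x :=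
  Finset.sum_nonneg fun y _ => mul_nonneg ENNReal.toReal_nonneg (h y)

variable {a b x : Config B}

theorem hitBefore_self (hab : a ≠ b) : pathProb P (hitBefore a b) a = 1 := by
  rw [pathProb_eq_stepMean _ (measurableSet_hitBefore a b)]
  have : consPath a ⁻¹' hitBefore a b = Set.univ := by
    ext ω
    simp [hitBefore, hitTick_consPath_self, hitTick_consPath_of_ne hab]
  simp only [this, pathProb_univ']
  exact stepMean_const _ _ _

theorem hitBefore_other : pathProb P (hitBefore a b) b = 0 := by
  rw [pathProb_eq_stepMean _ (measurableSet_hitBefore a b)]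
  have : consPath b ⁻¹' hitBefore a b = ∅ := by
    ext ω
    simp [hitBefore, hitTick_consPath_self]
  simp [this, stepMean]

theorem hitBefore_step (ha : x ≠ a) (hb : x ≠ b) : pathProb P (hitBefore a b) x
    = stepMean (P 0) (pathProb (fun j => P (j + 1)) (hitBefore a b)) x := by
  rw [pathProb_eq_stepMean _ (measurableSet_hitBefore a b)]
  have : consPath x ⁻¹' hitBefore a b = hitBefore a b := by
    ext ω
    simp [hitBefore, hitTick_consPath_of_ne ha, hitTick_consPath_of_ne hb]
  rw [this]

theorem hitBeforeWithin_self (hab : a ≠ b) (k : ℕ) :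
    pathProb P (hitBeforeWithin k a b) a = 1 := by
  rw [pathProb_eq_stepMean _ (measurableSet_hitBeforeWithin k a b)]
  have : consPath a ⁻¹' hitBeforeWithin k a b = Set.univ := by
    ext ω
    simp [hitBeforeWithin, hitTick_consPath_self, hitTick_consPath_of_ne hab]
  simp only [this, pathProb_univ']
  exact stepMean_const _ _ _

theorem hitBeforeWithin_other (k : ℕ) : pathProb P (hitBeforeWithin k a b) b = 0 := by
  rw [pathProb_eq_stepMean _ (measurableSet_hitBeforeWithin k a b)]
  have : consPath b ⁻¹' hitBeforeWithin k a b = ∅ := by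
    ext ω
    simp [hitBeforeWithin, hitTick_consPath_self]
  simp [this, stepMean]

theorem hitBeforeWithin_zero (ha : x ≠ a) : pathProb P (hitBeforeWithin 0 a b) x = 0 := by
  rw [pathProb_eq_stepMean _ (measurableSet_hitBeforeWithin 0 a b)]
  have : consPath x ⁻¹' hitBeforeWithin 0 a b = ∅ := by
    ext ω
    simp [hitBeforeWithin, hitTick_consPath_of_ne ha]
  simp [this, stepMean]

theorem hitBeforeWithin_succ (ha : x ≠ a) (hb : x ≠ b) (k : ℕ) :
    pathProb P (hitBeforeWithin (k + 1) a b) x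
      = stepMean (P 0) (pathProb (fun j => P (j + 1)) (hitBeforeWithin k a b)) x := by
  rw [pathProb_eq_stepMean _ (measurableSet_hitBeforeWithin (k + 1) a b)]
  have : consPath x ⁻¹' hitBeforeWithin (k + 1) a b = hitBeforeWithin k a b := by
    ext ω
    simp [hitBeforeWithin, hitTick_consPath_of_ne ha, hitTick_consPath_of_ne hb]
  rw [this]

theorem tendsto_hitBeforeWithin (a b x : Config B) :
    Tendsto (fun k => pathProb P (hitBeforeWithin k a b) x) atTop
      (𝓝 (pathProb P (hitBefore a b) x)) := by
  have hU : hitBefore a b = ⋃ k : ℕ, hitBeforeWithin k a b := by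
    ext ω
    simp only [hitBefore, hitBeforeWithin, Set.mem_iUnion, Set.mem_ofPred_eq]
    constructor
    · intro h
      obtain ⟨n, hn⟩ := ENat.ne_top_iff_exists.1 (ne_top_of_lt h)
      exact ⟨n, hn.symm.le, h⟩
    · rintro ⟨_, _, h⟩; exact h
  have hmono : Monotone fun k : ℕ => hitBeforeWithin k a b := by
    intro k l hkl ω hω
    exact ⟨hω.1.trans (by exact_mod_cast hkl), hω.2⟩
  have := tendsto_measure_iUnion_atTop (μ := chainLaw B P x) hmono
  rw [← hU] at this
  exact (ENNReal.tendsto_toReal (measure_ne_top _ _)).comp this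

theorem hitBeforeAfter_of_eq (hx : x = a ∨ x = b) (c : ℕ) :
    pathProb P (hitBeforeAfter c a b) x = 0 := by
  rw [pathProb_eq_stepMean _ (measurableSet_hitBeforeAfter c a b)]
  have : consPath x ⁻¹' hitBeforeAfter c a b = ∅ := by
    ext ω
    rcases hx with rfl | rfl <;> simp [hitBeforeAfter, hitTick_consPath_self]
  simp [this, stepMean]

theorem hitBeforeAfter_zero (ha : x ≠ a) :
    pathProb P (hitBeforeAfter 0 a b) x = pathProb P (hitBefore a b) x := by
  rw [pathProb_eq_stepMean _ (measurableSet_hitBeforeAfter 0 a b),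
    pathProb_eq_stepMean _ (measurableSet_hitBefore a b)]
  have : consPath x ⁻¹' hitBeforeAfter 0 a b = consPath x ⁻¹' hitBefore a b := by
    ext ω
    simp [hitBeforeAfter, hitBefore, hitTick_consPath_of_ne ha]
  rw [this]

theorem hitBeforeAfter_succ (ha : x ≠ a) (hb : x ≠ b) (c : ℕ) :
    pathProb P (hitBeforeAfter (c + 1) a b) x
      = stepMean (P 0) (pathProb (fun j => P (j + 1)) (hitBeforeAfter c a b)) x := by
  rw [pathProb_eq_stepMean _ (measurableSet_hitBeforeAfter (c + 1) a b)]
  have : consPath x ⁻¹' hitBeforeAfter (c + 1) a b = hitBeforeAfter c a b := by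
    ext ω
    simp [hitBeforeAfter, hitTick_consPath_of_ne ha, hitTick_consPath_of_ne hb]
  rw [this]

/-- A nonnegative function that is at least `1` at `a` and superharmonic away from `a` and `b`
dominates the probability of hitting `a` before `b`. -/
theorem hitBeforeWithin_le_of_superharmonic (k : ℕ) {f : Config B → ℝ} (hab : a ≠ b)
    (hf0 : ∀ x, 0 ≤ f x) (hfa : 1 ≤ f a)
    (hf : ∀ j < k, ∀ x, x ≠ a → x ≠ b → stepMean (P j) f x ≤ f x) (x : Config B) :
    pathProb P (hitBeforeWithin k a b) x ≤ f x := by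
  induction k generalizing P x with
  | zero =>
    by_cases ha : x = a
    · subst ha; exact (pathProb_le_one _ _ _).trans hfa
    · rw [hitBeforeWithin_zero P ha]; exact hf0 x
  | succ k ih =>
    by_cases ha : x = a
    · subst ha; exact (pathProb_le_one _ _ _).trans hfa
    by_cases hb : x = b
    · subst hb; rw [hitBeforeWithin_other]; exact hf0 x
    rw [hitBeforeWithin_succ P ha hb]
    refine (stepMean_mono _ (fun y => ih (fun j => P (j + 1))
      (fun j hj => hf (j + 1) (by omega)) y) x).trans (hf 0 (by omega) x ha hb)

/-- The probability of not visiting `a` up to time `k`. -/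
noncomputable def missProb (a : Config B) : ℕ → (ℕ → Config B → PMF (Config B)) → Config B → ℝ
  | 0, _, x => if x = a then 0 else 1
  | k + 1, P, x => if x = a then 0 else stepMean (P 0) (missProb a k fun j => P (j + 1)) x

theorem missProb_nonneg (a : Config B) (k : ℕ) (x : Config B) : 0 ≤ missProb a k P x := by
  induction k generalizing P x with
  | zero => unfold missProb; split_ifs <;> norm_num
  | succ k ih =>
    unfold missProb
    split_ifs
    · exact le_rfl
    · exact stepMean_nonneg _ (fun y => ih _ y) x

/-- A function that is at most `1`, nonpositive at `b`, and subharmonic away from `a` and `b` is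
dominated by the probability of hitting `a` before `b`, if `a` is hit almost surely. -/
theorem le_hitBeforeWithin_add_missProb (k : ℕ) {f : Config B → ℝ} (hab : a ≠ b)
    (hf1 : ∀ x, f x ≤ 1) (hfb : f b ≤ 0)
    (hf : ∀ j < k, ∀ x, x ≠ a → x ≠ b → f x ≤ stepMean (P j) f x) (x : Config B) :
    f x ≤ pathProb P (hitBeforeWithin k a b) x + missProb a k P x := by
  induction k generalizing P x with
  | zero =>
    by_cases ha : x = a
    · subst ha; rw [hitBeforeWithin_self P hab]
      exact (hf1 x).trans (le_add_of_nonneg_right (missProb_nonneg _ _ _ _))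
    · have := pathProb_nonneg P (hitBeforeWithin 0 a b) x
      simp only [missProb, if_neg ha]
      linarith [hf1 x]
  | succ k ih =>
    by_cases ha : x = a
    · subst ha; rw [hitBeforeWithin_self P hab]
      exact (hf1 x).trans (le_add_of_nonneg_right (missProb_nonneg _ _ _ _))
    by_cases hb : x = b
    · subst hb
      exact hfb.trans (add_nonneg (pathProb_nonneg _ _ _) (missProb_nonneg _ _ _ _))
    rw [hitBeforeWithin_succ P ha hb, missProb, if_neg ha, ← stepMean_add]
    exact (hf 0 (by omega) x ha hb).trans (stepMean_mono _ (fun y => ih (fun j => P (j + 1))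
      (fun j hj => hf (j + 1) (by omega)) y) x)

/-- The two events are disjoint, and a path in neither has not visited `a` up to time `k`. With
recurrence to `a` this yields complementary hitting probabilities in the limit. -/
theorem hitBeforeWithin_add (k : ℕ) (hab : a ≠ b) (x : Config B) :
    1 - missProb a k P x ≤ pathProb P (hitBeforeWithin k a b) x +
        pathProb P (hitBeforeWithin k b a) x ∧
    pathProb P (hitBeforeWithin k a b) x + pathProb P (hitBeforeWithin k b a) x ≤ 1 := by
  induction k generalizing P x with
  | zero =>
    by_cases ha : x = a
    · subst ha
      simp [hitBeforeWithin_self P hab, hitBeforeWithin_other, missProb]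
    by_cases hb : x = b
    · subst hb
      simp [hitBeforeWithin_self P hab.symm, hitBeforeWithin_other, missProb, ha]
    simp [hitBeforeWithin_zero P ha, hitBeforeWithin_zero P hb, missProb, ha]
  | succ k ih =>
    by_cases ha : x = a
    · subst ha
      simp [hitBeforeWithin_self P hab, hitBeforeWithin_other, missProb]
    by_cases hb : x = b
    · subst hb
      rw [hitBeforeWithin_self P hab.symm, hitBeforeWithin_other]
      have := missProb_nonneg P a (k + 1) x
      constructor <;> linarith
    rw [hitBeforeWithin_succ P ha hb, hitBeforeWithin_succ P hb ha, missProb, if_neg ha,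
      ← stepMean_add]
    constructor
    · have := stepMean_mono (P 0) (fun y => (ih (fun j => P (j + 1)) y).1) x
      have e := stepMean_add (P 0) (fun y => 1 - missProb a k (fun j => P (j + 1)) y)
        (missProb a k (fun j => P (j + 1))) x
      simp only [sub_add_cancel, stepMean_const] at e
      linarith
    · have := stepMean_mono (P 0) (fun y => (ih (fun j => P (j + 1)) y).2) x
      rwa [stepMean_const] at this

theorem hitBefore_add (hab : a ≠ b) {x : Config B}
    (hmiss : Tendsto (fun k => missProb a k P x) atTop (𝓝 0)) :
    pathProb P (hitBefore a b) x + pathProb P (hitBefore b a) x = 1 := by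
  have h := (tendsto_hitBeforeWithin P a b x).add (tendsto_hitBeforeWithin P b a x)
  refine tendsto_nhds_unique h ?_
  refine tendsto_of_tendsto_of_tendsto_of_le_of_le ?_ tendsto_const_nhds
    (fun k => (hitBeforeWithin_add P k hab x).1) (fun k => (hitBeforeWithin_add P k hab x).2)
  simpa using hmiss.const_sub 1

theorem hitBefore_le_of_superharmonic {f : Config B → ℝ} (hab : a ≠ b)
    (hf0 : ∀ x, 0 ≤ f x) (hfa : 1 ≤ f a)
    (hf : ∀ j, ∀ x, x ≠ a → x ≠ b → stepMean (P j) f x ≤ f x) (x : Config B) :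
    pathProb P (hitBefore a b) x ≤ f x :=
  le_of_tendsto' (tendsto_hitBeforeWithin P a b x)
    fun k => hitBeforeWithin_le_of_superharmonic P k hab hf0 hfa (fun j _ => hf j) x

theorem le_hitBefore_of_subharmonic {f : Config B → ℝ} (hab : a ≠ b)
    (hf1 : ∀ x, f x ≤ 1) (hfb : f b ≤ 0)
    (hf : ∀ j, ∀ x, x ≠ a → x ≠ b → f x ≤ stepMean (P j) f x) {x : Config B}
    (hmiss : Tendsto (fun k => missProb a k P x) atTop (𝓝 0)) :
    f x ≤ pathProb P (hitBefore a b) x := by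
  have h := (tendsto_hitBeforeWithin P a b x).add hmiss
  rw [add_zero] at h
  exact ge_of_tendsto' h fun k => le_hitBeforeWithin_add_missProb P k hab hf1 hfb
    (fun j _ => hf j) x

end Prob

/-- The paths that hit `v` before returning to `u`. -/
def successSet (B : BipartiteGraph W) : Set (ℕ → Config B) :=
  {ω | hitTick (allV B) ω < returnTick (allU B) ω}

/-- The paths that hit `v` within `k` steps and before returning to `u`. -/
def successWithinSet (B : BipartiteGraph W) (k : ℕ) : Set (ℕ → Config B) :=
  {ω | hitTick (allV B) ω ≤ k ∧ hitTick (allV B) ω < returnTick (allU B) ω}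

/-- The paths that return to `u` before hitting `v`, after more than `c` steps. -/
def failureAfterSet (B : BipartiteGraph W) (c : ℕ) : Set (ℕ → Config B) :=
  {ω | (c : ℕ∞) < returnTick (allU B) ω ∧ returnTick (allU B) ω < hitTick (allV B) ω}

theorem measurableSet_successSet : MeasurableSet (successSet B) :=
  measurableSet_enat_rel (measurable_hitTick (allV B)) (measurable_returnTick (allU B))
    (fun p q => p < q)

theorem measurableSet_successWithinSet (k : ℕ) : MeasurableSet (successWithinSet B k) :=
  measurableSet_enat_rel (measurable_hitTick (allV B)) (measurable_returnTick (allU B))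
    (fun p q => p ≤ k ∧ p < q)

theorem measurableSet_failureAfterSet (c : ℕ) : MeasurableSet (failureAfterSet B c) :=
  measurableSet_enat_rel (measurable_returnTick (allU B)) (measurable_hitTick (allV B))
    (fun p q => c < p ∧ p < q)

variable (P : ℕ → Config B → PMF (Config B))

theorem consPath_preimage_successSet (huv : allU B ≠ allV B) :
    consPath (allU B) ⁻¹' successSet B = hitBefore (allV B) (allU B) := by
  ext ω
  simp [successSet, hitBefore, returnTick_consPath, hitTick_consPath_of_ne huv]

theorem successSet_prob (huv : allU B ≠ allV B) : pathProb P (successSet B) (allU B)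
    = stepMean (P 0) (pathProb (fun j => P (j + 1)) (hitBefore (allV B) (allU B))) (allU B) := by
  rw [pathProb_eq_stepMean _ measurableSet_successSet, consPath_preimage_successSet huv]

theorem successWithinSet_prob (huv : allU B ≠ allV B) (k : ℕ) :
    pathProb P (successWithinSet B (k + 1)) (allU B)
      = stepMean (P 0) (pathProb (fun j => P (j + 1))
        (hitBeforeWithin k (allV B) (allU B))) (allU B) := by
  rw [pathProb_eq_stepMean _ (measurableSet_successWithinSet _)]
  have : consPath (allU B) ⁻¹' successWithinSet B (k + 1)
      = hitBeforeWithin k (allV B) (allU B) := by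
    ext ω
    simp [successWithinSet, hitBeforeWithin, returnTick_consPath, hitTick_consPath_of_ne huv]
  rw [this]

theorem failureAfterSet_zero_prob (huv : allU B ≠ allV B) :
    pathProb P (failureAfterSet B 0) (allU B)
      = stepMean (P 0) (pathProb (fun j => P (j + 1)) (hitBefore (allU B) (allV B))) (allU B) := by
  rw [pathProb_eq_stepMean _ (measurableSet_failureAfterSet _)]
  have : consPath (allU B) ⁻¹' failureAfterSet B 0 = hitBefore (allU B) (allV B) := by
    ext ω
    simp [failureAfterSet, hitBefore, returnTick_consPath, hitTick_consPath_of_ne huv]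
  rw [this]

theorem failureAfterSet_succ_prob (huv : allU B ≠ allV B) (c : ℕ) :
    pathProb P (failureAfterSet B (c + 1)) (allU B)
      = stepMean (P 0) (pathProb (fun j => P (j + 1))
        (hitBeforeAfter c (allU B) (allV B))) (allU B) := by
  rw [pathProb_eq_stepMean _ (measurableSet_failureAfterSet _)]
  have : consPath (allU B) ⁻¹' failureAfterSet B (c + 1)
      = hitBeforeAfter c (allU B) (allV B) := by
    ext ω
    simp [failureAfterSet, hitBeforeAfter, returnTick_consPath, hitTick_consPath_of_ne huv]
  rw [this]

end Hitting
end HardCore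

namespace HardCore

/-! ### The generator, attractiveness, and monotonicity of the success rate -/

section Generator

variable {W : Type*} [Fintype W] [DecidableEq W] (B : BipartiteGraph W) (R : Rates)

/-- The configuration `x ∪ {i}` if it is independent, and `x` otherwise. -/
noncomputable def activate (i : W) (x : Config B) : Config B :=
  @dite _ (B.graph.IsIndepSet ((insert i x.1 : Finset W) : Set W)) (Classical.dec _)
    (fun h => ⟨insert i x.1, h⟩) (fun _ => x)

theorem activate_of_isIndepSet {i : W} {x : Config B}
    (h : B.graph.IsIndepSet ((insert i x.1 : Finset W) : Set W)) :
    activate B i x = ⟨insert i x.1, h⟩ := dif_pos h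

theorem activate_of_not_isIndepSet {i : W} {x : Config B}
    (h : ¬ B.graph.IsIndepSet ((insert i x.1 : Finset W) : Set W)) :
    activate B i x = x := dif_neg h

theorem config_ext {x y : Config B} (h : x.1 = y.1) : x = y := Subtype.ext h

theorem config_ext_iff {x y : Config B} : x.1 = y.1 ↔ x = y :=
  ⟨config_ext B, fun h => h ▸ rfl⟩

/-- The configuration `x \ {i}`. -/
def deactivate (i : W) (x : Config B) : Config B :=
  ⟨x.1.erase i, fun _ ha _ hb => x.2 (Finset.mem_of_mem_erase ha) (Finset.mem_of_mem_erase hb)⟩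

/-- The generator of the continuous-time dynamics with the rates at time `s`. -/
noncomputable def generator (s : ℝ) (f : Config B → ℝ) (x : Config B) : ℝ :=
  ∑ i : W, ((birthRate B R s i : ℝ) * (f (activate B i x) - f x) + (f (deactivate B i x) - f x))

theorem step_apply_toReal (s : ℝ) (x y : Config B) :
    (step B R s x y).toReal = (transProb B R s x y : ℝ) := by
  simp [step]

theorem stepMean_step (s : ℝ) (f : Config B → ℝ) (x : Config B) :
    stepMean (step B R s) f x - f x = ∑ y, (moveProb B R s x y : ℝ) * (f y - f x) := by
  have h : stepMean (step B R s) f x - f x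
      = ∑ y, (step B R s x y).toReal * (f y - f x) := by
    simp only [mul_sub, Finset.sum_sub_distrib, ← Finset.sum_mul, sum_toReal_pmf, one_mul]
    rfl
  rw [h]
  refine Finset.sum_congr rfl fun y _ => ?_
  rw [step_apply_toReal, transProb]
  by_cases hy : y = x
  · simp [hy]
  · simp [hy]

theorem clockRate_eq_sum (s : ℝ) :
    (clockRate B R s : ℝ) = ∑ i : W, ((birthRate B R s i : ℝ) + 1) := by
  rw [← Finset.sum_add_sum_compl B.U]
  have e1 : ∑ i ∈ B.U, ((birthRate B R s i : ℝ) + 1) = ∑ i ∈ B.U, ((R.rateU s : ℝ) + 1) :=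
    Finset.sum_congr rfl fun i hi => by simp [birthRate, hi]
  have e2 : ∑ i ∈ B.Uᶜ, ((birthRate B R s i : ℝ) + 1) = ∑ i ∈ B.Uᶜ, ((R.rateV s : ℝ) + 1) :=
    Finset.sum_congr rfl fun i hi => by simp [birthRate, Finset.mem_compl.1 hi]
  rw [e1, e2, Finset.sum_const, Finset.sum_const, clockRate, nsmul_eq_mul, nsmul_eq_mul]
  push_cast
  ring

theorem one_le_clockRate (hU : B.U.Nonempty) (s : ℝ) : 1 ≤ clockRate B R s := by
  unfold clockRate
  have h : (1 : ℝ≥0) ≤ B.U.card := by exact_mod_cast hU.card_pos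
  calc (1 : ℝ≥0) = 1 * 1 := (one_mul 1).symm
    _ ≤ (1 + R.rateU s) * B.U.card := mul_le_mul' (le_add_of_nonneg_right zero_le) h
    _ ≤ _ := le_add_of_nonneg_right zero_le

/-- Refused activations and deactivations of inactive vertices are encoded as maps fixing `x`, so
they contribute zero and the sum over target states becomes a sum over vertices. -/
theorem sum_moveProb_mul (hU : B.U.Nonempty) (s : ℝ) (f : Config B → ℝ) (x : Config B) :
    (clockRate B R s : ℝ) * ∑ y, (moveProb B R s x y : ℝ) * (f y - f x)
      = generator B R s f x := by
  have hγ : (clockRate B R s : ℝ) ≠ 0 := by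
    have : (1 : ℝ) ≤ clockRate B R s := by exact_mod_cast one_le_clockRate B R hU s
    positivity
  have h1 : ∀ y, (clockRate B R s : ℝ) * ((moveProb B R s x y : ℝ) * (f y - f x))
      = ∑ i : W, ((if i ∉ x.1 ∧ y.1 = insert i x.1 then (birthRate B R s i : ℝ) else 0)
        + (if i ∈ x.1 ∧ y.1 = x.1.erase i then 1 else 0)) * (f y - f x) := by
    intro y
    rw [← Finset.sum_mul, ← mul_assoc, moveProb]
    congr 1
    push_cast
    rw [mul_div_cancel₀ _ hγ]
    refine Finset.sum_congr rfl fun i _ => ?_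
    split_ifs <;> simp
  rw [Finset.mul_sum, Finset.sum_congr rfl fun y _ => h1 y, Finset.sum_comm, generator]
  refine Finset.sum_congr rfl fun i _ => ?_
  simp only [add_mul, Finset.sum_add_distrib, ite_mul, zero_mul, one_mul]
  congr 1
  · by_cases hi : i ∈ x.1
    · have : activate B i x = x := by
        by_cases hind : B.graph.IsIndepSet ((insert i x.1 : Finset W) : Set W)
        · rw [activate_of_isIndepSet B hind]
          exact config_ext B (Finset.insert_eq_of_mem hi)
        · exact activate_of_not_isIndepSet B hind
      simp [hi, this]
    · simp only [hi, not_false_eq_true, true_and]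
      by_cases hind : B.graph.IsIndepSet ((insert i x.1 : Finset W) : Set W)
      · have ha : activate B i x = ⟨insert i x.1, hind⟩ :=
          activate_of_isIndepSet B hind
        have : ∀ y : Config B, y.1 = insert i x.1 ↔ y = activate B i x := by
          intro y; rw [ha]; exact config_ext_iff B (x := y) (y := ⟨insert i x.1, hind⟩)
        simp [this]
      · have ha : activate B i x = x := activate_of_not_isIndepSet B hind
        have : ∀ y : Config B, y.1 ≠ insert i x.1 := by
          intro y hy; exact hind (hy ▸ y.2)
        simp [this, ha]
  · by_cases hi : i ∈ x.1
    · have : ∀ y : Config B, y.1 = x.1.erase i ↔ y = deactivate B i x := by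
        intro y; rw [← config_ext_iff]; rfl
      simp [hi, this]
    · have : deactivate B i x = x := Subtype.ext (by simp [deactivate, hi])
      simp [hi, this]

theorem clockRate_mul_stepMean_sub (hU : B.U.Nonempty) (s : ℝ) (f : Config B → ℝ)
    (x : Config B) : (clockRate B R s : ℝ) * (stepMean (step B R s) f x - f x)
      = generator B R s f x := by
  rw [stepMean_step, sum_moveProb_mul B R hU]

/-- The coefficients are nonnegative and do not depend on `x`: this is the graphical coupling, in
which all states use the same vertex and the same attempted move. Monotonicity of a step reduces to
that of `activate` and `deactivate`. -/
theorem clockRate_mul_stepMean (hU : B.U.Nonempty) (s : ℝ) (f : Config B → ℝ) (x : Config B) :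
    (clockRate B R s : ℝ) * stepMean (step B R s) f x
      = ∑ i : W, ((birthRate B R s i : ℝ) * f (activate B i x) + f (deactivate B i x)) := by
  have h := clockRate_mul_stepMean_sub B R hU s f x
  have e : (clockRate B R s : ℝ) * f x = ∑ i : W, ((birthRate B R s i : ℝ) + 1) * f x := by
    rw [clockRate_eq_sum, Finset.sum_mul]
  have : (clockRate B R s : ℝ) * stepMean (step B R s) f x
      = generator B R s f x + (clockRate B R s : ℝ) * f x := by rw [← h]; ring
  rw [this, e, generator, ← Finset.sum_add_distrib]
  exact Finset.sum_congr rfl fun i _ => by ring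

theorem clockRate_pos (hU : B.U.Nonempty) (s : ℝ) : 0 < (clockRate B R s : ℝ) := by
  have : (1 : ℝ) ≤ clockRate B R s := by exact_mod_cast one_le_clockRate B R hU s
  linarith

/-! ### Monotonicity -/

variable {B}

/-- `y` has fewer active vertices in `U` and more in `V`. -/
def Precedes (x y : Config B) : Prop :=
  (∀ i ∈ B.U, i ∈ y.1 → i ∈ x.1) ∧ ∀ i ∉ B.U, i ∈ x.1 → i ∈ y.1

/-- `f` increases when vertices in `U` are deactivated and vertices in `V` are activated. -/
def IsIncreasing (f : Config B → ℝ) : Prop := ∀ x y, Precedes x y → f x ≤ f y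

theorem adj_cases {i j : W} (h : B.graph.Adj i j) : (i ∈ B.U ∧ j ∉ B.U) ∨ (i ∉ B.U ∧ j ∈ B.U) := by
  rcases B.bipartite.mem_of_adj h with h | h
  · left; simpa using h
  · right; simpa using h

theorem isIndepSet_insert_iff (i : W) (x : Config B) :
    B.graph.IsIndepSet ((insert i x.1 : Finset W) : Set W)
      ↔ ∀ j ∈ x.1, ¬ B.graph.Adj i j := by
  constructor
  · intro h j hj hadj
    exact h (by simp) (by simp [hj]) hadj.ne hadj
  · intro h a ha b hb hab hadj
    simp only [Finset.coe_insert, Set.mem_insert_iff, Finset.mem_coe] at ha hb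
    rcases ha with rfl | ha
    · rcases hb with rfl | hb
      · exact hab rfl
      · exact h b hb hadj
    · rcases hb with rfl | hb
      · exact h a ha hadj.symm
      · exact x.2 ha hb hab hadj

theorem mem_activate (i j : W) (x : Config B) : j ∈ (activate B i x).1 ↔
    j ∈ x.1 ∨ (j = i ∧ ∀ k ∈ x.1, ¬ B.graph.Adj i k) := by
  by_cases h : B.graph.IsIndepSet ((insert i x.1 : Finset W) : Set W)
  · rw [activate_of_isIndepSet B h, Finset.mem_insert]
    rw [isIndepSet_insert_iff] at h
    tauto
  · rw [activate_of_not_isIndepSet B h]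
    rw [isIndepSet_insert_iff] at h
    tauto

/-- This is where bipartiteness enters: a vertex of `U` can only be blocked by active vertices of
`V`, of which the smaller state has fewer, and vice versa. -/
theorem Precedes.activate {x y : Config B} (h : Precedes x y) (i : W) :
    Precedes (activate B i x) (activate B i y) := by
  refine ⟨fun j hj hy => ?_, fun j hj hx => ?_⟩
  · rw [mem_activate] at hy ⊢
    rcases hy with hy | ⟨rfl, hy⟩
    · exact Or.inl (h.1 j hj hy)
    · refine Or.inr ⟨rfl, fun k hk hadj => ?_⟩
      rcases adj_cases hadj with ⟨_, hkU⟩ | ⟨hjU, _⟩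
      · exact hy k (h.2 k hkU hk) hadj
      · exact hjU hj
  · rw [mem_activate] at hx ⊢
    rcases hx with hx | ⟨rfl, hx⟩
    · exact Or.inl (h.2 j hj hx)
    · refine Or.inr ⟨rfl, fun k hk hadj => ?_⟩
      rcases adj_cases hadj with ⟨hjU, _⟩ | ⟨_, hkU⟩
      · exact hj hjU
      · exact hx k (h.1 k hkU hk) hadj

theorem Precedes.deactivate {x y : Config B} (h : Precedes x y) (i : W) :
    Precedes (deactivate B i x) (deactivate B i y) := by
  refine ⟨fun j hj hy => ?_, fun j hj hx => ?_⟩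
  · simp only [HardCore.deactivate, Finset.mem_erase] at hy ⊢
    exact ⟨hy.1, h.1 j hj hy.2⟩
  · simp only [HardCore.deactivate, Finset.mem_erase] at hx ⊢
    exact ⟨hx.1, h.2 j hj hx.2⟩

theorem precedes_activate_of_mem {i : W} (hi : i ∈ B.U) (x : Config B) :
    Precedes (activate B i x) x := by
  refine ⟨fun j _ hy => (mem_activate _ _ _).2 (Or.inl hy), fun j hj hx => ?_⟩
  rcases (mem_activate _ _ _).1 hx with hx | ⟨rfl, _⟩
  · exact hx
  · exact absurd hi hj

theorem precedes_activate_of_notMem {i : W} (hi : i ∉ B.U) (x : Config B) :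
    Precedes x (activate B i x) := by
  refine ⟨fun j hj hy => ?_, fun j _ hx => (mem_activate _ _ _).2 (Or.inl hx)⟩
  rcases (mem_activate _ _ _).1 hy with hy | ⟨rfl, _⟩
  · exact hy
  · exact absurd hj hi

theorem IsIncreasing.stepMean {f : Config B → ℝ} (hf : IsIncreasing f) (hU : B.U.Nonempty)
    (s : ℝ) : IsIncreasing (stepMean (step B R s) f) := by
  intro x y hxy
  refine le_of_mul_le_mul_left ?_ (clockRate_pos B R hU s)
  rw [clockRate_mul_stepMean B R hU, clockRate_mul_stepMean B R hU]
  refine Finset.sum_le_sum fun i _ => add_le_add ?_ (hf _ _ (hxy.deactivate i))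
  exact mul_le_mul_of_nonneg_left (hf _ _ (hxy.activate i)) (NNReal.coe_nonneg _)

/-- For an increasing function the generator increases when the rate in `U` decreases and the rate
in `V` increases. -/
theorem generator_le_generator {R R' : Rates} {s s' : ℝ} (hRU : R'.rateU s' ≤ R.rateU s)
    (hRV : R.rateV s ≤ R'.rateV s') {f : Config B → ℝ} (hf : IsIncreasing f) (x : Config B) :
    generator B R s f x ≤ generator B R' s' f x := by
  refine Finset.sum_le_sum fun i _ => add_le_add ?_ le_rfl
  by_cases hi : i ∈ B.U
  · have h1 : f (activate B i x) - f x ≤ 0 := sub_nonpos.2 (hf _ _ (precedes_activate_of_mem hi x))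
    have h2 : (birthRate B R' s' i : ℝ) ≤ birthRate B R s i := by
      simp only [birthRate, if_pos hi]; exact_mod_cast hRU
    exact mul_le_mul_of_nonpos_right h2 h1
  · have h1 : 0 ≤ f (activate B i x) - f x :=
      sub_nonneg.2 (hf _ _ (precedes_activate_of_notMem hi x))
    have h2 : (birthRate B R s i : ℝ) ≤ birthRate B R' s' i := by
      simp only [birthRate, if_neg hi]; exact_mod_cast hRV
    exact mul_le_mul_of_nonneg_right h2 h1

theorem generator_le_of_le (R : Rates) (s : ℝ) {f g : Config B → ℝ} (hfg : ∀ y, f y ≤ g y)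
    {x : Config B} (hx : f x = g x) : generator B R s f x ≤ generator B R s g x := by
  refine Finset.sum_le_sum fun i _ => add_le_add ?_ ?_
  · rw [hx]
    exact mul_le_mul_of_nonneg_left (sub_le_sub_right (hfg _) _) (NNReal.coe_nonneg _)
  · rw [hx]; exact sub_le_sub_right (hfg _) _

theorem allU_ne_allV (hU : B.U.Nonempty) : allU B ≠ allV B := by
  intro h
  obtain ⟨i, hi⟩ := hU
  have h' : B.U = B.Uᶜ := congrArg Subtype.val h
  have : i ∈ B.Uᶜ := h' ▸ hi
  exact Finset.mem_compl.1 this hi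

theorem eq_allV_of_precedes {y : Config B} (h : Precedes (allV B) y) : y = allV B := by
  apply Subtype.ext
  ext i
  by_cases hi : i ∈ B.U
  · exact ⟨fun hy => h.1 i hi hy, fun hv => absurd hi (Finset.mem_compl.1 hv)⟩
  · exact ⟨fun _ => Finset.mem_compl.2 hi, fun hv => h.2 i hi hv⟩

theorem eq_allU_of_precedes {x : Config B} (h : Precedes x (allU B)) : x = allU B := by
  apply Subtype.ext
  ext i
  by_cases hi : i ∈ B.U
  · exact ⟨fun _ => hi, fun hv => h.1 i hi hv⟩
  · exact ⟨fun hx => h.2 i hi hx, fun hv => absurd hv hi⟩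

/-- The probability that the homogeneous chain with the rates at time `s` hits `v` before `u`. -/
noncomputable def escapeProb (B : BipartiteGraph W) (R : Rates) (s : ℝ) (x : Config B) : ℝ :=
  pathProb (fun _ => step B R s) (hitBefore (allV B) (allU B)) x

theorem escapeProb_nonneg (R : Rates) (s : ℝ) (x : Config B) : 0 ≤ escapeProb B R s x :=
  pathProb_nonneg _ _ _

theorem escapeProb_le_one (R : Rates) (s : ℝ) (x : Config B) : escapeProb B R s x ≤ 1 :=
  pathProb_le_one _ _ _

section Escape

variable (hU : B.U.Nonempty)
include hU

/-- Induction by one step, since a step preserves increasing functions. The absorbing states do no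
harm because `v` is maximal and `u` minimal for the order. -/
theorem isIncreasing_hitBeforeWithin (s : ℝ) (k : ℕ) : IsIncreasing
    (pathProb (fun _ => step B R s) (hitBeforeWithin k (allV B) (allU B))) := by
  have huv := allU_ne_allV hU
  induction k with
  | zero =>
    intro x y hxy
    by_cases hx : x = allV B
    · subst hx; rw [eq_allV_of_precedes hxy]
    · rw [hitBeforeWithin_zero _ hx]; exact pathProb_nonneg _ _ _
  | succ k ih =>
    intro x y hxy
    by_cases hy : y = allV B
    · subst hy; rw [hitBeforeWithin_self _ huv.symm]; exact pathProb_le_one _ _ _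
    by_cases hx : x = allV B
    · subst hx; rw [eq_allV_of_precedes hxy]
    by_cases hx' : x = allU B
    · subst hx'; rw [hitBeforeWithin_other]; exact pathProb_nonneg _ _ _
    by_cases hy' : y = allU B
    · subst hy'; rw [eq_allU_of_precedes hxy]
    rw [hitBeforeWithin_succ _ hx hx', hitBeforeWithin_succ _ hy hy']
    exact ih.stepMean R hU s x y hxy

theorem isIncreasing_escapeProb (s : ℝ) : IsIncreasing (escapeProb B R s) := fun x y hxy =>
  le_of_tendsto_of_tendsto' (tendsto_hitBeforeWithin _ _ _ x) (tendsto_hitBeforeWithin _ _ _ y)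
    fun k => isIncreasing_hitBeforeWithin R hU s k x y hxy

theorem escapeProb_allV (s : ℝ) : escapeProb B R s (allV B) = 1 :=
  hitBefore_self _ (allU_ne_allV hU).symm

omit hU in
theorem escapeProb_allU (s : ℝ) : escapeProb B R s (allU B) = 0 := hitBefore_other _

theorem generator_escapeProb (s : ℝ) {x : Config B} (hu : x ≠ allU B) (hv : x ≠ allV B) :
    generator B R s (escapeProb B R s) x = 0 := by
  have h : escapeProb B R s x = stepMean (step B R s) (escapeProb B R s) x :=
    hitBefore_step _ hv hu
  rw [← clockRate_mul_stepMean_sub B R hU, ← h, sub_self, mul_zero]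

/-- The escape probability is harmonic for its own rates away from `u` and `v`; being increasing, it
becomes superharmonic under less favourable rates. The next lemma is the mirror image. -/
theorem stepMean_escapeProb_le {R R' : Rates} {s s' : ℝ} (hRU : R'.rateU s' ≤ R.rateU s)
    (hRV : R.rateV s ≤ R'.rateV s') {x : Config B} (hu : x ≠ allU B) (hv : x ≠ allV B) :
    stepMean (step B R s) (escapeProb B R' s') x ≤ escapeProb B R' s' x := by
  have h := generator_le_generator hRU hRV (isIncreasing_escapeProb R' hU s') x
  rw [generator_escapeProb R' hU s' hu hv, ← clockRate_mul_stepMean_sub B R hU] at h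
  have := nonpos_of_mul_nonpos_right h (clockRate_pos B R hU s)
  linarith

theorem le_stepMean_escapeProb {R R' : Rates} {s s' : ℝ} (hRU : R'.rateU s' ≤ R.rateU s)
    (hRV : R.rateV s ≤ R'.rateV s') {x : Config B} (hu : x ≠ allU B) (hv : x ≠ allV B) :
    escapeProb B R s x ≤ stepMean (step B R' s') (escapeProb B R s) x := by
  have h := generator_le_generator hRU hRV (isIncreasing_escapeProb R hU s) x
  rw [generator_escapeProb R hU s hu hv, ← clockRate_mul_stepMean_sub B R' hU] at h
  have := nonneg_of_mul_nonneg_right h (clockRate_pos B R' hU s')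
  linarith

theorem escapeProb_le_escapeProb {R R' : Rates} {s s' : ℝ} (hRU : R'.rateU s' ≤ R.rateU s)
    (hRV : R.rateV s ≤ R'.rateV s') (x : Config B) :
    escapeProb B R s x ≤ escapeProb B R' s' x := by
  exact hitBefore_le_of_superharmonic (fun _ => step B R s) (f := escapeProb B R' s')
    (allU_ne_allV hU).symm (escapeProb_nonneg R' s') (escapeProb_allV R' hU s').ge
    (fun _ y hv hu => stepMean_escapeProb_le hU hRU hRV hu hv) x

theorem epsCheck_eq_stepMean (s : ℝ) :
    epsCheck B R s = stepMean (step B R s) (escapeProb B R s) (allU B) :=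
  successSet_prob _ (allU_ne_allV hU)

/-- The escape probability vanishes at `u`, so its one-step mean there is an increment.
Multiplication by `γ` removes the time-dependent normalisation, which is why `γ ε̌` and not `ε̌` is
the quantity that can be compared. -/
theorem clockRate_mul_epsCheck (s : ℝ) :
    (clockRate B R s : ℝ) * epsCheck B R s = generator B R s (escapeProb B R s) (allU B) := by
  rw [epsCheck_eq_stepMean R hU, ← clockRate_mul_stepMean_sub B R hU, escapeProb_allU, sub_zero]

/-- The rate `γ ε̌` of successful trials increases when the rate in `U` decreases and the rate in
`V` increases. -/
theorem clockRate_mul_epsCheck_le {R R' : Rates} {s s' : ℝ} (hRU : R'.rateU s' ≤ R.rateU s)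
    (hRV : R.rateV s ≤ R'.rateV s') :
    (clockRate B R s : ℝ) * epsCheck B R s ≤ (clockRate B R' s' : ℝ) * epsCheck B R' s' := by
  rw [clockRate_mul_epsCheck R hU, clockRate_mul_epsCheck R' hU]
  refine (generator_le_generator hRU hRV (isIncreasing_escapeProb R hU s) _).trans ?_
  refine generator_le_of_le R' s' (escapeProb_le_escapeProb hU hRU hRV) ?_
  rw [escapeProb_allU, escapeProb_allU]

omit hU in
theorem epsCheck_nonneg (s : ℝ) : 0 ≤ epsCheck B R s := measureReal_nonneg

omit hU in
theorem epsCheck_le_one (s : ℝ) : epsCheck B R s ≤ 1 := measureReal_le_one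

end Escape

end Generator
end HardCore

namespace HardCore

/-! ### Reachability of `v` and recurrence -/

section Recurrence

variable {W : Type*} [Fintype W] [DecidableEq W] {B : BipartiteGraph W}

/-- The number of vertices at which `x` differs from `v`. -/
def distToV (x : Config B) : ℕ := (x.1 ∩ B.U).card + (B.Uᶜ \ x.1).card

theorem distToV_le (x : Config B) : distToV x ≤ Fintype.card W := by
  unfold distToV
  rw [← Finset.card_union_of_disjoint]
  · exact Finset.card_le_univ _
  · rw [Finset.disjoint_left]
    intro i hi hi'
    simp only [Finset.mem_inter, Finset.mem_sdiff, Finset.mem_compl] at hi hi'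
    exact hi'.1 hi.2

theorem eq_allV_of_distToV {x : Config B} (h : distToV x = 0) : x = allV B := by
  have h1 : (x.1 ∩ B.U).card = 0 ∧ (B.Uᶜ \ x.1).card = 0 := by unfold distToV at h; omega
  rw [Finset.card_eq_zero, Finset.card_eq_zero] at h1
  refine config_ext B (Finset.ext fun i => ?_)
  have h2 := Finset.ext_iff.1 h1.1 i
  have h3 := Finset.ext_iff.1 h1.2 i
  simp only [Finset.mem_inter, Finset.mem_sdiff, Finset.mem_compl, Finset.notMem_empty,
    iff_false, not_and, not_not] at h2 h3
  change i ∈ x.1 ↔ i ∈ B.Uᶜ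
  rw [Finset.mem_compl]
  exact ⟨h2, h3⟩

theorem moveProb_le_step (R : Rates) (s : ℝ) (x y : Config B) :
    (moveProb B R s x y : ℝ) ≤ (step B R s x y).toReal := by
  rw [step_apply_toReal, NNReal.coe_le_coe, transProb]
  exact le_add_of_nonneg_right zero_le

/-- From every configuration other than `v` one can get closer to `v`, avoiding `u`. -/
theorem exists_step_toward {x : Config B} (hx : x ≠ allV B) :
    ∃ y : Config B, y ≠ allU B ∧ distToV y + 1 = distToV x ∧ ∀ (R : Rates) (s : ℝ),
      min 1 (R.rateV s : ℝ) / clockRate B R s ≤ (step B R s x y).toReal := by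
  by_cases hxU : (x.1 ∩ B.U).Nonempty
  · obtain ⟨i, hi⟩ := hxU
    obtain ⟨hix, hiU⟩ := Finset.mem_inter.1 hi
    have hval : (deactivate B i x).1 = x.1.erase i := rfl
    refine ⟨deactivate B i x, ?_, ?_, fun R s => ?_⟩
    · intro h
      have h' : x.1.erase i = B.U := congrArg Subtype.val h
      exact Finset.notMem_erase i x.1 (h' ▸ hiU)
    · unfold distToV
      rw [hval]
      have e1 : x.1.erase i ∩ B.U = (x.1 ∩ B.U).erase i := by
        ext j; simp only [Finset.mem_inter, Finset.mem_erase]; tauto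
      have e2 : B.Uᶜ \ x.1.erase i = B.Uᶜ \ x.1 := by
        ext j
        simp only [Finset.mem_sdiff, Finset.mem_compl, Finset.mem_erase, not_and]
        refine ⟨fun h => ⟨h.1, h.2 fun e => h.1 (e ▸ hiU)⟩, fun h => ⟨h.1, fun _ => h.2⟩⟩
      rw [e1, e2, Finset.card_erase_of_mem hi]
      have := Finset.card_pos.2 ⟨i, hi⟩
      omega
    · refine le_trans ?_ (moveProb_le_step R s _ _)
      rw [moveProb, NNReal.coe_div]
      refine div_le_div_of_nonneg_right ?_ (NNReal.coe_nonneg _)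
      refine (min_le_left _ _).trans ?_
      rw [NNReal.coe_sum]
      refine le_trans ?_ (Finset.single_le_sum (fun j _ => NNReal.coe_nonneg _)
        (Finset.mem_univ i))
      simp [hix, hval]
  · rw [Finset.not_nonempty_iff_eq_empty] at hxU
    have hsub : ∀ j ∈ x.1, j ∉ B.U := fun j hj hjU => by
      have : j ∈ x.1 ∩ B.U := Finset.mem_inter.2 ⟨hj, hjU⟩
      rw [hxU] at this
      exact Finset.notMem_empty _ this
    have hne : (B.Uᶜ \ x.1).Nonempty := by
      by_contra hne
      rw [Finset.not_nonempty_iff_eq_empty] at hne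
      exact hx (eq_allV_of_distToV (by simp [distToV, hxU, hne]))
    obtain ⟨i, hi⟩ := hne
    obtain ⟨hiU, hix⟩ := Finset.mem_sdiff.1 hi
    rw [Finset.mem_compl] at hiU
    have hind : B.graph.IsIndepSet ((insert i x.1 : Finset W) : Set W) := by
      rw [isIndepSet_insert_iff]
      intro j hj hadj
      rcases adj_cases hadj with ⟨h, _⟩ | ⟨_, h⟩
      · exact hiU h
      · exact hsub j hj h
    have hval : (activate B i x).1 = insert i x.1 := by rw [activate_of_isIndepSet B hind]
    refine ⟨activate B i x, ?_, ?_, fun R s => ?_⟩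
    · intro h
      have h' : insert i x.1 = B.U := by rw [← hval, h]; rfl
      exact hiU (h' ▸ Finset.mem_insert_self i x.1)
    · unfold distToV
      rw [hval]
      have e1 : insert i x.1 ∩ B.U = x.1 ∩ B.U := by
        ext j
        simp only [Finset.mem_inter, Finset.mem_insert]
        refine ⟨?_, fun h => ⟨Or.inr h.1, h.2⟩⟩
        rintro ⟨rfl | h, h2⟩
        · exact absurd h2 hiU
        · exact ⟨h, h2⟩
      have e2 : B.Uᶜ \ insert i x.1 = (B.Uᶜ \ x.1).erase i := by
        ext j
        simp only [Finset.mem_sdiff, Finset.mem_compl, Finset.mem_erase, Finset.mem_insert]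
        tauto
      rw [e1, e2, Finset.card_erase_of_mem hi]
      have := Finset.card_pos.2 ⟨i, hi⟩
      omega
    · refine le_trans ?_ (moveProb_le_step R s _ _)
      rw [moveProb, NNReal.coe_div]
      refine div_le_div_of_nonneg_right ?_ (NNReal.coe_nonneg _)
      refine (min_le_right _ _).trans ?_
      rw [NNReal.coe_sum]
      refine le_trans ?_ (Finset.single_le_sum (fun j _ => NNReal.coe_nonneg _)
        (Finset.mem_univ i))
      simp [hix, hval, birthRate, hiU]

theorem mul_le_stepMean (p : Config B → PMF (Config B)) {f : Config B → ℝ} (hf : ∀ y, 0 ≤ f y)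
    (x y : Config B) : (p x y).toReal * f y ≤ stepMean p f x :=
  Finset.single_le_sum (f := fun y => (p x y).toReal * f y)
    (fun z _ => mul_nonneg ENNReal.toReal_nonneg (hf z)) (Finset.mem_univ y)

theorem stepMean_le_one_sub (p : Config B → PMF (Config B)) {f : Config B → ℝ}
    (hf : ∀ y, f y ≤ 1) (x y : Config B) :
    stepMean p f x ≤ 1 - (p x y).toReal * (1 - f y) := by
  have h := mul_le_stepMean p (f := fun y => 1 - f y) (fun y => sub_nonneg.2 (hf y)) x y
  have e := stepMean_add p (fun y => 1 - f y) f x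
  simp only [sub_add_cancel, stepMean_const] at e
  linarith

theorem escapeProb_pos (hU : B.U.Nonempty) (R : Rates) (s : ℝ) (hV : 0 < R.rateV s)
    {x : Config B} (hx : x ≠ allU B) : 0 < escapeProb B R s x := by
  induction h : distToV x generalizing x with
  | zero =>
    rw [eq_allV_of_distToV h, escapeProb_allV R hU]; exact one_pos
  | succ d ih =>
    by_cases hv : x = allV B
    · rw [hv, escapeProb_allV R hU]; exact one_pos
    obtain ⟨y, hyu, hyd, hy⟩ := exists_step_toward hv
    have h1 : escapeProb B R s x = stepMean (step B R s) (escapeProb B R s) x :=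
      hitBefore_step _ hv hx
    rw [h1]
    refine lt_of_lt_of_le (mul_pos ?_ (ih hyu (by omega)))
      (mul_le_stepMean _ (escapeProb_nonneg R s) x y)
    exact lt_of_lt_of_le (div_pos (lt_min one_pos (by exact_mod_cast hV)) (clockRate_pos B R hU s))
      (hy R s)

theorem epsCheck_pos (hU : B.U.Nonempty) (R : Rates) (s : ℝ) (hV : 0 < R.rateV s) :
    0 < epsCheck B R s := by
  obtain ⟨y, hyu, -, hy⟩ := exists_step_toward (allU_ne_allV hU)
  rw [epsCheck_eq_stepMean R hU]
  refine lt_of_lt_of_le (mul_pos ?_ (escapeProb_pos hU R s hV hyu))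
    (mul_le_stepMean _ (escapeProb_nonneg R s) _ y)
  exact lt_of_lt_of_le (div_pos (lt_min one_pos (by exact_mod_cast hV)) (clockRate_pos B R hU s))
    (hy R s)

theorem missProb_le_one (P : ℕ → Config B → PMF (Config B)) (a : Config B) (k : ℕ)
    (x : Config B) : missProb a k P x ≤ 1 := by
  induction k generalizing P x with
  | zero => unfold missProb; split_ifs <;> norm_num
  | succ k ih =>
    unfold missProb
    split_ifs
    · exact zero_le_one
    · exact (stepMean_mono _ (fun y => ih _ y) x).trans_eq (stepMean_const _ _ _)

theorem missProb_self (P : ℕ → Config B → PMF (Config B)) (a : Config B) (k : ℕ) :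
    missProb a k P a = 0 := by cases k <;> simp [missProb]

theorem missProb_succ_le (P : ℕ → Config B → PMF (Config B)) (a : Config B) (k : ℕ)
    (x : Config B) : missProb a (k + 1) P x ≤ missProb a k P x := by
  induction k generalizing P x with
  | zero =>
    by_cases hx : x = a
    · subst hx; simp [missProb_self]
    · have := missProb_le_one P a 1 x
      simpa [missProb, hx] using this
  | succ k ih =>
    by_cases hx : x = a
    · subst hx; simp [missProb_self]
    · rw [missProb, if_neg hx, missProb, if_neg hx]
      exact stepMean_mono _ (fun y => ih _ y) x

theorem missProb_antitone (P : ℕ → Config B → PMF (Config B)) (a x : Config B) :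
    Antitone fun k => missProb a k P x :=
  antitone_nat_of_succ_le fun k => missProb_succ_le P a k x

/-- If the rate in `V` is at least one and the clock rate is bounded, then `v` is hit. -/
theorem tendsto_missProb (hU : B.U.Nonempty) (R : Rates) (s : ℕ → ℝ) (Γ : ℝ)
    (hV : ∀ j, 1 ≤ R.rateV (s j)) (hΓ : ∀ j, (clockRate B R (s j) : ℝ) ≤ Γ) (x : Config B) :
    Tendsto (fun k => missProb (allV B) k (fun j => step B R (s j)) x) atTop (𝓝 0) := by
  have hΓ1 : 1 ≤ Γ := le_trans (by exact_mod_cast one_le_clockRate B R hU (s 0)) (hΓ 0)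
  set c : ℝ := 1 / Γ with hc
  have hc0 : 0 < c := by positivity
  have hc1 : c ≤ 1 := by rw [hc, div_le_one (by linarith)]; exact hΓ1
  set m := Fintype.card W
  set q : ℝ := 1 - c ^ m with hq
  have hq1 : q < 1 := by have := pow_pos hc0 m; linarith
  have hq0 : 0 ≤ q := by have := pow_le_one₀ (n := m) hc0.le hc1; linarith
  -- A monotone path to `v` of length `d` is followed with probability at least `c ^ d`. The
  -- statement ranges over all environments `s` because each step shifts the environment.
  have h1 : ∀ (d : ℕ) (s : ℕ → ℝ) (_ : ∀ j, 1 ≤ R.rateV (s j))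
      (_ : ∀ j, (clockRate B R (s j) : ℝ) ≤ Γ) (x : Config B), distToV x = d →
      missProb (allV B) d (fun j => step B R (s j)) x ≤ 1 - c ^ d := by
    intro d
    induction d with
    | zero =>
      intro s _ _ x hx
      rw [eq_allV_of_distToV hx, missProb_self]; simp
    | succ d ih =>
      intro s hV hΓ x hx
      by_cases hv : x = allV B
      · rw [hv, missProb_self]
        have := pow_le_one₀ (n := d + 1) hc0.le hc1
        linarith
      obtain ⟨y, -, hyd, hy⟩ := exists_step_toward hv
      rw [missProb, if_neg hv]
      refine (stepMean_le_one_sub _ (fun y => missProb_le_one _ _ _ _) x y).trans ?_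
      have h2 := ih (fun j => s (j + 1)) (fun j => hV _) (fun j => hΓ _) y (by omega)
      have h3 : c ≤ (step B R (s 0) x y).toReal := by
        refine le_trans ?_ (hy R (s 0))
        have : (1 : ℝ) ≤ R.rateV (s 0) := by exact_mod_cast hV 0
        rw [min_eq_left this, hc]
        exact one_div_le_one_div_of_le (clockRate_pos B R hU _) (hΓ 0)
      have h4 : c ^ d ≤ 1 - missProb (allV B) d (fun j => step B R (s (j + 1))) y := by linarith
      have h5 : c * c ^ d ≤ (step B R (s 0) x y).toReal
          * (1 - missProb (allV B) d (fun j => step B R (s (j + 1))) y) :=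
        mul_le_mul h3 h4 (by positivity) (by linarith)
      rw [pow_succ']
      linarith
  -- A further block of `m = |W|` steps misses `v` with probability at most `q`, from any state and
  -- in any shifted environment; iterating gives geometric decay.
  have h2 : ∀ (k : ℕ) (s : ℕ → ℝ) (_ : ∀ j, 1 ≤ R.rateV (s j))
      (_ : ∀ j, (clockRate B R (s j) : ℝ) ≤ Γ) (x : Config B),
      missProb (allV B) (m + k) (fun j => step B R (s j)) x
        ≤ q * missProb (allV B) k (fun j => step B R (s j)) x := by
    intro k
    induction k with
    | zero =>
      intro s hV hΓ x
      by_cases hv : x = allV B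
      · rw [hv, missProb_self, missProb_self, mul_zero]
      · have e : missProb (allV B) 0 (fun j => step B R (s j)) x = 1 := by simp [missProb, hv]
        rw [e, mul_one, add_zero]
        refine ((missProb_antitone _ _ _ (distToV_le x)).trans (h1 _ s hV hΓ x rfl)).trans ?_
        have := pow_le_pow_of_le_one hc0.le hc1 (distToV_le x)
        linarith
    | succ k ih =>
      intro s hV hΓ x
      by_cases hv : x = allV B
      · rw [hv, missProb_self, missProb_self, mul_zero]
      · rw [← add_assoc, missProb, if_neg hv, missProb, if_neg hv, ← stepMean_const_mul]
        exact stepMean_mono _ (fun y => ih (fun j => s (j + 1)) (fun j => hV _) (fun j => hΓ _) y) x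
  have h3 : ∀ j : ℕ, missProb (allV B) (m * j) (fun j => step B R (s j)) x ≤ q ^ j := by
    intro j
    induction j with
    | zero => simpa using missProb_le_one _ _ _ _
    | succ j ih =>
      rw [Nat.mul_succ, add_comm, pow_succ']
      exact (h2 _ s hV hΓ x).trans (mul_le_mul_of_nonneg_left ih hq0)
  rw [Metric.tendsto_atTop]
  intro ε hε
  obtain ⟨j, hj⟩ := exists_pow_lt_of_lt_one hε hq1
  refine ⟨m * j, fun k hk => ?_⟩
  rw [Real.dist_eq, sub_zero, abs_of_nonneg (missProb_nonneg _ _ _ _)]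
  exact ((missProb_antitone _ _ _ hk).trans (h3 j)).trans_lt hj

end Recurrence
end HardCore

namespace HardCore

/-! ### Probability that no trial succeeds: product lower bound and exponential upper bound -/

section Survival

variable {W : Type*} [Fintype W] [DecidableEq W] {B : BipartiteGraph W}

/-- The paths on which none of the visits to `u` before time `m` starts a successful trial. -/
def noSuccessSet (B : BipartiteGraph W) (m : ℕ) : Set (ℕ → Config B) :=
  {ω | ∀ j < m, ω j = allU B → (fun i => ω (i + j)) ∉ successSet B}

theorem measurableSet_noSuccessSet (m : ℕ) : MeasurableSet (noSuccessSet B m) := by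
  have : noSuccessSet B m = ⋂ j, ⋂ (_ : j < m), ((fun ω : ℕ → Config B => ω j) ⁻¹' {allU B}
      ∩ (fun (ω : ℕ → Config B) (i : ℕ) => ω (i + j)) ⁻¹' successSet B)ᶜ := by
    ext ω
    simp only [noSuccessSet, Set.mem_ofPred_eq, Set.mem_iInter, Set.mem_compl_iff, Set.mem_inter_iff,
      Set.mem_preimage, Set.mem_singleton_iff, not_and]
  rw [this]
  refine MeasurableSet.iInter fun j => MeasurableSet.iInter fun _ => MeasurableSet.compl
    ((measurable_pi_apply j (MeasurableSet.singleton _)).inter ?_)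
  exact (measurable_pi_lambda _ fun i => measurable_pi_apply (i + j)) measurableSet_successSet

theorem consPath_mem_noSuccessSet (x : Config B) (ω : ℕ → Config B) (m : ℕ) :
    consPath x ω ∈ noSuccessSet B (m + 1) ↔
      (x = allU B → consPath x ω ∉ successSet B) ∧ ω ∈ noSuccessSet B m := by
  constructor
  · intro h
    exact ⟨fun hx => h 0 (Nat.succ_pos m) hx, fun j hj hu => h (j + 1) (by omega) hu⟩
  · rintro ⟨h0, h⟩ (_ | j) hj hu
    · exact h0 hu
    · exact h j (by omega) hu

theorem disjoint_hitBefore (a b : Config B) : Disjoint (hitBefore a b) (hitBefore b a) :=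
  Set.disjoint_left.2 fun ω (h : hitTick a ω < hitTick b ω) (h' : hitTick b ω < hitTick a ω) =>
    lt_asymm h h'

/-- From every state and time, `u` or `v` is hit almost surely. -/
def HitsEnds (P : ℕ → Config B → PMF (Config B)) : Prop :=
  ∀ (n : ℕ) (x : Config B), pathProb (fun j => P (j + n)) (hitBefore (allU B) (allV B)) x
    + pathProb (fun j => P (j + n)) (hitBefore (allV B) (allU B)) x = 1

theorem HitsEnds.tail {P : ℕ → Config B → PMF (Config B)} (h : HitsEnds P) (n : ℕ) :
    HitsEnds fun j => P (j + n) := by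
  intro k x
  have := h (k + n) x
  simp only [← add_assoc] at this
  exact this

/-- The probability of hitting `u` before `v` and of having no successful trial that starts before
time `m`. -/
noncomputable def survivalProb (B : BipartiteGraph W) :
    ℕ → (ℕ → Config B → PMF (Config B)) → Config B → ℝ
  | 0, P, x => pathProb P (hitBefore (allU B) (allV B)) x
  | m + 1, P, x => if x = allV B then 0 else
      stepMean (P 0) (survivalProb B m fun j => P (j + 1)) x

variable {P : ℕ → Config B → PMF (Config B)}

/-- First-step induction. Failure of a trial at `u` means, up to a null set, that after one step `u`
is hit before `v`; carrying this event along makes the induction hypothesis apply again. Away from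
`u` no trial starts and the event is simply transported. -/
theorem pathProb_inter_noSuccessSet (hU : B.U.Nonempty) (hP : HitsEnds P) (m : ℕ) (x : Config B) :
    pathProb P (hitBefore (allU B) (allV B) ∩ noSuccessSet B m) x = survivalProb B m P x := by
  have huv := allU_ne_allV hU
  induction m generalizing P x with
  | zero =>
    have : noSuccessSet B 0 = Set.univ := by ext ω; simp [noSuccessSet]
    rw [this, Set.inter_univ, survivalProb]
  | succ m ih =>
    rw [pathProb_eq_stepMean _ ((measurableSet_hitBefore _ _).inter (measurableSet_noSuccessSet _)),
      survivalProb]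
    by_cases hv : x = allV B
    · have : consPath x ⁻¹' (hitBefore (allU B) (allV B) ∩ noSuccessSet B (m + 1)) = ∅ := by
        ext ω
        simp [hv, hitBefore, hitTick_consPath_self]
      rw [if_pos hv, this]
      simp [stepMean]
    rw [if_neg hv, ← funext (ih (hP.tail 1))]
    unfold stepMean
    refine Finset.sum_congr rfl fun y _ => ?_
    congr 1
    by_cases hu : x = allU B
    · subst hu
      have h1 : consPath (allU B) ⁻¹' (hitBefore (allU B) (allV B) ∩ noSuccessSet B (m + 1))
          = (hitBefore (allV B) (allU B))ᶜ ∩ noSuccessSet B m := by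
        ext ω
        have h2 : consPath (allU B) ω ∈ hitBefore (allU B) (allV B) := by
          simp [hitBefore, hitTick_consPath_self, hitTick_consPath_of_ne huv]
        have h3 : consPath (allU B) ω ∈ successSet B ↔ ω ∈ hitBefore (allV B) (allU B) := by
          rw [← consPath_preimage_successSet huv]; rfl
        simp only [Set.mem_preimage, Set.mem_inter_iff, h2, true_and, consPath_mem_noSuccessSet,
          h3, forall_const, Set.mem_compl_iff]
      rw [h1]
      -- Not hitting `v` before `u` and hitting `u` before `v` differ only by a null set, by
      -- `HitsEnds`.
      refine measureReal_congr ?_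
      refine Filter.EventuallyEq.inter ?_ (ae_eq_refl _)
      have hsub : hitBefore (allU B) (allV B) ⊆ (hitBefore (allV B) (allU B))ᶜ :=
        fun ω h => Set.disjoint_left.1 (disjoint_hitBefore _ _) h
      refine (ae_eq_of_subset_of_measure_ge hsub ?_
        (measurableSet_hitBefore _ _).nullMeasurableSet (measure_ne_top _ _)).symm
      have h4 := hP 1 y
      rw [prob_compl_eq_one_sub (measurableSet_hitBefore _ _)]
      refine tsub_le_iff_right.2 ?_
      unfold pathProb at h4
      rw [← measureReal_union₀' (measurableSet_hitBefore _ _).nullMeasurableSet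
        (disjoint_hitBefore _ _).aedisjoint] at h4
      have h5 := measure_union_le (μ := chainLaw B (fun j => P (j + 1)) y)
        (hitBefore (allU B) (allV B)) (hitBefore (allV B) (allU B))
      refine le_trans (le_of_eq ?_) h5
      have h6 := congrArg ENNReal.ofReal h4
      rw [ofReal_measureReal, ENNReal.ofReal_one] at h6
      exact h6.symm
    · have h1 : consPath x ⁻¹' (hitBefore (allU B) (allV B) ∩ noSuccessSet B (m + 1))
          = hitBefore (allU B) (allV B) ∩ noSuccessSet B m := by
        ext ω
        simp [consPath_mem_noSuccessSet, hu, hitBefore, hitTick_consPath_of_ne hu,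
          hitTick_consPath_of_ne hv]
      rw [h1]

theorem pathProb_noSuccessSet (hU : B.U.Nonempty) (hP : HitsEnds P) (m : ℕ) :
    pathProb P (noSuccessSet B m) (allU B) = survivalProb B m P (allU B) := by
  have huv := allU_ne_allV hU
  rw [← pathProb_inter_noSuccessSet hU hP, pathProb_eq_stepMean _ (measurableSet_noSuccessSet _),
    pathProb_eq_stepMean _ ((measurableSet_hitBefore _ _).inter (measurableSet_noSuccessSet _))]
  have : consPath (allU B) ⁻¹' hitBefore (allU B) (allV B) = Set.univ := by
    ext ω
    simp [hitBefore, hitTick_consPath_self, hitTick_consPath_of_ne huv]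
  rw [Set.preimage_inter, this, Set.univ_inter]

/-- The probability that the trial that starts at `u` at time `0` is successful. -/
noncomputable def successProb (P : ℕ → Config B → PMF (Config B)) : ℝ :=
  pathProb P (successSet B) (allU B)

theorem successProb_nonneg : 0 ≤ successProb P := pathProb_nonneg _ _ _

theorem successProb_le_one : successProb P ≤ 1 := pathProb_le_one _ _ _

theorem failure_prob (hU : B.U.Nonempty) (hP : HitsEnds P) :
    stepMean (P 0) (pathProb (fun j => P (j + 1)) (hitBefore (allU B) (allV B))) (allU B)
      = 1 - successProb P := by
  rw [successProb, successSet_prob P (allU_ne_allV hU), eq_sub_iff_add_eq, ← stepMean_add,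
    funext (hP 1), stepMean_const]

theorem survivalProb_allV (m : ℕ) : survivalProb B m P (allV B) = 0 := by
  cases m with
  | zero => exact hitBefore_other _
  | succ m => simp [survivalProb]

/-- At `u` the failure probability supplies exactly the factor for the current time. At any other
state the factor is paid although no trial starts, which only lowers the bound. -/
theorem le_survivalProb (hU : B.U.Nonempty) (hP : HitsEnds P) (m : ℕ) (x : Config B) :
    (∏ j ∈ Finset.range m, (1 - successProb fun i => P (i + j)))
      * pathProb P (hitBefore (allU B) (allV B)) x ≤ survivalProb B m P x := by
  have huv := allU_ne_allV hU
  induction m generalizing P x with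
  | zero => simp [survivalProb]
  | succ m ih =>
    by_cases hv : x = allV B
    · rw [hv, hitBefore_other, mul_zero, survivalProb_allV]
    rw [survivalProb, if_neg hv]
    refine le_trans ?_ (stepMean_mono _ (fun y => ih (hP.tail 1) y) x)
    rw [stepMean_const_mul, Finset.prod_range_succ']
    have h0 : 0 ≤ ∏ j ∈ Finset.range m, (1 - successProb fun i => P (i + j + 1)) :=
      Finset.prod_nonneg fun j _ => sub_nonneg.2 successProb_le_one
    have hs0 : 0 ≤ 1 - successProb fun i => P (i + 0) := sub_nonneg.2 successProb_le_one
    have hs1 : (1 - successProb fun i => P (i + 0)) ≤ 1 := sub_le_self _ successProb_nonneg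
    rw [mul_assoc]
    refine mul_le_mul_of_nonneg_left ?_ h0
    by_cases hu : x = allU B
    · subst hu
      rw [hitBefore_self _ huv, mul_one, failure_prob hU hP]
      rfl
    · rw [hitBefore_step P hu hv]
      exact mul_le_of_le_one_left (stepMean_nonneg _ (fun y => pathProb_nonneg _ _ _) _) hs1

/-- If the chain were at `u` at all times, the first exponential alone would do. A tick spent
elsewhere wastes one term `e j ≤ ebar`; the sum over `c` counts the expected wasted ticks before the
first visit to `u`, and `κ` bounds the expected wasted ticks in each later failed trial, cut off at
the remaining horizon. Since at most `m` trials start, the total loss is at most `ebar * κ * m` plus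
the initial term. -/
theorem survivalProb_le (hU : B.U.Nonempty) (hP : HitsEnds P) (m : ℕ) (e : ℕ → ℝ) (ebar κ : ℝ)
    (hebar : 0 ≤ ebar) (hκ : 0 ≤ κ)
    (he0 : ∀ j < m, 0 ≤ e j) (he : ∀ j < m, e j ≤ successProb fun i => P (i + j))
    (heb : ∀ j < m, e j ≤ ebar)
    (hθ : ∀ j < m, ∑ c ∈ Finset.range (m - 1 - j),
      pathProb (fun i => P (i + j)) (failureAfterSet B (c + 1)) (allU B) ≤ κ) (x : Config B) :
    survivalProb B m P x ≤ (Real.exp (-∑ j ∈ Finset.range m, e j) + ebar * κ * m)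
        * pathProb P (hitBefore (allU B) (allV B)) x
      + ebar * ∑ c ∈ Finset.range m, pathProb P (hitBeforeAfter c (allU B) (allV B)) x := by
  have huv := allU_ne_allV hU
  induction m generalizing P e x with
  | zero => simp [survivalProb]
  | succ m ih =>
    by_cases hv : x = allV B
    · rw [hv, hitBefore_other, mul_zero, survivalProb_allV, zero_add]
      exact mul_nonneg hebar (Finset.sum_nonneg fun c _ => pathProb_nonneg _ _ _)
    have ih' := ih (P := fun j => P (j + 1)) (e := fun j => e (j + 1)) (hP.tail 1)
      (fun j hj => he0 (j + 1) (by omega)) (fun j hj => he (j + 1) (by omega))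
      (fun j hj => heb (j + 1) (by omega)) (fun j hj => by
        have := hθ (j + 1) (by omega)
        rw [show m + 1 - 1 - (j + 1) = m - 1 - j by omega] at this
        exact this)
    rw [survivalProb, if_neg hv]
    refine (stepMean_mono _ ih' x).trans ?_
    rw [stepMean_add, stepMean_const_mul, stepMean_const_mul, stepMean_sum,
      Finset.sum_range_succ' e]
    set E' := ∑ j ∈ Finset.range m, e (j + 1) with hE'
    have hE'0 : 0 ≤ E' := Finset.sum_nonneg fun j hj =>
      he0 (j + 1) (by have := Finset.mem_range.1 hj; omega)
    have he00 := he0 0 (Nat.succ_pos m)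
    have heb0 := heb 0 (Nat.succ_pos m)
    have hexp : Real.exp (-(E' + e 0)) = Real.exp (-E') * Real.exp (-e 0) := by
      rw [← Real.exp_add]; congr 1; ring
    have h1e : 1 - e 0 ≤ Real.exp (-e 0) := by
      have := Real.add_one_le_exp (-e 0); linarith
    have hmul := mul_le_mul_of_nonneg_left h1e (Real.exp_pos (-E')).le
    have hexp1 : Real.exp (-E') ≤ 1 := Real.exp_le_one_iff.2 (by linarith)
    push_cast
    by_cases hu : x = allU B
    · subst hu
      have h2 := hθ 0 (Nat.succ_pos m)
      rw [failure_prob hU hP, hitBefore_self _ huv]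
      simp only [← failureAfterSet_succ_prob P huv]
      have h2' : ∑ c ∈ Finset.range m, pathProb P (failureAfterSet B (c + 1)) (allU B) ≤ κ := h2
      have h3 : e 0 ≤ successProb P := he 0 (Nat.succ_pos m)
      have h4 : 0 ≤ ∑ c ∈ Finset.range (m + 1),
          pathProb P (hitBeforeAfter c (allU B) (allV B)) (allU B) :=
        Finset.sum_nonneg fun c _ => pathProb_nonneg _ _ _
      have h5 := mul_le_mul_of_nonneg_left h2' hebar
      have h6 := mul_nonneg hebar h4
      -- At `u` the failure factor `1 - successProb P ≤ 1 - e 0 ≤ exp (-e 0)` contributes the new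
      -- term of the exponent, while the ticks wasted by the trial contribute at most `ebar * κ`.
      have h7 : Real.exp (-E') * (1 - successProb P) ≤ Real.exp (-E') * (1 - e 0) :=
        mul_le_mul_of_nonneg_left (by linarith) (Real.exp_pos _).le
      have h8 : ebar * κ * m * (1 - successProb P) ≤ ebar * κ * m :=
        mul_le_of_le_one_right (by positivity) (by linarith [successProb_nonneg (P := P)])
      rw [hexp]
      nlinarith
    · rw [← hitBefore_step P hu hv]
      simp only [← hitBeforeAfter_succ P hu hv]
      rw [Finset.sum_range_succ' (fun c => pathProb P (hitBeforeAfter c (allU B) (allV B)) x),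
        hitBeforeAfter_zero P hu]
      set h := pathProb P (hitBefore (allU B) (allV B)) x with hh
      have hh0 : 0 ≤ h := pathProb_nonneg _ _ _
      set S := ∑ c ∈ Finset.range m, pathProb P (hitBeforeAfter (c + 1) (allU B) (allV B)) x
      -- Away from `u` the missing term `e 0` is replaced by the additive error `ebar`, which the
      -- new summand `c = 0` of the waiting-time sum pays for.
      have h1 : Real.exp (-E') ≤ Real.exp (-(E' + e 0)) + ebar := by
        rw [hexp]
        have : Real.exp (-E') * e 0 ≤ ebar :=
          (mul_le_of_le_one_left he00 hexp1).trans heb0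
        linarith
      have h2 : Real.exp (-E') * h ≤ (Real.exp (-(E' + e 0)) + ebar) * h :=
        mul_le_mul_of_nonneg_right h1 hh0
      have h3 : 0 ≤ ebar * κ * h := by positivity
      linarith

/-! ### The length of failed trials -/

/-- The tail sum `T` beyond `C` is at most its first block, bounded by `C * a C`, plus a copy of
itself shifted by `C`, which is at most `η * T ≤ T / 2`. -/
theorem sum_range_le_of_geometric {a : ℕ → ℝ} (ha0 : ∀ c, 0 ≤ a c) (ha : Antitone a) (C L : ℕ)
    {η : ℝ} (hη : η ≤ 1 / 2) (h : ∀ c < L, a (c + C) ≤ η * a c) :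
    ∑ c ∈ Finset.range L, a c ≤ ∑ c ∈ Finset.range C, a c + 2 * C * a C := by
  set T := ∑ c ∈ Finset.Ico C L, a c with hT
  have hT0 : 0 ≤ T := Finset.sum_nonneg fun c _ => ha0 c
  have h1 : ∑ c ∈ Finset.range L, a c ≤ ∑ c ∈ Finset.range C, a c + T := by
    rw [hT, ← Finset.sum_union]
    · refine Finset.sum_le_sum_of_subset_of_nonneg (fun c hc => ?_) (fun c _ _ => ha0 c)
      simp only [Finset.mem_range, Finset.mem_union, Finset.mem_Ico] at hc ⊢
      omega
    · rw [Finset.disjoint_left]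
      intro c hc hc'
      simp only [Finset.mem_range, Finset.mem_Ico] at hc hc'
      omega
  have h2 : T ≤ ∑ c ∈ Finset.Ico C (2 * C), a c + ∑ c ∈ Finset.Ico C L, a (c + C) := by
    rw [Finset.sum_Ico_add' a C L C, ← Finset.sum_union]
    · refine Finset.sum_le_sum_of_subset_of_nonneg (fun c hc => ?_) (fun c _ _ => ha0 c)
      simp only [Finset.mem_union, Finset.mem_Ico] at hc ⊢
      omega
    · rw [Finset.disjoint_left]
      intro c hc hc'
      simp only [Finset.mem_Ico] at hc hc'
      omega
  have h3 : ∑ c ∈ Finset.Ico C (2 * C), a c ≤ C * a C := by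
    have := Finset.sum_le_card_nsmul (Finset.Ico C (2 * C)) a (a C)
      (fun c hc => ha (Finset.mem_Ico.1 hc).1)
    rw [Nat.card_Ico, nsmul_eq_mul, show 2 * C - C = C by omega] at this
    exact this
  have h4 : ∑ c ∈ Finset.Ico C L, a (c + C) ≤ η * T := by
    rw [hT, Finset.mul_sum]
    exact Finset.sum_le_sum fun c hc => h c (Finset.mem_Ico.1 hc).2
  nlinarith

/-- After `c` ticks without hitting either end, the waiting time restarts from some state other than
`u` and `v`, where the hypothesis bounds the chance of waiting `C` more ticks. -/
theorem hitBeforeAfter_add_le (C c : ℕ) (η : ℝ)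
    (h3 : ∀ j ≤ c, ∀ x, x ≠ allU B → x ≠ allV B →
      pathProb (fun i => P (i + j)) (hitBeforeAfter C (allU B) (allV B)) x
        ≤ η * pathProb (fun i => P (i + j)) (hitBefore (allU B) (allV B)) x) (x : Config B) :
    pathProb P (hitBeforeAfter (c + C) (allU B) (allV B)) x
      ≤ η * pathProb P (hitBeforeAfter c (allU B) (allV B)) x := by
  induction c generalizing P x with
  | zero =>
    by_cases hx : x = allU B ∨ x = allV B
    · rw [hitBeforeAfter_of_eq P hx, hitBeforeAfter_of_eq P hx, mul_zero]
    · rw [not_or] at hx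
      rw [zero_add, hitBeforeAfter_zero P hx.1]
      exact h3 0 le_rfl x hx.1 hx.2
  | succ c ih =>
    by_cases hx : x = allU B ∨ x = allV B
    · rw [hitBeforeAfter_of_eq P hx, hitBeforeAfter_of_eq P hx, mul_zero]
    · rw [not_or] at hx
      rw [show c + 1 + C = c + C + 1 by omega, hitBeforeAfter_succ P hx.1 hx.2,
        hitBeforeAfter_succ P hx.1 hx.2, ← stepMean_const_mul]
      exact stepMean_mono _ (fun y => ih (P := fun j => P (j + 1))
        (fun j hj => h3 (j + 1) (by omega)) y) x

theorem failureAfterSet_antitone : Antitone (failureAfterSet B) := by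
  intro c d hcd ω hω
  exact ⟨lt_of_le_of_lt (by exact_mod_cast hcd) hω.1, hω.2⟩

/-- Write `θ c` for the probability of a failed trial with more than `c` ticks, so that `θ 0 = r`.
The truncated mean gives `∑ θ c ≤ η r + (C + 1) θ (C + 1) ≤ 3 η r` over `1 ≤ c ≤ C`; beyond `C` the
decay by a factor `η` every `C` ticks adds at most `2 C θ (C + 1) ≤ 2 η r`. -/
theorem sum_failureAfterSet_le (hU : B.U.Nonempty) (C L : ℕ) {η r : ℝ} (hC : 0 < C)
    (hη : η ≤ 1 / 2)
    (h3 : ∀ j ≤ L, ∀ x, x ≠ allU B → x ≠ allV B →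
      pathProb (fun i => P (i + j)) (hitBeforeAfter C (allU B) (allV B)) x
        ≤ η * pathProb (fun i => P (i + j)) (hitBefore (allU B) (allV B)) x)
    (h0 : pathProb P (failureAfterSet B 0) (allU B) = r)
    (h1 : ∑ c ∈ Finset.range (C + 1), pathProb P (failureAfterSet B c) (allU B)
      - (C + 1) * pathProb P (failureAfterSet B (C + 1)) (allU B) ≤ (1 + η) * r)
    (h2 : C * pathProb P (failureAfterSet B (C + 1)) (allU B) ≤ η * r) :
    ∑ c ∈ Finset.range L, pathProb P (failureAfterSet B (c + 1)) (allU B) ≤ 5 * η * r := by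
  have huv := allU_ne_allV hU
  have h := sum_range_le_of_geometric (a := fun c => pathProb P (failureAfterSet B (c + 1))
    (allU B)) (fun c => pathProb_nonneg _ _ _)
    (fun c d hcd => pathProb_mono _ (failureAfterSet_antitone (by omega)) _) C L hη (fun c hc => by
      rw [failureAfterSet_succ_prob P huv, failureAfterSet_succ_prob P huv, ← stepMean_const_mul]
      exact stepMean_mono _ (fun y => hitBeforeAfter_add_le (P := fun j => P (j + 1)) C c η
        (fun j hj => h3 (j + 1) (by omega)) y) _)
  rw [Finset.sum_range_succ'] at h1
  have hC1 : (1 : ℝ) ≤ C := by exact_mod_cast hC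
  have hθ : pathProb P (failureAfterSet B (C + 1)) (allU B)
      ≤ C * pathProb P (failureAfterSet B (C + 1)) (allU B) :=
    le_mul_of_one_le_left (pathProb_nonneg _ _ _) hC1
  nlinarith

end Survival
end HardCore

namespace HardCore

/-! ### The chain given the clock, compared with homogeneous environments -/

section Quenched

variable {W : Type*} [Fintype W] [DecidableEq W] {B : BipartiteGraph W}

/-- The step laws of the chain observed at the ticks of the clock `ξ`. -/
noncomputable def clockSteps (B : BipartiteGraph W) (R : Rates) (ξ : ℕ → ℝ) (j : ℕ) :
    Config B → PMF (Config B) := step B R (ξ (j + 1))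

theorem quenchedLaw_eq (R : Rates) (ξ : ℕ → ℝ) (n : ℕ) (x : Config B) :
    quenchedLaw B R ξ n x = chainLaw B (fun j => clockSteps B R ξ (j + n)) x := by
  unfold quenchedLaw clockSteps
  congr 1
  funext j
  rw [add_comm n j]

theorem quenchedLaw_real (R : Rates) (ξ : ℕ → ℝ) (n : ℕ) (x : Config B)
    (E : Set (ℕ → Config B)) :
    (quenchedLaw B R ξ n x).real E = pathProb (fun j => clockSteps B R ξ (j + n)) E x := by
  rw [quenchedLaw_eq]; rfl

instance (R : Rates) (ξ : ℕ → ℝ) (n : ℕ) (x : Config B) :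
    IsProbabilityMeasure (quenchedLaw B R ξ n x) := by
  rw [quenchedLaw_eq]; infer_instance

/-- Rates of the kind considered here: the rate in `U` decreases, the rate in `V` increases and is
at least one after time `0`, and both are constant after time `t`. -/
structure Rates.IsFrozen (R : Rates) (t : ℝ) : Prop where
  nonneg : 0 ≤ t
  antitone : Antitone R.rateU
  monotone : Monotone R.rateV
  frozenU : ∀ s, t ≤ s → R.rateU s = R.rateU t
  frozenV : ∀ s, t ≤ s → R.rateV s = R.rateV t
  one_le : 1 ≤ R.rateV 0

variable {R : Rates} {t : ℝ} (hR : R.IsFrozen t) (hU : B.U.Nonempty)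
include hR

theorem Rates.IsFrozen.rateU_ge (s : ℝ) : R.rateU t ≤ R.rateU s := by
  rcases le_total s t with h | h
  · exact hR.antitone h
  · rw [hR.frozenU s h]

theorem Rates.IsFrozen.rateV_le (s : ℝ) : R.rateV s ≤ R.rateV t := by
  rcases le_total s t with h | h
  · exact hR.monotone h
  · rw [hR.frozenV s h]

theorem clockRate_of_le {s : ℝ} (hs : t ≤ s) : clockRate B R s = clockRate B R t := by
  unfold clockRate
  rw [hR.frozenU s hs, hR.frozenV s hs]

theorem clockRate_le_bound {s : ℝ} (hs : 0 ≤ s) : (clockRate B R s : ℝ) ≤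
    ((1 + R.rateU 0) * (B.U.card : ℝ≥0) + (1 + R.rateV t) * ((B.Uᶜ).card : ℝ≥0) : ℝ≥0) := by
  rw [NNReal.coe_le_coe]
  unfold clockRate
  gcongr
  · exact hR.antitone hs
  · exact hR.rateV_le s

theorem successRate_mono (hU : B.U.Nonempty) :
    Monotone fun s => (clockRate B R s : ℝ) * epsCheck B R s :=
  fun _ _ h => clockRate_mul_epsCheck_le hU (hR.antitone h) (hR.monotone h)

theorem successRate_le (hU : B.U.Nonempty) (s : ℝ) :
    (clockRate B R s : ℝ) * epsCheck B R s ≤ (clockRate B R t : ℝ) * epsCheck B R t :=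
  clockRate_mul_epsCheck_le hU (hR.rateU_ge s) (hR.rateV_le s)

theorem measurable_clockRate : Measurable fun s => (clockRate B R s : ℝ) := by
  unfold clockRate
  have h1 := hR.antitone.measurable
  have h2 := hR.monotone.measurable
  fun_prop

theorem measurable_epsCheck (hU : B.U.Nonempty) : Measurable (epsCheck B R) := by
  have : epsCheck B R = fun s => (clockRate B R s : ℝ) * epsCheck B R s / clockRate B R s := by
    funext s
    rw [mul_div_cancel_left₀ _ (clockRate_pos B R hU s).ne']
  rw [this]
  exact (successRate_mono hR hU).measurable.div (measurable_clockRate hR)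

/-- Combine `γ(s) ε̌(s) ≤ γ(t) ε̌(t)` with `γ(t) ≤ A γ(s)` and cancel `γ(s)`. -/
theorem epsCheck_le_of_clockRate_le (hU : B.U.Nonempty) {A s : ℝ}
    (hA : (clockRate B R t : ℝ) ≤ A * clockRate B R s) :
    epsCheck B R s ≤ A * epsCheck B R t := by
  have h1 := successRate_le hR hU s
  have h2 := mul_le_mul_of_nonneg_right hA (epsCheck_nonneg (B := B) R t)
  refine le_of_mul_le_mul_left ?_ (clockRate_pos B R hU s)
  linarith

variable {ξ : ℕ → ℝ} (hξ : IsClock ξ)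
include hξ

omit hR in
theorem IsClock.nonneg (n : ℕ) : 0 ≤ ξ n := by
  rw [← hξ.1]; exact hξ.2.1.monotone (Nat.zero_le n)

theorem hitsEnds_clockSteps (hU : B.U.Nonempty) : HitsEnds (clockSteps B R ξ) := by
  intro n x
  rw [add_comm]
  refine hitBefore_add _ (allU_ne_allV hU).symm ?_
  exact tendsto_missProb hU R (fun j => ξ (j + n + 1)) _
    (fun j => hR.one_le.trans (hR.monotone (hξ.nonneg _)))
    (fun j => clockRate_le_bound hR (hξ.nonneg _)) x

/-- In a time-inhomogeneous environment that improves with time, a trial is at least as likely to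
be successful as in the environment at its first step. -/
theorem epsCheck_le_successProb (hU : B.U.Nonempty) (n : ℕ) :
    epsCheck B R (ξ (n + 1)) ≤ successProb fun i => clockSteps B R ξ (i + n) := by
  rw [epsCheck_eq_stepMean R hU, successProb, successSet_prob _ (allU_ne_allV hU)]
  have e : clockSteps B R ξ (0 + n) = step B R (ξ (n + 1)) := by rw [zero_add]; rfl
  rw [e]
  refine stepMean_mono _ (fun y => ?_) _
  refine le_hitBefore_of_subharmonic (f := escapeProb B R (ξ (n + 1))) _ (allU_ne_allV hU).symm
    (escapeProb_le_one R _) (escapeProb_allU R _).le (fun j x hv hu => ?_) ?_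
  · exact le_stepMean_escapeProb hU (hR.antitone (hξ.2.1.monotone (by omega)))
      (hR.monotone (hξ.2.1.monotone (by omega))) hu hv
  · exact tendsto_missProb hU R (fun j => ξ (j + 1 + n + 1)) _
      (fun j => hR.one_le.trans (hR.monotone (hξ.nonneg _)))
      (fun j => clockRate_le_bound hR (hξ.nonneg _)) y

omit hR hξ in
theorem stepMean_escapeProb_allU_le (hU : B.U.Nonempty) {s s' : ℝ}
    (h1 : R.rateU s' ≤ R.rateU s) (h2 : R.rateV s ≤ R.rateV s') :
    (clockRate B R s : ℝ) * stepMean (step B R s) (escapeProb B R s') (allU B)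
      ≤ clockRate B R s' * epsCheck B R s' := by
  rw [clockRate_mul_epsCheck R hU]
  refine le_trans (le_of_eq ?_) (generator_le_generator h1 h2 (isIncreasing_escapeProb R hU s') _)
  rw [← clockRate_mul_stepMean_sub B R hU, escapeProb_allU, sub_zero]

-- Freezing makes the environment at time `t` the most favourable one of all, so `h_t` is
-- superharmonic along the whole trial, however long it lasts.
omit hξ in
theorem clockRate_mul_successProb_le (hU : B.U.Nonempty) (n : ℕ) :
    (clockRate B R (ξ (n + 1)) : ℝ) * successProb (fun i => clockSteps B R ξ (i + n))
      ≤ clockRate B R t * epsCheck B R t := by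
  refine le_trans ?_ (stepMean_escapeProb_allU_le (s := ξ (n + 1)) hU (hR.rateU_ge _)
    (hR.rateV_le _))
  refine mul_le_mul_of_nonneg_left ?_ (NNReal.coe_nonneg _)
  rw [successProb, successSet_prob _ (allU_ne_allV hU)]
  have e : clockSteps B R ξ (0 + n) = step B R (ξ (n + 1)) := by rw [zero_add]; rfl
  rw [e]
  refine stepMean_mono _ (fun y => ?_) _
  exact hitBefore_le_of_superharmonic _ (f := escapeProb B R t) (allU_ne_allV hU).symm
    (escapeProb_nonneg R t) (escapeProb_allV R hU t).ge
    (fun j x hv hu => stepMean_escapeProb_le hU (hR.rateU_ge _) (hR.rateV_le _) hu hv) y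

/-- A trial that is required to finish within `k + 1` ticks only sees rates up to time `s'`, and for
these `h_{s'}` is superharmonic. -/
theorem clockRate_mul_successWithin_le (hU : B.U.Nonempty) (n k : ℕ) {s' : ℝ}
    (hs' : ξ (n + (k + 1)) ≤ s') :
    (clockRate B R (ξ (n + 1)) : ℝ) *
        pathProb (fun i => clockSteps B R ξ (i + n)) (successWithinSet B (k + 1)) (allU B)
      ≤ clockRate B R s' * epsCheck B R s' := by
  have hle : ∀ j ≤ k + 1, ξ (j + n) ≤ s' := fun j hj =>
    (hξ.2.1.monotone (by omega)).trans hs'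
  have hle1 : ξ (n + 1) ≤ s' := by
    have := hle 1 (by omega)
    rwa [add_comm 1 n] at this
  refine le_trans ?_ (stepMean_escapeProb_allU_le (s := ξ (n + 1)) hU (hR.antitone hle1)
    (hR.monotone hle1))
  refine mul_le_mul_of_nonneg_left ?_ (NNReal.coe_nonneg _)
  rw [successWithinSet_prob _ (allU_ne_allV hU)]
  have e : clockSteps B R ξ (0 + n) = step B R (ξ (n + 1)) := by rw [zero_add]; rfl
  rw [e]
  refine stepMean_mono _ (fun y => ?_) _
  refine hitBeforeWithin_le_of_superharmonic _ k (f := escapeProb B R s') (allU_ne_allV hU).symm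
    (escapeProb_nonneg R s') (escapeProb_allV R hU s').ge (fun j hj x hv hu => ?_) y
  have h1 : ξ (j + 1 + n + 1) ≤ s' := by
    have := hle (j + 2) (by omega)
    rwa [show j + 2 + n = j + 1 + n + 1 by omega] at this
  exact stepMean_escapeProb_le hU (hR.antitone h1) (hR.monotone h1) hu hv

end Quenched

/-! ### Conditions I to IV in unconditioned form -/

section Conditions

variable {W : Type*} [Fintype W] [DecidableEq W] {B : BipartiteGraph W}

theorem cond_real_apply' {Ω : Type*} [MeasurableSpace Ω] (μ : Measure Ω) {s : Set Ω}
    (hs : MeasurableSet s) (E : Set Ω) : (cond μ s).real E = (μ.real s)⁻¹ * μ.real (s ∩ E) := by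
  simp [Measure.real, cond_apply hs, ENNReal.toReal_mul, ENNReal.toReal_inv]

/-- The product formula also holds for a null conditioning event, where both sides vanish. -/
theorem cond_real_mul {Ω : Type*} [MeasurableSpace Ω] (μ : Measure Ω) [IsFiniteMeasure μ]
    {s : Set Ω} (hs : MeasurableSet s) (E : Set Ω) :
    (cond μ s).real E * μ.real s = μ.real (s ∩ E) := by
  rw [cond_real_apply' μ hs]
  by_cases h : μ.real s = 0
  · rw [h, mul_zero]
    exact le_antisymm measureReal_nonneg (h ▸ measureReal_mono Set.inter_subset_left)
  · field_simp

variable (R : Rates) (ξ : ℕ → ℝ) (n : ℕ)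

theorem failureSet_eq : {ω : ℕ → Config B | returnTick (allU B) ω < hitTick (allV B) ω}
    = failureAfterSet B 0 := by
  ext ω
  simp [failureAfterSet, returnTick_eq]

theorem hitBeforeAfter_le_of_fallBackLaw {x : Config B} {C : ℕ} {η : ℝ}
    (h : (fallBackLaw B R ξ n x).real {ω | (C : ℕ∞) < hitTick (allU B) ω} ≤ η) :
    pathProb (fun j => clockSteps B R ξ (j + n)) (hitBeforeAfter C (allU B) (allV B)) x
      ≤ η * pathProb (fun j => clockSteps B R ξ (j + n)) (hitBefore (allU B) (allV B)) x := by
  rw [← quenchedLaw_real, ← quenchedLaw_real]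
  refine le_trans (le_of_eq ?_) (mul_le_mul_of_nonneg_right h measureReal_nonneg)
  unfold fallBackLaw
  rw [show {ω : ℕ → Config B | hitTick (allU B) ω < hitTick (allV B) ω}
      = hitBefore (allU B) (allV B) from rfl,
    cond_real_mul _ (measurableSet_hitBefore (allU B) (allV B))]
  congr 1
  ext ω
  exact and_comm

theorem failureAfter_le_of_failedTrialLaw {C : ℕ} {η : ℝ}
    (h : C * (failedTrialLaw B R ξ n).real {ω | ((C + 1 : ℕ) : ℕ∞) < returnTick (allU B) ω} ≤ η) :
    C * pathProb (fun j => clockSteps B R ξ (j + n)) (failureAfterSet B (C + 1)) (allU B)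
      ≤ η * pathProb (fun j => clockSteps B R ξ (j + n)) (failureAfterSet B 0) (allU B) := by
  rw [← quenchedLaw_real, ← quenchedLaw_real]
  refine le_trans (le_of_eq ?_) (mul_le_mul_of_nonneg_right h measureReal_nonneg)
  unfold failedTrialLaw
  rw [failureSet_eq, mul_assoc, cond_real_mul _ (measurableSet_failureAfterSet 0),
    ← failureSet_eq]
  congr 2
  ext ω
  exact and_comm

/-- The sum of indicators is `min r (C + 1)`; the subtracted term removes its value `C + 1` where
`r` exceeds the truncation level. -/
theorem truncated_eq_sum (C : ℕ) (r : ℕ∞) :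
    (if r ≤ (C + 1 : ℕ) then (r.toNat : ℝ) else 0)
      = ∑ c ∈ Finset.range (C + 1), (if (c : ℕ∞) < r then (1 : ℝ) else 0)
        - (C + 1) * (if ((C + 1 : ℕ) : ℕ∞) < r then 1 else 0) := by
  by_cases hr : r ≤ (C + 1 : ℕ)
  · rw [if_pos hr, if_neg (not_lt.2 hr), mul_zero, sub_zero]
    lift r to ℕ using ne_top_of_le_ne_top (ENat.natCast_ne_top _) hr
    have hr' : r ≤ C + 1 := by exact_mod_cast hr
    simp only [ENat.toNat_natCast, Nat.cast_lt]
    rw [← Finset.sum_filter, Finset.sum_const, nsmul_eq_mul, mul_one]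
    congr 1
    have : (Finset.range (C + 1)).filter (fun c => c < r) = Finset.range r := by
      ext c; simp only [Finset.mem_filter, Finset.mem_range]; omega
    rw [this, Finset.card_range]
  · rw [if_neg hr, if_pos (not_le.1 hr), mul_one]
    have : ∀ c ∈ Finset.range (C + 1), (if (c : ℕ∞) < r then (1 : ℝ) else 0) = 1 := by
      intro c hc
      refine if_pos (lt_of_le_of_lt ?_ (not_le.1 hr))
      exact_mod_cast (Finset.mem_range.1 hc).le
    rw [Finset.sum_congr rfl this]
    simp

/-- Non-nullity of the failure event makes the conditional law a probability measure, so all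
indicators are integrable; multiplying by the failure probability then clears the conditioning. -/
theorem sum_failureAfter_of_failedTrialLaw {C : ℕ} {η : ℝ}
    (hr : pathProb (fun j => clockSteps B R ξ (j + n)) (failureAfterSet B 0) (allU B) ≠ 0)
    (h : |∫ ω, (if returnTick (allU B) ω ≤ (C + 1 : ℕ)
        then ((returnTick (allU B) ω).toNat : ℝ) else 0) ∂(failedTrialLaw B R ξ n) - 1| ≤ η) :
    ∑ c ∈ Finset.range (C + 1),
        pathProb (fun j => clockSteps B R ξ (j + n)) (failureAfterSet B c) (allU B)
      - (C + 1) * pathProb (fun j => clockSteps B R ξ (j + n)) (failureAfterSet B (C + 1)) (allU B)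
      ≤ (1 + η) * pathProb (fun j => clockSteps B R ξ (j + n)) (failureAfterSet B 0) (allU B) := by
  have h1 : ∫ ω, (if returnTick (allU B) ω ≤ (C + 1 : ℕ)
        then ((returnTick (allU B) ω).toNat : ℝ) else 0) ∂(failedTrialLaw B R ξ n) ≤ 1 + η := by
    have := (abs_le.1 h).2; linarith
  simp only [← quenchedLaw_real] at hr ⊢
  set μ := quenchedLaw B R ξ n (allU B) with hμ
  have hm : ∀ c : ℕ, MeasurableSet {ω : ℕ → Config B | (c : ℕ∞) < returnTick (allU B) ω} :=
    fun c => measurable_returnTick (allU B) (t := {r | (c : ℕ∞) < r}) MeasurableSet.of_discrete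
  have hprob : IsProbabilityMeasure (failedTrialLaw B R ξ n) := by
    refine cond_isProbabilityMeasure ?_
    rw [failureSet_eq]
    intro h0
    exact hr (by rw [Measure.real, h0]; rfl)
  have hint : ∀ c : ℕ, Integrable (fun ω => if (c : ℕ∞) < returnTick (allU B) ω then (1 : ℝ) else 0)
      (failedTrialLaw B R ξ n) := by
    intro c
    have := (integrable_const (μ := failedTrialLaw B R ξ n) (1 : ℝ)).indicator (hm c)
    refine this.congr (ae_of_all _ fun ω => ?_)
    simp [Set.indicator_apply]
  have hI : ∀ c : ℕ, ∫ ω, (if (c : ℕ∞) < returnTick (allU B) ω then (1 : ℝ) else 0)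
      ∂(failedTrialLaw B R ξ n)
      = (failedTrialLaw B R ξ n).real {ω | (c : ℕ∞) < returnTick (allU B) ω} := by
    intro c
    rw [← integral_indicator_one (hm c)]
    refine integral_congr_ae (ae_of_all _ fun ω => ?_)
    simp [Set.indicator_apply]
  have hc : ∀ c : ℕ, (failedTrialLaw B R ξ n).real {ω | (c : ℕ∞) < returnTick (allU B) ω}
      * μ.real (failureAfterSet B 0) = μ.real (failureAfterSet B c) := by
    intro c
    unfold failedTrialLaw
    rw [failureSet_eq, cond_real_mul _ (measurableSet_failureAfterSet 0), ← failureSet_eq]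
    congr 1
    ext ω
    exact and_comm
  simp only [truncated_eq_sum] at h1
  rw [integral_sub (integrable_finsetSum _ fun c _ => hint c) ((hint (C + 1)).const_mul _),
    integral_finsetSum _ fun c _ => hint c, integral_const_mul] at h1
  simp only [hI] at h1
  have h2 := mul_le_mul_of_nonneg_right h1
    (measureReal_nonneg (μ := μ) (s := failureAfterSet B 0))
  rw [sub_mul, Finset.sum_mul, mul_assoc] at h2
  simpa only [hc] using h2

/-- A successful trial is either short or falls into the tail event, whose share among the
successful trials is at most `η`. -/
theorem successProb_le_of_successfulTrialLaw {k : ℕ} {η : ℝ}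
    (h : (successfulTrialLaw B R ξ n).real {ω | (k : ℕ∞) < hitTick (allV B) ω} ≤ η) :
    (1 - η) * successProb (fun j => clockSteps B R ξ (j + n))
      ≤ pathProb (fun j => clockSteps B R ξ (j + n)) (successWithinSet B k) (allU B) := by
  have h1 := mul_le_mul_of_nonneg_right h
    (measureReal_nonneg (μ := quenchedLaw B R ξ n (allU B)) (s := successSet B))
  unfold successfulTrialLaw at h1
  rw [show {ω : ℕ → Config B | hitTick (allV B) ω < returnTick (allU B) ω} = successSet B from rfl,
    cond_real_mul _ measurableSet_successSet] at h1
  have h2 : (quenchedLaw B R ξ n (allU B)).real (successSet B)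
      ≤ (quenchedLaw B R ξ n (allU B)).real (successWithinSet B k)
        + (quenchedLaw B R ξ n (allU B)).real
          (successSet B ∩ {ω | (k : ℕ∞) < hitTick (allV B) ω}) := by
    refine le_trans (measureReal_mono ?_) (measureReal_union_le _ _)
    intro ω hω
    rcases le_or_gt (hitTick (allV B) ω) k with hk | hk
    · exact Or.inl ⟨hk, hω⟩
    · exact Or.inr ⟨hω, hk⟩
  rw [quenchedLaw_real, quenchedLaw_real] at h2
  rw [quenchedLaw_real (E := successSet B)] at h1
  unfold successProb
  linarith

end Conditions
end HardCore

namespace HardCore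

/-! ### From continuous-time events to events of the tick chain -/

section PathEvents

variable {W : Type*} [Fintype W] [DecidableEq W] {B : BipartiteGraph W}

theorem returnTick_le_iff (z : Config B) (ω : ℕ → Config B) (n : ℕ) :
    returnTick z ω ≤ n ↔ ∃ j, 1 ≤ j ∧ j ≤ n ∧ ω j = z := by
  rw [returnTick_eq]
  cases n with
  | zero =>
    simp only [Nat.cast_zero, nonpos_iff_eq_zero, add_eq_zero, one_ne_zero, and_false, false_iff]
    rintro ⟨j, h1, h2, _⟩
    omega
  | succ n =>
    rw [Nat.cast_add, Nat.cast_one, ENat.add_le_add_iff_right ENat.one_ne_top, hitTick_le_iff]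
    constructor
    · rintro ⟨j, hj, h⟩; exact ⟨j + 1, by omega, by omega, h⟩
    · rintro ⟨j, h1, h2, h⟩
      refine ⟨j - 1, by omega, ?_⟩
      rwa [Nat.sub_add_cancel h1]

variable {ξ : ℕ → ℝ} (hξ : IsClock ξ)
include hξ

theorem IsClock.exists_index {r : ℝ} (hr : 0 ≤ r) : ∃ m, ξ m ≤ r ∧ r < ξ (m + 1) := by
  have hex : ∃ n, r < ξ n := (hξ.2.2.eventually_gt_atTop r).exists
  classical
  have hpos : Nat.find hex ≠ 0 := by
    intro h
    have := Nat.find_spec hex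
    rw [h, hξ.1] at this
    linarith
  obtain ⟨m, hm⟩ := Nat.exists_eq_succ_of_ne_zero hpos
  refine ⟨m, ?_, ?_⟩
  · exact not_lt.1 (Nat.find_min hex (m := m) (by omega))
  · have := Nat.find_spec hex
    rwa [hm] at this

theorem IsClock.exists_tickCount {t : ℝ} (ht : 0 ≤ t) :
    ∃ N, ∀ n, n < N + 1 ↔ ξ n ≤ t := by
  obtain ⟨m, hm, hm'⟩ := hξ.exists_index ht
  refine ⟨m, fun n => ⟨fun h => (hξ.2.1.monotone (by omega)).trans hm, fun h => ?_⟩⟩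
  exact hξ.2.1.lt_iff_lt.1 (h.trans_lt hm')

theorem IsClock.stateAt_eq {r : ℝ} {m : ℕ} (hm : ξ m ≤ r) (hm' : r < ξ (m + 1))
    (ω : ℕ → Config B) : stateAt ξ ω r = ω m := by
  have : {n : ℕ | ξ (n + 1) ≤ r} = Set.Iio m := by
    ext n
    simp only [Set.mem_ofPred_eq, Set.mem_Iio]
    refine ⟨fun h => ?_, fun h => (hξ.2.1.monotone (by omega)).trans hm⟩
    have := hξ.2.1.lt_iff_lt.1 (h.trans_lt hm')
    omega
  rw [stateAt, this, ← Finset.coe_Iio, Set.ncard_coe_finset, Nat.card_Iio]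

theorem IsClock.stateAt_tick (n : ℕ) (ω : ℕ → Config B) : stateAt ξ ω (ξ n) = ω n :=
  hξ.stateAt_eq le_rfl (hξ.2.1 (Nat.lt_succ_self n)) ω

/-- A visit to `v` at a tick before index `M` would make the trial started at the last preceding
visit to `u` successful. -/
theorem lt_hitTime_of_noSuccess (hU : B.U.Nonempty) {t : ℝ} {M : ℕ}
    (hM : ∀ n, n < M ↔ ξ n ≤ t) {ω : ℕ → Config B} (h0 : ω 0 = allU B)
    (hω : ω ∈ noSuccessSet B M) : ENNReal.ofReal t < hitTime (allV B) ξ ω 0 := by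
  classical
  have huv := allU_ne_allV hU
  have hv : ∀ n < M, ω n ≠ allV B := by
    intro n hn hv
    set j := Nat.findGreatest (fun j => ω j = allU B) n with hj
    have hju : ω j = allU B :=
      Nat.findGreatest_spec (P := fun j => ω j = allU B) (Nat.zero_le n) h0
    have hjn : j ≤ n := Nat.findGreatest_le n
    have hne : j ≠ n := fun e => huv (by rw [← hju, e, hv])
    refine hω j (by omega) hju ?_
    have h1 : hitTick (allV B) (fun i => ω (i + j)) ≤ (n - j : ℕ) :=
      (hitTick_le_iff _ _ _).2 ⟨n - j, le_rfl, by simp only [Nat.sub_add_cancel hjn, hv]⟩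
    refine lt_of_le_of_lt h1 (not_le.1 fun h2 => ?_)
    obtain ⟨i, hi1, hi2, hi⟩ := (returnTick_le_iff _ _ _).1 h2
    exact Nat.findGreatest_is_greatest (P := fun j => ω j = allU B) (n := n) (k := i + j)
      (by omega) (by omega) hi
  have htM : t < ξ M := not_le.1 fun h => lt_irrefl _ ((hM M).2 h)
  have hM0 : 0 < ξ M ∨ M = 0 := by
    rcases Nat.eq_zero_or_pos M with h | h
    · exact Or.inr h
    · left; rw [← hξ.1]; exact hξ.2.1 h
  rcases hM0 with hpos | rfl
  · refine lt_of_lt_of_le ((ENNReal.ofReal_lt_ofReal_iff hpos).2 htM) (le_sInf ?_)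
    rintro _ ⟨r, ⟨hr0, hr⟩, rfl⟩
    obtain ⟨m, hm, hm'⟩ := hξ.exists_index hr0
    rw [hξ.stateAt_eq hm hm'] at hr
    have hMm : M ≤ m := not_lt.1 fun h => hv m h hr
    exact ENNReal.ofReal_le_ofReal ((hξ.2.1.monotone hMm).trans hm)
  -- This case means `t < 0`, so only positivity of the hitting time is needed; it holds since the
  -- chain stays at `u` until the first tick.
  · rw [hξ.1] at htM
    rw [ENNReal.ofReal_of_nonpos htM.le]
    refine lt_of_lt_of_le (b := ENNReal.ofReal (ξ 1)) (ENNReal.ofReal_pos.2 ?_) (le_sInf ?_)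
    · rw [← hξ.1]; exact hξ.2.1 one_pos
    rintro _ ⟨r, ⟨hr0, hr⟩, rfl⟩
    obtain ⟨m, hm, hm'⟩ := hξ.exists_index hr0
    rw [hξ.stateAt_eq hm hm'] at hr
    have : m ≠ 0 := by rintro rfl; exact huv (h0 ▸ hr)
    exact ENNReal.ofReal_le_ofReal ((hξ.2.1.monotone (by omega)).trans hm)

/-- A successful trial started at a tick up to `t` is a candidate in the infimum defining `S`. -/
theorem noSuccess_or_firstSuccess_le {t : ℝ} {M : ℕ}
    (hM : ∀ n, n < M ↔ ξ n ≤ t) (ω : ℕ → Config B) :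
    ω ∈ noSuccessSet B M ∨ firstSuccess B ξ ω ≤ ENNReal.ofReal t := by
  by_contra hcon
  rw [not_or] at hcon
  obtain ⟨h1, h2⟩ := hcon
  unfold noSuccessSet at h1
  simp only [Set.mem_ofPred_eq, not_forall, not_not] at h1
  obtain ⟨n, hn, hu, hs⟩ := h1
  apply h2
  refine le_trans (csInf_le' (Set.mem_image_of_mem _ ⟨⟨n, rfl⟩, ?_, ?_⟩))
    (ENNReal.ofReal_le_ofReal ((hM n).1 hn))
  · rw [hξ.stateAt_tick, hu]
  have hs' : hitTick (allV B) (fun i => ω (i + n)) < returnTick (allU B) (fun i => ω (i + n)) := hs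
  obtain ⟨j, hj⟩ := ENat.ne_top_iff_exists.1 (ne_top_of_lt hs')
  obtain ⟨i, hij, hi⟩ := (hitTick_le_iff _ _ _).1 hj.symm.le
  have h3 : hitTime (allV B) ξ ω (ξ n) ≤ ENNReal.ofReal (ξ (i + n)) := by
    refine csInf_le' (Set.mem_image_of_mem _ ⟨hξ.2.1.monotone (by omega), ?_⟩)
    rw [hξ.stateAt_tick]; exact hi
  -- The return to `u` happens at a strictly later tick than the hit of `v` at index `i + n`, so the
  -- two times are separated by the gap between `ξ (i + n)` and `ξ (i + n + 1)`; this keeps the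
  -- inequality strict after taking the infimum.
  have hpos : 0 < ξ (i + n + 1) := by
    rw [← hξ.1]; exact hξ.2.1 (by omega)
  refine lt_of_le_of_lt h3 (lt_of_lt_of_le ((ENNReal.ofReal_lt_ofReal_iff hpos).2
    (hξ.2.1 (Nat.lt_succ_self _))) (le_sInf ?_))
  rintro _ ⟨r, ⟨hr0, hr, l, hl, hl'⟩, rfl⟩
  obtain ⟨m, hm, hm'⟩ := hξ.exists_index ((hξ.nonneg n).trans hr0.le)
  rw [hξ.stateAt_eq hm hm'] at hr
  have hnl : n < l + 1 := hξ.2.1.lt_iff_lt.1 hl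
  have hlm : l + 1 < m + 1 := hξ.2.1.lt_iff_lt.1 (hl'.trans_lt hm')
  have h4 : returnTick (allU B) (fun i => ω (i + n)) ≤ (m - n : ℕ) :=
    (returnTick_le_iff _ _ _).2 ⟨m - n, by omega, le_rfl, by
      simp only [Nat.sub_add_cancel (show n ≤ m by omega), hr]⟩
  have h5 : (j : ℕ∞) < (m - n : ℕ) := by
    rw [hj]; exact lt_of_lt_of_le hs' h4
  have h6 : j < m - n := by exact_mod_cast h5
  exact ENNReal.ofReal_le_ofReal ((hξ.2.1.monotone (by omega)).trans hm)

omit hξ in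
theorem ae_chainLaw_zero (P : ℕ → Config B → PMF (Config B)) (x : Config B) :
    ∀ᵐ ω ∂chainLaw B P x, ω 0 = x := by
  have h := chainLaw_cylinderSet_zero P x (fun _ => x)
  rw [if_pos rfl] at h
  have h2 := (prob_compl_eq_zero_iff (measurableSet_cylinderSet 0 fun _ => x)).2 h
  refine measure_mono_null (fun ω hω => ?_) h2
  intro hc
  exact hω (hc 0 le_rfl)

theorem noSuccess_le_quenchedLaw (hU : B.U.Nonempty) (R : Rates) {t : ℝ} {M : ℕ}
    (hM : ∀ n, n < M ↔ ξ n ≤ t) :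
    quenchedLaw B R ξ 0 (allU B) (noSuccessSet B M)
      ≤ quenchedLaw B R ξ 0 (allU B) {ω | ENNReal.ofReal t < hitTime (allV B) ξ ω 0} := by
  refine measure_mono_ae ?_
  have := ae_chainLaw_zero (fun j => step B R (ξ (0 + j + 1))) (allU B)
  filter_upwards [this] with ω h0 hω
  exact lt_hitTime_of_noSuccess hξ hU hM h0 hω

theorem quenchedLaw_le_noSuccess (R : Rates) {t : ℝ} {M : ℕ}
    (hM : ∀ n, n < M ↔ ξ n ≤ t) :
    quenchedLaw B R ξ 0 (allU B) {ω | ENNReal.ofReal t < hitTime (allV B) ξ ω 0}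
      ≤ quenchedLaw B R ξ 0 (allU B) (noSuccessSet B M)
        + quenchedLaw B R ξ 0 (allU B) {ω | firstSuccess B ξ ω ≤ ENNReal.ofReal t ∧
          ENNReal.ofReal t < hitTime (allV B) ξ ω 0} := by
  refine le_trans (measure_mono ?_) (measure_union_le _ _)
  intro ω hω
  rcases noSuccess_or_firstSuccess_le hξ hM ω with h | h
  · exact Or.inl h
  · exact Or.inr ⟨h, hω⟩

end PathEvents
end HardCore

namespace HardCore

/-! ### Compensator identity for exponential variables -/

section Exponential

instance : IsProbabilityMeasure (expMeasure 1) := isProbabilityMeasure_expMeasure one_pos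

instance : IsProbabilityMeasure expNoise := by unfold expNoise; infer_instance

theorem expMeasure_Iic_zero : expMeasure 1 (Set.Iic 0) = 0 := by
  rw [← ofReal_cdf, cdf_expMeasure_eq one_pos]
  simp

theorem ae_pos_expMeasure : ∀ᵐ x ∂expMeasure 1, 0 < x := by
  have := expMeasure_Iic_zero
  rw [ae_iff]
  simpa [Set.Iic] using this

theorem expMeasure_eq : expMeasure 1 = volume.withDensity (exponentialPDF 1) := rfl

theorem expMeasure_Ici {t : ℝ} (ht : 0 ≤ t) :
    expMeasure 1 (Set.Ici t) = ENNReal.ofReal (Real.exp (-t)) := by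
  have h1 : expMeasure 1 (Set.Ici t) = expMeasure 1 (Set.Iic t)ᶜ := by
    have hac : expMeasure 1 ≪ volume := withDensity_absolutelyContinuous _ _
    have h0 : expMeasure 1 {t} = 0 := hac (by simp)
    rw [Set.compl_Iic]
    refine le_antisymm ?_ (measure_mono Set.Ioi_subset_Ici_self)
    rw [← Set.Ioi_union_left]
    exact (measure_union_le _ _).trans (by rw [h0, add_zero])
  rw [h1, prob_compl_eq_one_sub measurableSet_Iic, ← ofReal_cdf, cdf_expMeasure_eq one_pos,
    if_pos ht, ← ENNReal.ofReal_one, ← ENNReal.ofReal_sub]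
  · congr 1; ring_nf
  · simp only [sub_nonneg, Real.exp_le_one_iff]; linarith

/-- The compensator identity for an exponential variable of mean one. -/
theorem integral_intervalIntegral_expMeasure {p : ℝ → ℝ} (hp : Measurable p) (hp0 : ∀ x, 0 ≤ p x)
    (hint : ∀ a b, IntervalIntegrable p volume a b) :
    ∫ x, (∫ y in (0 : ℝ)..x, p y) ∂expMeasure 1 = ∫ x, p x ∂expMeasure 1 := by
  have hcont : Continuous fun x => ∫ y in (0 : ℝ)..x, p y :=
    intervalIntegral.continuous_primitive hint 0
  rw [integral_eq_lintegral_of_nonneg_ae ?_ hcont.aestronglyMeasurable,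
    integral_eq_lintegral_of_nonneg_ae (ae_of_all _ hp0) hp.aestronglyMeasurable]
  · congr 1
    have h1 := lintegral_comp_eq_lintegral_meas_le_mul (expMeasure 1) (f := fun x => x) (g := p)
      (ae_pos_expMeasure.mono fun x hx => hx.le) measurable_id.aemeasurable
      (fun t _ => hint 0 t) (ae_of_all _ hp0)
    have hm : Measurable (exponentialPDF 1) := (measurable_exponentialPDFReal 1).ennreal_ofReal
    rw [h1, expMeasure_eq, lintegral_withDensity_eq_lintegral_mul _ hm hp.ennreal_ofReal,
      ← expMeasure_eq]
    -- By the layer-cake formula the left side is `∫ P(X ≥ t) p(t) dt`, and the tail of the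
    -- exponential law of mean one equals its density.
    have h2 : ∀ t ∈ Set.Ioi (0 : ℝ), expMeasure 1 {a : ℝ | t ≤ a} * ENNReal.ofReal (p t)
        = exponentialPDF 1 t * ENNReal.ofReal (p t) := by
      intro t ht
      have := expMeasure_Ici (le_of_lt ht)
      rw [Set.Ici] at this
      rw [this, exponentialPDF_of_nonneg (le_of_lt ht)]
      simp
    rw [setLIntegral_congr_fun measurableSet_Ioi h2]
    have h3 : ∀ t, (exponentialPDF 1 * fun t => ENNReal.ofReal (p t)) t
        = exponentialPDF 1 t * ENNReal.ofReal (p t) := fun t => rfl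
    simp only [h3]
    have h4 : ∫⁻ t in (Set.Ioi (0 : ℝ))ᶜ, exponentialPDF 1 t * ENNReal.ofReal (p t) = 0 := by
      rw [Set.compl_Ioi, ← Set.Iio_union_right]
      refine le_antisymm ((lintegral_union_le _ _ _).trans ?_) zero_le
      rw [setLIntegral_congr_fun (g := fun _ => 0) measurableSet_Iio
        (fun t ht => by rw [exponentialPDF_of_neg ht, zero_mul])]
      simp
    rw [← lintegral_add_compl (μ := volume)
      (fun t => exponentialPDF 1 t * ENNReal.ofReal (p t)) (measurableSet_Ioi (a := (0 : ℝ))),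
      h4, add_zero]
  · filter_upwards [ae_pos_expMeasure] with x hx
    exact intervalIntegral.integral_nonneg hx.le fun y _ => hp0 y

/-- This is the product rule for the primitive. As `p` is only integrable, it goes through absolute
continuity and almost everywhere differentiability. -/
theorem sq_intervalIntegral {p : ℝ → ℝ} (hint : ∀ a b, IntervalIntegrable p volume a b) (x : ℝ) :
    (∫ y in (0 : ℝ)..x, p y) ^ 2
      = ∫ y in (0 : ℝ)..x, 2 * (p y * ∫ z in (0 : ℝ)..y, p z) := by
  have hac : AbsolutelyContinuousOnInterval (fun x => ∫ y in (0 : ℝ)..x, p y) 0 x :=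
    (hint 0 x).absolutelyContinuousOnInterval_intervalIntegral (by simp)
  have h := hac.integral_deriv_mul_eq_sub hac
  simp only [intervalIntegral.integral_same, mul_zero, sub_zero] at h
  rw [sq, ← h]
  refine intervalIntegral.integral_congr_ae ?_
  have hae := (hint 0 x).ae_hasDerivAt_integral
  filter_upwards [hae] with y hy hyx
  have hd := (hy (Set.uIoc_subset_uIcc hyx) 0 (by simp)).deriv
  rw [hd]
  ring

end Exponential

/-! ### Compensated sums over a Poisson process and their second moments -/

section Martingale

/-- The `n`-th point of the Poisson process of rate one with the spacings `e`. -/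
noncomputable def arrival (e : ℕ → ℝ) (n : ℕ) : ℝ := ∑ i ∈ Finset.range n, e i

theorem arrival_succ (e : ℕ → ℝ) (n : ℕ) : arrival e (n + 1) = arrival e n + e n :=
  Finset.sum_range_succ _ _

theorem measurable_arrival (n : ℕ) : Measurable fun e => arrival e n :=
  Finset.measurable_sum _ fun i _ => measurable_pi_apply i

variable {f : ℝ → ℝ} {h : ℝ}

/-- Expectations with respect to the first `k` spacings and the next one. -/
theorem integral_expNoise_split {G : (ℕ → ℝ) → ℝ → ℝ} (k : ℕ)
    (hG : Measurable (Function.uncurry G))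
    (hdep : ∀ e e' : ℕ → ℝ, (∀ i < k, e i = e' i) → G e = G e')
    (hint : Integrable (fun e => G e (e k)) expNoise) :
    ∫ e, G e (e k) ∂expNoise = ∫ e, (∫ x, G e x ∂expMeasure 1) ∂expNoise := by
  classical
  have hind : iIndepFun (fun (i : ℕ) (e : ℕ → ℝ) => e i) expNoise :=
    iIndepFun_infinitePi (X := fun _ x => x) (fun _ => measurable_id)
  -- Padding the first `k` spacings with zeros gives a sequence `X e` that is independent of `e k`
  -- and, by `hdep`, indistinguishable from `e` for `G`.
  let ext : ((i : Finset.range k) → ℝ) → ℕ → ℝ := fun z i =>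
    if hi : i ∈ Finset.range k then z ⟨i, hi⟩ else 0
  have hext : Measurable ext := by
    refine measurable_pi_lambda _ fun i => ?_
    by_cases hi : i ∈ Finset.range k
    · simp only [ext, dif_pos hi]
      exact measurable_pi_apply (⟨i, hi⟩ : Finset.range k)
    · simp only [ext, dif_neg hi]
      exact measurable_const
  let X : (ℕ → ℝ) → ℕ → ℝ := fun e => ext fun i => e i
  have hres : Measurable fun (e : ℕ → ℝ) (i : Finset.range k) => e i :=
    measurable_pi_lambda _ fun i => measurable_pi_apply _
  have hX : Measurable X := hext.comp hres
  have hXG : ∀ e, G (X e) = G e := fun e => hdep _ _ fun i hi => by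
    simp [X, ext, hi]
  have h2 : IndepFun X (fun e => e k) expNoise := by
    have h3 := hind.indepFun_finset (Finset.range k) {k} (by simp) (fun i => measurable_pi_apply i)
    have hψ : Measurable fun z : ({k} : Finset ℕ) → ℝ => z ⟨k, by simp⟩ := measurable_pi_apply _
    exact h3.comp (φ := ext) (ψ := fun z => z ⟨k, by simp⟩) hext hψ
  have hmap := (indepFun_iff_map_prod_eq_prod_map_map hX.aemeasurable
    (measurable_pi_apply k).aemeasurable).1 h2
  have hk : expNoise.map (fun e => e k) = expMeasure 1 :=
    Measure.infinitePi_map_eval (fun _ : ℕ => expMeasure 1) k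
  rw [hk] at hmap
  have hpair : Measurable fun e : ℕ → ℝ => (X e, e k) := hX.prodMk (measurable_pi_apply k)
  have e1 : ∫ e, G e (e k) ∂expNoise
      = ∫ z, Function.uncurry G z ∂(expNoise.map fun e => (X e, e k)) := by
    rw [integral_map hpair.aemeasurable hG.aestronglyMeasurable]
    simp [hXG]
  have hint' : Integrable (Function.uncurry G) (expNoise.map fun e => (X e, e k)) := by
    rw [integrable_map_measure hG.aestronglyMeasurable hpair.aemeasurable]
    refine hint.congr (ae_of_all _ fun e => ?_)
    simp [hXG]
  have : IsProbabilityMeasure (expNoise.map X) := Measure.isProbabilityMeasure_map hX.aemeasurable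
  rw [e1, hmap, integral_prod _ (hmap ▸ hint'), integral_map hX.aemeasurable]
  · simp [hXG]
  · exact hG.stronglyMeasurable.integral_prod_right.aestronglyMeasurable

/-- The compensated sum of `f` over the first `k` points. -/
noncomputable def compensatedSum (f : ℝ → ℝ) (k : ℕ) (e : ℕ → ℝ) : ℝ :=
  ∑ n ∈ Finset.range k, f (arrival e (n + 1)) - ∫ y in (0 : ℝ)..arrival e k, f y

section OneStep

variable {p : ℝ → ℝ} (hp : Measurable p) (hp0 : ∀ x, 0 ≤ p x) (hph : ∀ x, p x ≤ h)
  (hpi : Integrable p)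
include hp hp0 hpi

omit hp in
theorem abs_intervalIntegral_le (a b : ℝ) : |∫ y in a..b, p y| ≤ ∫ y, p y := by
  rw [← Real.norm_eq_abs]
  refine (intervalIntegral.norm_integral_le_integral_norm_uIoc).trans ?_
  simp only [Real.norm_eq_abs, abs_of_nonneg (hp0 _)]
  exact setIntegral_le_integral hpi (ae_of_all _ hp0)

theorem integrable_sub_intervalIntegral (hph : ∀ x, p x ≤ h) :
    Integrable p (expMeasure 1) ∧ Integrable (fun x => ∫ y in (0 : ℝ)..x, p y) (expMeasure 1) := by
  have hint : ∀ a b, IntervalIntegrable p volume a b := fun a b => hpi.intervalIntegrable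
  refine ⟨Integrable.of_bound hp.aestronglyMeasurable h (ae_of_all _ fun x => ?_),
    Integrable.of_bound (intervalIntegral.continuous_primitive hint 0).aestronglyMeasurable
      (∫ y, p y) (ae_of_all _ fun x => ?_)⟩
  · rw [Real.norm_eq_abs, abs_of_nonneg (hp0 x)]; exact hph x
  · exact abs_intervalIntegral_le hp0 hpi 0 x

include hph

theorem integral_compensated_step :
    ∫ x, (p x - ∫ y in (0 : ℝ)..x, p y) ∂expMeasure 1 = 0 := by
  have hint : ∀ a b, IntervalIntegrable p volume a b := fun a b => hpi.intervalIntegrable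
  obtain ⟨h1, h2⟩ := integrable_sub_intervalIntegral hp hp0 hpi hph
  rw [integral_sub h1 h2, integral_intervalIntegral_expMeasure hp hp0 hint, sub_self]

theorem integrable_sq : Integrable fun x => p x ^ 2 := by
  refine (hpi.const_mul h).mono' (hp.pow_const 2).aestronglyMeasurable (ae_of_all _ fun x => ?_)
  rw [Real.norm_eq_abs, abs_of_nonneg (sq_nonneg _), sq]
  exact mul_le_mul_of_nonneg_right (hph x) (hp0 x)

/-- With `F` the primitive of `p`, the identity `F² = ∫ 2 p F` and the compensator identity give `E
F(X)² = E[2 p(X) F(X)]`, which cancels the cross term. What remains is `E p(X)²`, and the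
compensator identity for `p²` rewrites it. -/
theorem integral_compensated_step_sq :
    ∫ x, (p x - ∫ y in (0 : ℝ)..x, p y) ^ 2 ∂expMeasure 1
      = ∫ x, (∫ y in (0 : ℝ)..x, p y ^ 2) ∂expMeasure 1 := by
  have hint : ∀ a b, IntervalIntegrable p volume a b := fun a b => hpi.intervalIntegrable
  have hcont := intervalIntegral.continuous_primitive hint 0
  have hh : 0 ≤ h := (hp0 0).trans (hph 0)
  have hI : 0 ≤ ∫ y, p y := integral_nonneg hp0
  have hF : ∀ x, |∫ y in (0 : ℝ)..x, p y| ≤ ∫ y, p y := fun x => abs_intervalIntegral_le hp0 hpi 0 x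
  have hsq := integrable_sq hp hp0 hph hpi
  have e1 := integral_intervalIntegral_expMeasure (hp.pow_const 2) (fun x => sq_nonneg (p x))
    (fun a b => hsq.intervalIntegrable)
  have hm3 : Measurable fun y => 2 * (p y * ∫ z in (0 : ℝ)..y, p z) :=
    (hp.mul hcont.measurable).const_mul 2
  have hi1 : Integrable (fun x => p x ^ 2) (expMeasure 1) := by
    refine Integrable.of_bound (hp.pow_const 2).aestronglyMeasurable (h ^ 2)
      (ae_of_all _ fun x => ?_)
    rw [Real.norm_eq_abs, abs_of_nonneg (sq_nonneg _)]
    exact pow_le_pow_left₀ (hp0 x) (hph x) 2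
  have hi2 : Integrable (fun x => 2 * (p x * ∫ z in (0 : ℝ)..x, p z)) (expMeasure 1) := by
    refine Integrable.of_bound hm3.aestronglyMeasurable (2 * (h * ∫ y, p y))
      (ae_of_all _ fun x => ?_)
    rw [Real.norm_eq_abs, abs_mul, abs_mul, abs_of_nonneg (hp0 x), abs_two]
    exact mul_le_mul_of_nonneg_left (mul_le_mul (hph x) (hF x) (abs_nonneg _) hh) two_pos.le
  have hi3 : Integrable (fun x => (∫ y in (0 : ℝ)..x, p y) ^ 2) (expMeasure 1) := by
    refine Integrable.of_bound (hcont.pow 2).aestronglyMeasurable ((∫ y, p y) ^ 2)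
      (ae_of_all _ fun x => ?_)
    rw [Real.norm_eq_abs, abs_pow]
    exact pow_le_pow_left₀ (abs_nonneg _) (hF x) 2
  have e2 : ∫ x, (∫ y in (0 : ℝ)..x, p y) ^ 2 ∂expMeasure 1
      = ∫ x, 2 * (p x * ∫ z in (0 : ℝ)..x, p z) ∂expMeasure 1 := by
    -- The compensator identity asks for a nonnegative integrand on the whole line, but the
    -- primitive is negative or zero to the left of zero; the absolute value changes nothing on the
    -- positive half-line.
    set q : ℝ → ℝ := fun y => 2 * (p y * |∫ z in (0 : ℝ)..y, p z|) with hq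
    have hqm : Measurable q := (hp.mul hcont.abs.measurable).const_mul 2
    have hqi : Integrable q := by
      refine ((hpi.mul_const (∫ y, p y)).const_mul 2).mono' hqm.aestronglyMeasurable
        (ae_of_all _ fun x => ?_)
      rw [Real.norm_eq_abs, hq, abs_mul, abs_mul, abs_abs, abs_of_nonneg (hp0 x), abs_two]
      exact mul_le_mul_of_nonneg_left (mul_le_mul_of_nonneg_left (hF x) (hp0 x)) two_pos.le
    have e3 := integral_intervalIntegral_expMeasure hqm
      (fun x => mul_nonneg two_pos.le (mul_nonneg (hp0 x) (abs_nonneg _)))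
      (fun a b => hqi.intervalIntegrable)
    have hpos : ∀ y : ℝ, 0 ≤ y → |∫ z in (0 : ℝ)..y, p z| = ∫ z in (0 : ℝ)..y, p z := fun y hy =>
      abs_of_nonneg (intervalIntegral.integral_nonneg hy fun z _ => hp0 z)
    have e4 : ∫ x, q x ∂expMeasure 1 = ∫ x, 2 * (p x * ∫ z in (0 : ℝ)..x, p z) ∂expMeasure 1 := by
      refine integral_congr_ae ?_
      filter_upwards [ae_pos_expMeasure] with x hx
      simp only [hq, hpos x hx.le]
    rw [← e4, ← e3]
    refine integral_congr_ae ?_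
    filter_upwards [ae_pos_expMeasure] with x hx
    rw [sq_intervalIntegral hint]
    refine intervalIntegral.integral_congr fun y hy => ?_
    rw [Set.uIcc_of_le hx.le] at hy
    simp only [hq, hpos y hy.1]
  have e5 : ∀ x, (p x - ∫ y in (0 : ℝ)..x, p y) ^ 2 = p x ^ 2
      - 2 * (p x * ∫ z in (0 : ℝ)..x, p z) + (∫ y in (0 : ℝ)..x, p y) ^ 2 := fun x => by ring
  simp only [e5]
  have hi12 : Integrable (fun x => p x ^ 2 - 2 * (p x * ∫ z in (0 : ℝ)..x, p z)) (expMeasure 1) :=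
    hi1.sub hi2
  rw [integral_add hi12 hi3, integral_sub hi1 hi2, e2, e1]
  ring

end OneStep

variable (hf : Measurable f) (hf0 : ∀ x, 0 ≤ f x) (hfh : ∀ x, f x ≤ h) (hfi : Integrable f)
include hf hf0 hfi

omit hf0 in
theorem measurable_compensatedSum (k : ℕ) : Measurable (compensatedSum f k) := by
  have hcont := intervalIntegral.continuous_primitive
    (fun a b => hfi.intervalIntegrable (a := a) (b := b)) 0
  exact (Finset.measurable_sum _ fun n _ => hf.comp (measurable_arrival (n + 1))).sub
    (hcont.measurable.comp (measurable_arrival k))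

include hfh

omit hf in
theorem abs_compensatedSum_le (k : ℕ) (e : ℕ → ℝ) :
    |compensatedSum f k e| ≤ k * h + ∫ y, f y := by
  unfold compensatedSum
  refine (abs_sub _ _).trans (add_le_add ?_ (abs_intervalIntegral_le hf0 hfi _ _))
  rw [abs_of_nonneg (Finset.sum_nonneg fun n _ => hf0 _)]
  have := Finset.sum_le_card_nsmul (Finset.range k) (fun n => f (arrival e (n + 1))) h
    (fun n _ => hfh _)
  simpa using this

/-- The square minus the integral of `f²` has constant mean: conditionally on the first `k` spacings
the next increment is a centred compensated step with the function `x ↦ f (s + x)`, where `s` is the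
current arrival. -/
theorem integral_compensatedSum_sq (k : ℕ) : ∫ e, (compensatedSum f k e ^ 2
    - ∫ y in (0 : ℝ)..arrival e k, f y ^ 2) ∂expNoise = 0 := by
  have hint : ∀ a b, IntervalIntegrable f volume a b := fun a b => hfi.intervalIntegrable
  have hsqi := integrable_sq hf hf0 hfh hfi
  have hint2 : ∀ a b, IntervalIntegrable (fun y => f y ^ 2) volume a b :=
    fun a b => hsqi.intervalIntegrable
  have hc1 := intervalIntegral.continuous_primitive hint 0
  have hc2 := intervalIntegral.continuous_primitive hint2 0
  have hZm := measurable_compensatedSum hf hfi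
  have hm : ∀ k, Measurable fun e => compensatedSum f k e ^ 2
      - ∫ y in (0 : ℝ)..arrival e k, f y ^ 2 := fun k =>
    ((hZm k).pow_const 2).sub (hc2.measurable.comp (measurable_arrival k))
  have hI : ∀ k, Integrable (fun e => compensatedSum f k e ^ 2
      - ∫ y in (0 : ℝ)..arrival e k, f y ^ 2) expNoise := by
    intro k
    refine Integrable.of_bound (hm k).aestronglyMeasurable
      ((k * h + ∫ y, f y) ^ 2 + ∫ y, f y ^ 2) (ae_of_all _ fun e => ?_)
    rw [Real.norm_eq_abs]
    refine (abs_sub _ _).trans (add_le_add ?_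
      (abs_intervalIntegral_le (fun x => sq_nonneg (f x)) hsqi _ _))
    rw [abs_pow]
    exact pow_le_pow_left₀ (abs_nonneg _) (abs_compensatedSum_le hf0 hfh hfi k e) 2
  induction k with
  | zero => simp [compensatedSum, arrival]
  | succ k ih =>
    -- `G e x` is the quantity at step `k + 1` when the next spacing is `x`; it depends on `e` only
    -- through the first `k` spacings.
    set G : (ℕ → ℝ) → ℝ → ℝ := fun e x => (compensatedSum f k e + (f (arrival e k + x)
      - ((∫ y in (0 : ℝ)..(arrival e k + x), f y) - ∫ y in (0 : ℝ)..arrival e k, f y))) ^ 2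
      - ∫ y in (0 : ℝ)..(arrival e k + x), f y ^ 2 with hG
    have hGk : ∀ e, G e (e k) = compensatedSum f (k + 1) e ^ 2
        - ∫ y in (0 : ℝ)..arrival e (k + 1), f y ^ 2 := by
      intro e
      simp only [hG]
      rw [← arrival_succ]
      congr 2
      unfold compensatedSum
      rw [Finset.sum_range_succ]
      ring
    have hGm : Measurable (Function.uncurry G) := by
      have hS : Measurable fun z : (ℕ → ℝ) × ℝ => arrival z.1 k :=
        (measurable_arrival k).comp measurable_fst
      have hSx : Measurable fun z : (ℕ → ℝ) × ℝ => arrival z.1 k + z.2 := hS.add measurable_snd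
      exact ((((hZm k).comp measurable_fst).add ((hf.comp hSx).sub
        ((hc1.measurable.comp hSx).sub (hc1.measurable.comp hS)))).pow_const 2).sub
        (hc2.measurable.comp hSx)
    have hdep : ∀ e e' : ℕ → ℝ, (∀ i < k, e i = e' i) → G e = G e' := by
      intro e e' hee
      have ha : ∀ n ≤ k, arrival e n = arrival e' n := fun n hn =>
        Finset.sum_congr rfl fun i hi => hee i (by have := Finset.mem_range.1 hi; omega)
      have hz : compensatedSum f k e = compensatedSum f k e' := by
        unfold compensatedSum
        rw [ha k le_rfl, Finset.sum_congr rfl fun n hn => by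
          rw [ha (n + 1) (by have := Finset.mem_range.1 hn; omega)]]
      funext x
      simp only [hG, hz, ha k le_rfl]
    have hsplit := integral_expNoise_split k hGm hdep (by simpa only [hGk] using hI (k + 1))
    simp only [hGk] at hsplit
    rw [hsplit, ← ih]
    refine integral_congr_ae (ae_of_all _ fun e => ?_)
    set s := arrival e k
    set Z := compensatedSum f k e
    set p : ℝ → ℝ := fun x => f (s + x) with hpdef
    have hp : Measurable p := hf.comp (measurable_const.add measurable_id)
    have hp0 : ∀ x, 0 ≤ p x := fun x => hf0 _
    have hph : ∀ x, p x ≤ h := fun x => hfh _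
    have hpi : Integrable p := hfi.comp_add_left s
    have hpsq := integrable_sq hp hp0 hph hpi
    have hF : ∀ x, (∫ y in (0 : ℝ)..(s + x), f y) - ∫ y in (0 : ℝ)..s, f y
        = ∫ y in (0 : ℝ)..x, p y := by
      intro x
      rw [intervalIntegral.integral_interval_sub_left (hint _ _) (hint _ _), hpdef,
        intervalIntegral.integral_comp_add_left (fun y => f y) s, add_zero]
    have hF2 : ∀ x, (∫ y in (0 : ℝ)..(s + x), f y ^ 2)
        = (∫ y in (0 : ℝ)..s, f y ^ 2) + ∫ y in (0 : ℝ)..x, p y ^ 2 := by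
      intro x
      rw [← intervalIntegral.integral_add_adjacent_intervals (hint2 0 s) (hint2 _ _), hpdef,
        intervalIntegral.integral_comp_add_left (fun y => f y ^ 2) s, add_zero]
    have hstep0 := integral_compensated_step hp hp0 hph hpi
    have hstep2 := integral_compensated_step_sq hp hp0 hph hpi
    obtain ⟨hi1, hi2⟩ := integrable_sub_intervalIntegral hp hp0 hpi hph
    have hD : Integrable (fun x => p x - ∫ y in (0 : ℝ)..x, p y) (expMeasure 1) := hi1.sub hi2
    have hpc := intervalIntegral.continuous_primitive
      (fun a b => hpi.intervalIntegrable (a := a) (b := b)) 0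
    have hD2 : Integrable (fun x => (p x - ∫ y in (0 : ℝ)..x, p y) ^ 2) (expMeasure 1) := by
      refine Integrable.of_bound ((hp.sub hpc.measurable).pow_const 2).aestronglyMeasurable
        ((h + ∫ y, p y) ^ 2) (ae_of_all _ fun x => ?_)
      rw [Real.norm_eq_abs, abs_pow]
      refine pow_le_pow_left₀ (abs_nonneg _) ((abs_sub _ _).trans (add_le_add ?_
        (abs_intervalIntegral_le hp0 hpi _ _))) 2
      rw [abs_of_nonneg (hp0 x)]; exact hph x
    have hV : Integrable (fun x => ∫ y in (0 : ℝ)..x, p y ^ 2) (expMeasure 1) := by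
      refine Integrable.of_bound (intervalIntegral.continuous_primitive
        (fun a b => hpsq.intervalIntegrable (a := a) (b := b)) 0).aestronglyMeasurable
        (∫ y, p y ^ 2) (ae_of_all _ fun x => ?_)
      exact abs_intervalIntegral_le (fun x => sq_nonneg (p x)) hpsq _ _
    have e5 : ∀ x, G e x = (Z ^ 2 - ∫ y in (0 : ℝ)..s, f y ^ 2)
        + (2 * Z * (p x - ∫ y in (0 : ℝ)..x, p y)
        + ((p x - ∫ y in (0 : ℝ)..x, p y) ^ 2 - ∫ y in (0 : ℝ)..x, p y ^ 2)) := by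
      intro x
      change (Z + (p x - ((∫ y in (0 : ℝ)..(s + x), f y) - ∫ y in (0 : ℝ)..s, f y))) ^ 2
        - ∫ y in (0 : ℝ)..(s + x), f y ^ 2 = _
      rw [hF, hF2]
      ring
    simp only [e5]
    have hDV : Integrable (fun x => (p x - ∫ y in (0 : ℝ)..x, p y) ^ 2
        - ∫ y in (0 : ℝ)..x, p y ^ 2) (expMeasure 1) := hD2.sub hV
    have hDD : Integrable (fun x => 2 * Z * (p x - ∫ y in (0 : ℝ)..x, p y)
        + ((p x - ∫ y in (0 : ℝ)..x, p y) ^ 2 - ∫ y in (0 : ℝ)..x, p y ^ 2)) (expMeasure 1) :=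
      (hD.const_mul _).add hDV
    rw [integral_add (integrable_const _) hDD,
      integral_add (hD.const_mul _) hDV, integral_const_mul, hstep0,
      integral_sub hD2 hV, hstep2]
    simp only [integral_const, probReal_univ, one_smul, mul_zero, sub_self, add_zero]
    rfl

theorem integral_compensatedSum_sq_le (k : ℕ) :
    ∫ e, compensatedSum f k e ^ 2 ∂expNoise ≤ h * ∫ y, f y := by
  have hsqi := integrable_sq hf hf0 hfh hfi
  have hc2 := intervalIntegral.continuous_primitive
    (fun a b => hsqi.intervalIntegrable (a := a) (b := b)) 0
  have h1 : Integrable (fun e => compensatedSum f k e ^ 2) expNoise := by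
    refine Integrable.of_bound
      ((measurable_compensatedSum hf hfi k).pow_const 2).aestronglyMeasurable
      ((k * h + ∫ y, f y) ^ 2) (ae_of_all _ fun e => ?_)
    rw [Real.norm_eq_abs, abs_pow]
    exact pow_le_pow_left₀ (abs_nonneg _) (abs_compensatedSum_le hf0 hfh hfi k e) 2
  have h2 : ∀ e : ℕ → ℝ, |∫ y in (0 : ℝ)..arrival e k, f y ^ 2| ≤ ∫ y, f y ^ 2 := fun e =>
    abs_intervalIntegral_le (fun x => sq_nonneg (f x)) hsqi _ _
  have h3 : Integrable (fun e => ∫ y in (0 : ℝ)..arrival e k, f y ^ 2) expNoise :=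
    Integrable.of_bound (hc2.measurable.comp (measurable_arrival k)).aestronglyMeasurable _
      (ae_of_all _ h2)
  have h4 := integral_compensatedSum_sq hf hf0 hfh hfi k
  rw [integral_sub h1 h3, sub_eq_zero] at h4
  rw [h4]
  have h5 : ∫ e, (∫ y in (0 : ℝ)..arrival e k, f y ^ 2) ∂expNoise ≤ ∫ e, (∫ y, f y ^ 2) ∂expNoise :=
    integral_mono h3 (integrable_const _) fun e => (le_abs_self _).trans (h2 e)
  refine h5.trans ?_
  simp only [integral_const, probReal_univ, one_smul]
  rw [← integral_const_mul]
  refine integral_mono hsqi (hfi.const_mul h) fun y => ?_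
  simp only [sq]
  exact mul_le_mul_of_nonneg_right (hfh y) (hf0 y)

/-- Concentration of sums over a Poisson process. -/
theorem measure_abs_sum_sub_integral_le {L a : ℝ} (hfL : ∀ y, L < y → f y = 0)
    (ha : 0 < a) :
    expNoise {e | ∃ N, (∀ n, n < N + 1 ↔ arrival e n ≤ L) ∧
      a < |∑ n ∈ Finset.range N, f (arrival e (n + 1)) - ∫ y in (0 : ℝ)..L, f y|}
      ≤ ENNReal.ofReal (h * (∫ y, f y) / a ^ 2) := by
  -- Because `f` vanishes beyond `L`, the compensated sum is constant once the arrivals have passed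
  -- `L`. The event thus lies in the increasing union of the sets `Bad K`, and Chebyshev's
  -- inequality at index `K`, uniform in `K`, replaces any stopping argument.
  set Bad : ℕ → Set (ℕ → ℝ) := fun K => ⋂ k, ⋂ (_ : K ≤ k), {e | a < |compensatedSum f k e|}
    with hBad
  have hmono : Monotone Bad := by
    intro K K' hK e he
    simp only [hBad, Set.mem_iInter] at he ⊢
    exact fun k hk => he k (hK.trans hk)
  have hsub : {e | ∃ N, (∀ n, n < N + 1 ↔ arrival e n ≤ L) ∧
      a < |∑ n ∈ Finset.range N, f (arrival e (n + 1)) - ∫ y in (0 : ℝ)..L, f y|}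
      ⊆ ⋃ K, Bad K := by
    rintro e ⟨N, hN, hlt⟩
    refine Set.mem_iUnion.2 ⟨N + 1, ?_⟩
    simp only [hBad, Set.mem_iInter]
    intro k hk
    have hgt : ∀ n, N < n → L < arrival e n := fun n hn =>
      not_le.1 fun h => by have := (hN n).2 h; omega
    have e1 : ∑ n ∈ Finset.range k, f (arrival e (n + 1))
        = ∑ n ∈ Finset.range N, f (arrival e (n + 1)) := by
      symm
      refine Finset.sum_subset (fun n hn => ?_) fun n _ hn => ?_
      · rw [Finset.mem_range] at hn ⊢; omega
      · rw [Finset.mem_range] at hn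
        exact hfL _ (hgt _ (by omega))
    have e2 : ∫ y in (0 : ℝ)..arrival e k, f y = ∫ y in (0 : ℝ)..L, f y := by
      have hLk : L < arrival e k := hgt k (by omega)
      rw [← intervalIntegral.integral_add_adjacent_intervals (b := L) hfi.intervalIntegrable
        hfi.intervalIntegrable]
      have : ∫ y in L..arrival e k, f y = 0 := by
        rw [intervalIntegral.integral_of_le hLk.le]
        exact setIntegral_eq_zero_of_forall_eq_zero fun y hy => hfL y hy.1
      rw [this, add_zero]
    change a < |compensatedSum f k e|
    rw [compensatedSum, e1, e2]
    exact hlt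
  refine (measure_mono hsub).trans ?_
  rw [hmono.measure_iUnion]
  refine iSup_le fun K => ?_
  have h1 : Bad K ⊆ {e | a < |compensatedSum f K e|} := fun e he => by
    simp only [hBad, Set.mem_iInter] at he
    exact he K le_rfl
  refine (measure_mono h1).trans ?_
  have h2 : {e | a < |compensatedSum f K e|} ⊆ {e | a ^ 2 ≤ compensatedSum f K e ^ 2} := by
    intro e he
    have he' : a < |compensatedSum f K e| := he
    change a ^ 2 ≤ compensatedSum f K e ^ 2
    rw [← sq_abs (compensatedSum f K e)]
    exact pow_le_pow_left₀ ha.le he'.le 2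
  refine (measure_mono h2).trans ?_
  have hi : Integrable (fun e => compensatedSum f K e ^ 2) expNoise := by
    refine Integrable.of_bound
      ((measurable_compensatedSum hf hfi K).pow_const 2).aestronglyMeasurable
      ((K * h + ∫ y, f y) ^ 2) (ae_of_all _ fun e => ?_)
    rw [Real.norm_eq_abs, abs_pow]
    exact pow_le_pow_left₀ (abs_nonneg _) (abs_compensatedSum_le hf0 hfh hfi K e) 2
  have h3 := mul_meas_ge_le_integral_of_nonneg (ae_of_all expNoise fun e =>
    sq_nonneg (compensatedSum f K e)) hi (a ^ 2)
  have h4 := h3.trans (integral_compensatedSum_sq_le hf hf0 hfh hfi K)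
  rw [← ofReal_measureReal (measure_ne_top _ _)]
  refine ENNReal.ofReal_le_ofReal ?_
  rw [le_div_iff₀ (by positivity), mul_comm]
  exact h4

end Martingale

/-! ### Arrivals tend to infinity -/

section Arrivals

/-- The compensator identity with `p = 1` gives mean one, and integrability follows because the
integral of a non-integrable function would be zero. -/
theorem integrable_id_expMeasure_and : Integrable (fun x => x) (expMeasure 1) ∧
    ∫ x, x ∂expMeasure 1 = 1 := by
  have h := integral_intervalIntegral_expMeasure (p := fun _ => 1) measurable_const
    (fun _ => zero_le_one) (fun a b => intervalIntegrable_const)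
  simp only [intervalIntegral.integral_const, sub_zero, smul_eq_mul, mul_one, integral_const,
    probReal_univ] at h
  refine ⟨?_, h⟩
  by_contra hni
  rw [integral_undef hni] at h
  exact zero_ne_one h

theorem ae_pos_expNoise : ∀ᵐ e ∂expNoise, ∀ i, 0 < e i := by
  rw [ae_all_iff]
  intro i
  have := (measurePreserving_eval_infinitePi (fun _ : ℕ => expMeasure 1) i)
  exact this.quasiMeasurePreserving.ae ae_pos_expMeasure

theorem ae_tendsto_arrival : ∀ᵐ e ∂expNoise, Tendsto (arrival e) atTop atTop := by
  have hind : iIndepFun (fun (i : ℕ) (e : ℕ → ℝ) => e i) expNoise :=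
    iIndepFun_infinitePi (X := fun _ x => x) (fun _ => measurable_id)
  have hmp := fun i => measurePreserving_eval_infinitePi (fun _ : ℕ => expMeasure 1) i
  obtain ⟨h1, h2⟩ := integrable_id_expMeasure_and
  have hint : Integrable (fun e : ℕ → ℝ => e 0) expNoise :=
    (hmp 0).integrable_comp_of_integrable h1
  have hmean : ∫ e : ℕ → ℝ, e 0 ∂expNoise = 1 := by
    have h3 := integral_map (μ := expNoise) (φ := fun e : ℕ → ℝ => e 0) (f := fun x : ℝ => x)
      (measurable_pi_apply 0).aemeasurable measurable_id.aestronglyMeasurable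
    rw [← h3, ← h2]
    exact congrArg (fun μ : Measure ℝ => ∫ x, x ∂μ) (hmp 0).map_eq
  have hslln := strong_law_ae_real (fun (i : ℕ) (e : ℕ → ℝ) => e i) hint
    (fun i j hij => hind.indepFun hij)
    (fun i => ⟨(measurable_pi_apply i).aemeasurable, (measurable_pi_apply 0).aemeasurable,
      ((hmp i).map_eq).trans ((hmp 0).map_eq).symm⟩)
  filter_upwards [hslln] with e he
  rw [hmean] at he
  have h3 : Tendsto (fun n : ℕ => (n : ℝ) * (arrival e n / n)) atTop atTop :=
    Tendsto.atTop_mul_pos one_pos tendsto_natCast_atTop_atTop he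
  refine h3.congr' ?_
  filter_upwards [eventually_gt_atTop 0] with n hn
  have : (n : ℝ) ≠ 0 := by exact_mod_cast hn.ne'
  field_simp

end Arrivals
end HardCore

namespace HardCore

/-! ### Inverse of the integrated rate and the change of variables -/

section TimeChange

/-- The first time at which the primitive of `g` reaches the level `y`. -/
noncomputable def timeChange (g : ℝ → ℝ≥0) (y : ℝ) : ℝ :=
  sInf {r : ℝ | 0 ≤ r ∧ y ≤ ∫ q in (0 : ℝ)..r, (g q : ℝ)}

variable {g : ℝ → ℝ≥0} {K : ℝ} (hg : Measurable g) (hg1 : ∀ s, 1 ≤ g s)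
  (hgK : ∀ s, 0 ≤ s → (g s : ℝ) ≤ K)
include hg hgK

theorem intervalIntegrable_of_bound_nonneg {a b : ℝ} (ha : 0 ≤ a) (hb : 0 ≤ b) :
    IntervalIntegrable (fun s => (g s : ℝ)) volume a b := by
  rw [intervalIntegrable_iff]
  refine Measure.integrableOn_of_bounded (M := K) (by simp)
    hg.coe_nnreal_real.aestronglyMeasurable ?_
  rw [ae_restrict_iff' measurableSet_uIoc]
  refine ae_of_all _ fun s hs => ?_
  rw [Real.norm_eq_abs, abs_of_nonneg (NNReal.coe_nonneg _)]
  refine hgK s ?_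
  have := hs.1
  exact (le_min ha hb).trans this.le

include hg1

theorem sub_le_primitive_sub {a b : ℝ} (ha : 0 ≤ a) (hab : a ≤ b) :
    b - a ≤ (∫ q in (0 : ℝ)..b, (g q : ℝ)) - ∫ q in (0 : ℝ)..a, (g q : ℝ) := by
  have hi := fun {a b : ℝ} (ha : 0 ≤ a) (hb : 0 ≤ b) =>
    intervalIntegrable_of_bound_nonneg hg hgK ha hb
  rw [intervalIntegral.integral_interval_sub_left (hi le_rfl (ha.trans hab)) (hi le_rfl ha)]
  have := intervalIntegral.integral_mono_on (μ := volume) (f := fun _ => (1 : ℝ))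
    (g := fun s => (g s : ℝ)) hab intervalIntegrable_const (hi ha (ha.trans hab))
    (fun s _ => by exact_mod_cast hg1 s)
  simpa using this

/-- As `g ≥ 1`, the primitive is strictly increasing and reaches the level `y` no later than at `y`;
it is continuous although `g` need not be. -/
theorem exists_timeChange_eq {y : ℝ} (hy : 0 ≤ y) :
    0 ≤ timeChange g y ∧ ∫ q in (0 : ℝ)..timeChange g y, (g q : ℝ) = y := by
  have hsub := fun {a b : ℝ} (ha : 0 ≤ a) (hab : a ≤ b) =>
    sub_le_primitive_sub hg hg1 hgK ha hab
  have hcont : ContinuousOn (fun r => ∫ q in (0 : ℝ)..r, (g q : ℝ)) (Set.Icc 0 y) := by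
    have h := intervalIntegral.continuousOn_primitive_interval (μ := volume) (a := 0) (b := y)
      (f := fun s => (g s : ℝ)) ?_
    · rwa [Set.uIcc_of_le hy] at h
    · have := intervalIntegrable_of_bound_nonneg hg hgK le_rfl hy
      rw [intervalIntegrable_iff_integrableOn_Icc_of_le hy] at this
      rwa [Set.uIcc_of_le hy]
  have hmem : y ∈ Set.Icc (∫ q in (0 : ℝ)..0, (g q : ℝ)) (∫ q in (0 : ℝ)..y, (g q : ℝ)) := by
    have := hsub le_rfl hy
    simp only [intervalIntegral.integral_same, sub_zero] at this ⊢
    exact ⟨hy, this⟩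
  obtain ⟨r₀, hr₀, he⟩ := intermediate_value_Icc hy hcont hmem
  have hset : {r : ℝ | 0 ≤ r ∧ y ≤ ∫ q in (0 : ℝ)..r, (g q : ℝ)} = Set.Ici r₀ := by
    ext r
    simp only [Set.mem_ofPred_eq, Set.mem_Ici]
    simp only at he
    constructor
    · rintro ⟨h0, h1⟩
      by_contra! hlt
      have := hsub h0 hlt.le
      linarith
    · intro h
      have := hsub hr₀.1 h
      exact ⟨hr₀.1.trans h, by linarith⟩
  rw [timeChange, hset, csInf_Ici]
  exact ⟨hr₀.1, he⟩

theorem timeChange_of_nonpos {y : ℝ} (hy : y ≤ 0) : timeChange g y = 0 := by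
  have hset : {r : ℝ | 0 ≤ r ∧ y ≤ ∫ q in (0 : ℝ)..r, (g q : ℝ)} = Set.Ici 0 := by
    ext r
    simp only [Set.mem_ofPred_eq, Set.mem_Ici, and_iff_left_iff_imp]
    intro h
    have := sub_le_primitive_sub hg hg1 hgK le_rfl h
    simp only [intervalIntegral.integral_same, sub_zero] at this
    linarith
  rw [timeChange, hset, csInf_Ici]

theorem timeChange_nonneg (y : ℝ) : 0 ≤ timeChange g y := by
  rcases le_total y 0 with h | h
  · rw [timeChange_of_nonpos hg hg1 hgK h]
  · exact (exists_timeChange_eq hg hg1 hgK h).1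

theorem timeChange_le_iff {y r : ℝ} (hr : 0 ≤ r) :
    timeChange g y ≤ r ↔ y ≤ ∫ q in (0 : ℝ)..r, (g q : ℝ) := by
  have hsub := fun {a b : ℝ} (ha : 0 ≤ a) (hab : a ≤ b) =>
    sub_le_primitive_sub hg hg1 hgK ha hab
  rcases le_total y 0 with h | h
  · rw [timeChange_of_nonpos hg hg1 hgK h]
    have := hsub le_rfl hr
    simp only [intervalIntegral.integral_same, sub_zero] at this
    simp only [hr, true_iff]
    linarith
  · obtain ⟨h0, h1⟩ := exists_timeChange_eq hg hg1 hgK h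
    constructor
    · intro hle
      have := hsub h0 hle
      linarith
    · intro hle
      by_contra! hlt
      have := hsub hr hlt.le
      linarith

theorem monotone_timeChange : Monotone (timeChange g) := by
  intro y y' h
  rw [timeChange_le_iff hg hg1 hgK (timeChange_nonneg hg hg1 hgK y')]
  exact h.trans ((timeChange_le_iff hg hg1 hgK (timeChange_nonneg hg hg1 hgK y')).1 le_rfl)

/-- The equivalence `timeChange_le_iff` identifies preimages of half-lines, and measures agreeing on
half-lines are equal. This gives substitution without any continuity of `g`. -/
theorem map_timeChange {t : ℝ} (ht : 0 ≤ t) :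
    (volume.restrict (Set.Ioc 0 (∫ q in (0 : ℝ)..t, (g q : ℝ)))).map (timeChange g)
      = (volume.restrict (Set.Ioc 0 t)).withDensity fun s => (g s : ℝ≥0∞) := by
  have hm := (monotone_timeChange hg hg1 hgK).measurable
  have hmono : ∀ {a b : ℝ}, 0 ≤ a → a ≤ b →
      ∫ q in (0 : ℝ)..a, (g q : ℝ) ≤ ∫ q in (0 : ℝ)..b, (g q : ℝ) := fun ha hab => by
    have := sub_le_primitive_sub hg hg1 hgK ha hab
    linarith
  refine Measure.ext_of_Iic _ _ fun r => ?_
  rw [Measure.map_apply hm measurableSet_Iic, Measure.restrict_apply (hm measurableSet_Iic),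
    withDensity_apply _ measurableSet_Iic, Measure.restrict_restrict measurableSet_Iic]
  rcases lt_or_ge r 0 with hr | hr
  · have e1 : timeChange g ⁻¹' Set.Iic r = ∅ := by
      ext y
      simp only [Set.mem_preimage, Set.mem_Iic, Set.mem_empty_iff_false, iff_false, not_le]
      exact hr.trans_le (timeChange_nonneg hg hg1 hgK y)
    have e2 : Set.Iic r ∩ Set.Ioc 0 t = ∅ := by
      ext y
      simp only [Set.mem_inter_iff, Set.mem_Iic, Set.mem_Ioc, Set.mem_empty_iff_false, iff_false]
      rintro ⟨h1, h2, _⟩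
      linarith
    simp [e1, e2]
  · have e1 : timeChange g ⁻¹' Set.Iic r ∩ Set.Ioc 0 (∫ q in (0 : ℝ)..t, (g q : ℝ))
        = Set.Ioc 0 (∫ q in (0 : ℝ)..min t r, (g q : ℝ)) := by
      ext y
      simp only [Set.mem_inter_iff, Set.mem_preimage, Set.mem_Iic, Set.mem_Ioc,
        timeChange_le_iff hg hg1 hgK hr]
      rcases le_total t r with h | h
      · rw [min_eq_left h]
        have := hmono ht h
        exact ⟨fun h => h.2, fun h => ⟨h.2.trans this, h⟩⟩
      · rw [min_eq_right h]
        have := hmono hr h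
        exact ⟨fun h => ⟨h.2.1, h.1⟩, fun h => ⟨h.2, h.1, h.2.trans this⟩⟩
    have e2 : Set.Iic r ∩ Set.Ioc 0 t = Set.Ioc 0 (min t r) := by
      ext y
      simp only [Set.mem_inter_iff, Set.mem_Iic, Set.mem_Ioc, le_min_iff]
      tauto
    have hmin : 0 ≤ min t r := le_min ht hr
    have hi := intervalIntegrable_of_bound_nonneg hg hgK le_rfl hmin
    rw [intervalIntegrable_iff_integrableOn_Ioc_of_le hmin] at hi
    rw [e1, e2, Real.volume_Ioc, sub_zero, intervalIntegral.integral_of_le hmin,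
      ofReal_integral_eq_lintegral_ofReal hi (ae_of_all _ fun s => NNReal.coe_nonneg _)]
    simp

theorem integral_comp_timeChange {t : ℝ} (ht : 0 ≤ t) {h : ℝ → ℝ} (hh : Measurable h) :
    ∫ y in (0 : ℝ)..(∫ q in (0 : ℝ)..t, (g q : ℝ)), h (timeChange g y)
      = ∫ s in (0 : ℝ)..t, h s * (g s : ℝ) := by
  have hm := (monotone_timeChange hg hg1 hgK).measurable
  have h0 : 0 ≤ ∫ q in (0 : ℝ)..t, (g q : ℝ) :=
    intervalIntegral.integral_nonneg ht fun s _ => NNReal.coe_nonneg _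
  rw [intervalIntegral.integral_of_le h0,
    ← integral_map (μ := volume.restrict (Set.Ioc 0 (∫ q in (0 : ℝ)..t, (g q : ℝ))))
      hm.aemeasurable hh.aestronglyMeasurable, map_timeChange hg hg1 hgK ht,
    integral_withDensity_eq_integral_smul hg, intervalIntegral.integral_of_le ht]
  refine integral_congr_ae (ae_of_all _ fun s => ?_)
  simp only [NNReal.smul_def, smul_eq_mul]
  ring

end TimeChange

/-! ### The inhomogeneous Poisson clock and concentration over its ticks -/

section Clock

variable {W : Type*} [Fintype W] [DecidableEq W] {B : BipartiteGraph W}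
  {R : Rates} {t : ℝ} (hR : R.IsFrozen t) (hU : B.U.Nonempty)

theorem clock_eq (e : ℕ → ℝ) (n : ℕ) :
    clock B R e n = timeChange (clockRate B R) (arrival e n) := rfl

include hR hU

theorem clockRate_timeChange_hyps : ∃ K : ℝ, Measurable (clockRate B R) ∧
    (∀ s, 1 ≤ clockRate B R s) ∧ ∀ s, 0 ≤ s → (clockRate B R s : ℝ) ≤ K := by
  refine ⟨_, ?_, fun s => ?_, fun s hs => clockRate_le_bound hR hs⟩
  · have h1 := hR.antitone.measurable
    have h2 := hR.monotone.measurable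
    unfold clockRate
    fun_prop
  · have := one_le_clockRate B R hU s
    exact_mod_cast this

theorem measurable_clock : Measurable (clock B R) := by
  obtain ⟨K, hg, hg1, hgK⟩ := clockRate_timeChange_hyps hR hU
  exact measurable_pi_lambda _ fun n =>
    (monotone_timeChange hg hg1 hgK).measurable.comp (measurable_arrival n)

theorem clock_le_iff (e : ℕ → ℝ) (n : ℕ) {r : ℝ} (hr : 0 ≤ r) :
    clock B R e n ≤ r ↔ arrival e n ≤ ∫ q in (0 : ℝ)..r, (clockRate B R q : ℝ) := by
  obtain ⟨K, hg, hg1, hgK⟩ := clockRate_timeChange_hyps hR hU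
  exact timeChange_le_iff hg hg1 hgK hr

theorem ae_isClock : ∀ᵐ e ∂expNoise, IsClock (clock B R e) := by
  obtain ⟨K, hg, hg1, hgK⟩ := clockRate_timeChange_hyps hR hU
  filter_upwards [ae_pos_expNoise, ae_tendsto_arrival] with e he hlim
  have hmono : StrictMono (arrival e) := strictMono_nat_of_lt_succ fun n => by
    rw [arrival_succ]; linarith [he n]
  have hnn : ∀ n, 0 ≤ arrival e n := fun n => Finset.sum_nonneg fun i _ => (he i).le
  refine ⟨?_, ?_, ?_⟩
  · rw [clock_eq]
    exact timeChange_of_nonpos hg hg1 hgK (by simp [arrival])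
  · refine strictMono_nat_of_lt_succ fun n => ?_
    refine lt_of_le_of_ne (monotone_timeChange hg hg1 hgK (hmono (Nat.lt_succ_self n)).le)
      fun heq => ?_
    have h1 := (exists_timeChange_eq hg hg1 hgK (hnn n)).2
    have h2 := (exists_timeChange_eq hg hg1 hgK (hnn (n + 1))).2
    rw [clock_eq, clock_eq] at heq
    rw [← heq, h1] at h2
    exact (hmono (Nat.lt_succ_self n)).ne h2
  · rw [tendsto_atTop]
    intro r
    filter_upwards [hlim.eventually_gt_atTop
      (∫ q in (0 : ℝ)..(max r 0), (clockRate B R q : ℝ))] with n hn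
    have := (clock_le_iff hR hU e n (le_max_right r 0)).not.2 (not_le.2 hn)
    exact (le_max_left r 0).trans (not_le.1 this).le

/-- Concentration of sums over the ticks up to time `t`. -/
theorem measure_abs_clock_sum_sub_integral_le {h : ℝ → ℝ} {hbar a : ℝ} (hh : Measurable h)
    (hh0 : ∀ s, 0 ≤ h s) (hhb : ∀ s, 0 ≤ s → h s ≤ hbar) (ha : 0 < a) :
    expNoise {e | ∃ N, (∀ n, n < N + 1 ↔ clock B R e n ≤ t) ∧
      a < |∑ n ∈ Finset.range N, h (clock B R e (n + 1))
        - ∫ s in (0 : ℝ)..t, h s * (clockRate B R s : ℝ)|}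
      ≤ ENNReal.ofReal (hbar * (∫ s in (0 : ℝ)..t, h s * (clockRate B R s : ℝ)) / a ^ 2) := by
  obtain ⟨K, hg, hg1, hgK⟩ := clockRate_timeChange_hyps hR hU
  have ht := hR.nonneg
  set L := ∫ q in (0 : ℝ)..t, (clockRate B R q : ℝ) with hL
  have hL0 : 0 ≤ L := intervalIntegral.integral_nonneg ht fun s _ => NNReal.coe_nonneg _
  -- In operational time the ticks are the arrivals of the unit-rate process and the horizon `t` is
  -- `L`; the cutoff makes `f` integrable and zero beyond `L`.
  set f : ℝ → ℝ := (Set.Icc 0 L).indicator fun y => h (timeChange (clockRate B R) y) with hfdef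
  have hcomp : Measurable fun y => h (timeChange (clockRate B R) y) :=
    hh.comp (monotone_timeChange hg hg1 hgK).measurable
  have hf : Measurable f := hcomp.indicator measurableSet_Icc
  have hb0 : 0 ≤ hbar := (hh0 0).trans (hhb 0 le_rfl)
  have hf0 : ∀ y, 0 ≤ f y := fun y => Set.indicator_nonneg (fun y _ => hh0 _) y
  have hfb : ∀ y, f y ≤ hbar := fun y =>
    Set.indicator_le' (fun y _ => hhb _ (timeChange_nonneg hg hg1 hgK y)) (fun _ _ => hb0) y
  have hfi : Integrable f := by
    rw [hfdef, integrable_indicator_iff measurableSet_Icc]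
    refine Measure.integrableOn_of_bounded (M := hbar) (by simp) hcomp.aestronglyMeasurable
      (ae_of_all _ fun y => ?_)
    rw [Real.norm_eq_abs, abs_of_nonneg (hh0 _)]
    exact hhb _ (timeChange_nonneg hg hg1 hgK y)
  have hint : ∫ y in (0 : ℝ)..L, f y = ∫ s in (0 : ℝ)..t, h s * (clockRate B R s : ℝ) := by
    rw [← integral_comp_timeChange hg hg1 hgK ht hh]
    refine intervalIntegral.integral_congr fun y hy => ?_
    rw [Set.uIcc_of_le hL0] at hy
    simp only [hfdef, Set.indicator_of_mem hy]
  have hint' : ∫ y, f y = ∫ s in (0 : ℝ)..t, h s * (clockRate B R s : ℝ) := by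
    rw [← hint, hfdef, integral_indicator measurableSet_Icc, integral_Icc_eq_integral_Ioc,
      intervalIntegral.integral_of_le hL0]
    refine setIntegral_congr_fun measurableSet_Ioc fun y hy => ?_
    simp only [Set.indicator_of_mem (Set.Ioc_subset_Icc_self hy)]
  have hconc := measure_abs_sum_sub_integral_le hf hf0 hfb hfi (L := L) (a := a)
    (fun y hy => Set.indicator_of_notMem (fun h => absurd h.2 (not_le.2 hy)) _) ha
  rw [hint', hint] at hconc
  refine le_trans (measure_mono_ae ?_) hconc
  filter_upwards [ae_pos_expNoise] with e he hbad
  obtain ⟨N, hN, hlt⟩ := hbad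
  have hN' : ∀ n, n < N + 1 ↔ arrival e n ≤ L := fun n => by
    rw [hN n, clock_le_iff hR hU e n ht]
  refine ⟨N, hN', ?_⟩
  rw [Finset.sum_congr rfl fun n hn => ?_]
  · exact hlt
  · have h1 : arrival e (n + 1) ∈ Set.Icc 0 L :=
      ⟨Finset.sum_nonneg fun i _ => (he i).le,
        (hN' (n + 1)).1 (by have := Finset.mem_range.1 hn; omega)⟩
    simp only [hfdef, Set.indicator_of_mem h1, clock_eq]

end Clock

end HardCore

namespace HardCore

/-! ### Monotonicity and freezing of the given rates -/

section Frozen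

variable {gU gV : ℝ≥0 → ℝ≥0} (hgU : Monotone gU) (hgV : Monotone gV)

theorem eventually_one_le_of_isLittleO
    (hgU_large : (fun _ : ℝ≥0 => (1 : ℝ)) =o[atTop] fun x => (gU x : ℝ))
    (hgUV : (fun x => (gU x : ℝ)) =o[atTop] fun x => (gV x : ℝ)) : ∀ᶠ x in atTop, 1 ≤ gV x := by
  filter_upwards [(hgU_large.trans hgUV).bound one_pos] with x hx
  rw [one_mul, norm_one, Real.norm_eq_abs, NNReal.abs_eq] at hx
  exact_mod_cast hx

variable {cU cV μU μV : ℝ} (hcU : 0 < cU) (hcV : 0 < cV) (hμU : 0 < μU) (hμV : 0 < μV)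
include hgU hgV hμU hμV

theorem isFrozen_frozenRates {lam t : ℝ} (ht : 0 ≤ t) (h1 : 1 ≤ gV (cV * lam).toNNReal) :
    (frozenRates gU gV cU cV μU μV lam t).IsFrozen t where
  nonneg := ht
  antitone s s' h := hgU (Real.toNNReal_le_toNNReal (by
    have := mul_le_mul_of_nonneg_left (min_le_min_right t h) hμU.le
    linarith))
  monotone s s' h := hgV (Real.toNNReal_le_toNNReal (by
    have := mul_le_mul_of_nonneg_left (min_le_min_right t h) hμV.le
    linarith))
  frozenU s hs := by simp [frozenRates, hs]
  frozenV s hs := by simp [frozenRates, hs]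
  one_le := by simpa [frozenRates, ht] using h1

include hcV in
theorem eventually_isFrozen_frozenRates (hlarge : ∀ᶠ x in atTop, 1 ≤ gV x) :
    ∀ᶠ lam in atTop, ∀ t, 0 ≤ t → (frozenRates gU gV cU cV μU μV lam t).IsFrozen t := by
  have h1 : Tendsto (fun lam : ℝ => (cV * lam).toNNReal) atTop atTop :=
    tendsto_real_toNNReal_atTop.comp (tendsto_id.const_mul_atTop hcV)
  filter_upwards [h1.eventually hlarge] with lam hlam t ht
  exact isFrozen_frozenRates hgU hgV hμU hμV ht hlam

end Frozen

/-! ### The doubling property bounds the growth of the clock rate -/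

section Doubling

variable {W : Type*} [Fintype W] [DecidableEq W] {B : BipartiteGraph W} (hU : B.U.Nonempty)

omit hU in
theorem clockRate_le_mul {R : Rates} {s t A : ℝ} (hA : 1 ≤ A) (h1 : R.rateU t ≤ R.rateU s)
    (h2 : (R.rateV t : ℝ) ≤ A * R.rateV s) :
    (clockRate B R t : ℝ) ≤ A * clockRate B R s := by
  unfold clockRate
  push_cast
  rw [mul_add, ← mul_assoc, ← mul_assoc]
  have h1' : (R.rateU t : ℝ) ≤ R.rateU s := by exact_mod_cast h1
  have h3 : 0 ≤ (R.rateU s : ℝ) := NNReal.coe_nonneg _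
  gcongr
  · nlinarith
  · linarith

theorem pow_doubling_le {gV : ℝ≥0 → ℝ≥0} {A : ℝ} {x₀ : ℝ≥0} (hA : 1 ≤ A)
    (hd : ∀ x, x₀ ≤ x → (gV (2 * x) : ℝ) ≤ A * gV x) (p : ℕ) (x : ℝ≥0) (hx : x₀ ≤ x) :
    (gV (2 ^ p * x) : ℝ) ≤ A ^ p * gV x := by
  induction p with
  | zero => simp
  | succ p ih =>
    have h1 : x ≤ 2 ^ p * x := le_mul_of_one_le_left' (one_le_pow₀ one_le_two)
    have h2 := hd (2 ^ p * x) (hx.trans h1)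
    rw [← mul_assoc, ← pow_succ'] at h2
    refine h2.trans ?_
    rw [pow_succ', mul_assoc]
    exact mul_le_mul_of_nonneg_left ih (by linarith)

variable {gU gV : ℝ≥0 → ℝ≥0} (hgU : Monotone gU) (hgV : Monotone gV)
  {cU cV μU μV : ℝ} (hcU : 0 < cU) (hcV : 0 < cV) (hμU : 0 < μU) (hμV : 0 < μV)
include hU hgU hgV hcU hcV hμU hμV

/-- If the rate function of `V` has the doubling property and the mean number of successful trials
at the final success rate stays bounded, then the clock rate increases at most by a constant
factor. -/
theorem exists_clockRate_le_of_doubling (hlarge : ∀ᶠ x in atTop, 1 ≤ gV x)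
    (hdoub : (fun x => (gV (2 * x) : ℝ)) =O[atTop] fun x => (gV x : ℝ)) (K : ℝ) :
    ∃ A : ℝ, ∀ᶠ lam in atTop, ∀ t, 0 ≤ t →
      epsCheck B (frozenRates gU gV cU cV μU μV lam t) t
        * (∫ s in (0 : ℝ)..t, (clockRate B (frozenRates gU gV cU cV μU μV lam t) s : ℝ)) ≤ K →
      ∀ s ∈ Set.Icc 0 t, (clockRate B (frozenRates gU gV cU cV μU μV lam t) t : ℝ)
        ≤ A * clockRate B (frozenRates gU gV cU cV μU μV lam t) s := by
  obtain ⟨c, hc⟩ := hdoub.bound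
  obtain ⟨x₀, hx₀⟩ := eventually_atTop.1 hc
  set A := max c 1 with hA
  have hA1 : 1 ≤ A := le_max_right _ _
  have hd : ∀ x, x₀ ≤ x → (gV (2 * x) : ℝ) ≤ A * gV x := fun x hx => by
    have := hx₀ x hx
    simp only [Real.norm_eq_abs, NNReal.abs_eq] at this
    exact this.trans (mul_le_mul_of_nonneg_right (le_max_left _ _) (NNReal.coe_nonneg _))
  -- For `t ≤ 2 c_U λ / μ_U` the argument of `g_V` grows at most by this factor, so `p` doublings
  -- suffice.
  obtain ⟨p, hp⟩ := pow_unbounded_of_one_lt (1 + 2 * cU * μV / (μU * cV)) (one_lt_two (α := ℝ))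
  -- Reference rates that every sufficiently late environment dominates: once `c_U λ ≤ μ_U t` the
  -- rate in `U` is `g_U(0)`, and the rate in `V` is at least one. Their success rate `c₀` is
  -- positive and independent of `λ`.
  set R₀ : Rates := ⟨fun _ => gU 0, fun _ => 1⟩ with hR₀
  have hc₀ : 0 < (clockRate B R₀ 0 : ℝ) * epsCheck B R₀ 0 :=
    mul_pos (clockRate_pos B R₀ hU 0) (epsCheck_pos hU R₀ 0 one_pos)
  set c₀ := (clockRate B R₀ 0 : ℝ) * epsCheck B R₀ 0 with hc₀def
  refine ⟨A ^ p, ?_⟩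
  have hx₀lim : ∀ᶠ lam : ℝ in atTop, x₀ ≤ (cV * lam).toNNReal :=
    (tendsto_real_toNNReal_atTop.comp (tendsto_id.const_mul_atTop hcV)).eventually_ge_atTop x₀
  filter_upwards [hx₀lim, eventually_isFrozen_frozenRates (cU := cU) hgU hgV hcV hμU hμV hlarge,
    eventually_gt_atTop (K * A / c₀ * (μU / cU)), eventually_gt_atTop 0]
    with lam hlx hfr hlK hlam t ht hK s hs
  have hR := hfr t ht
  set R := frozenRates gU gV cU cV μU μV lam t with hRdef
  have hcl : 0 < cV * lam := mul_pos hcV hlam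
  rcases le_or_gt t (2 * cU * lam / μU) with htT | htT
  · refine clockRate_le_mul (one_le_pow₀ hA1) (hR.rateU_ge s) ?_
    have h1 : R.rateV t ≤ gV (2 ^ p * (cV * lam).toNNReal) := by
      refine hgV ?_
      rw [min_self, Real.toNNReal_le_iff_le_coe]
      push_cast
      rw [Real.coe_toNNReal _ hcl.le]
      have h2 : μV * t ≤ 2 * cU * μV / (μU * cV) * (cV * lam) := by
        have := mul_le_mul_of_nonneg_left htT hμV.le
        refine this.trans (le_of_eq ?_)
        field_simp
      nlinarith
    have h2 : gV (cV * lam).toNNReal ≤ R.rateV s := by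
      refine hgV (Real.toNNReal_le_toNNReal ?_)
      have := mul_nonneg hμV.le (le_min hs.1 ht)
      linarith
    have h1' : (R.rateV t : ℝ) ≤ gV (2 ^ p * (cV * lam).toNNReal) := by exact_mod_cast h1
    have h2' : (gV (cV * lam).toNNReal : ℝ) ≤ R.rateV s := by exact_mod_cast h2
    refine h1'.trans ((pow_doubling_le hA1 hd p _ hlx).trans ?_)
    exact mul_le_mul_of_nonneg_left h2' (by positivity)
  -- Such a long horizon is incompatible with the bound `K`: on `[t/2, t]` one doubling gives `γ ≥
  -- γ(t)/A`, so `ε̌(t) ∫ γ ≥ t c₀ / (2 A)`, which exceeds `K` for large `λ` because `t` is at least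
  -- of order `λ`.
  · exfalso
    obtain ⟨Kb, hg, hg1, hgK⟩ := clockRate_timeChange_hyps hR hU
    have ht0 : 0 < t := lt_of_le_of_lt (by positivity) htT
    have hγ : ∀ r ∈ Set.Icc (t / 2) t, (clockRate B R t : ℝ) / A ≤ clockRate B R r := by
      intro r hr
      rw [div_le_iff₀ (by linarith), mul_comm]
      refine clockRate_le_mul hA1 (hR.rateU_ge r) ?_
      set x := (cV * lam + μV * r).toNNReal with hx
      have hxr : R.rateV r = gV x := by simp [hRdef, frozenRates, hr.2, hx]
      have hnn : 0 ≤ μV * r := mul_nonneg hμV.le (by linarith [hr.1])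
      rw [hxr]
      refine le_trans ?_ (hd x (hlx.trans (Real.toNNReal_le_toNNReal (by linarith))))
      refine NNReal.coe_le_coe.2 (hgV ?_)
      rw [min_self, Real.toNNReal_le_iff_le_coe]
      push_cast
      rw [hx, Real.coe_toNNReal _ (by linarith)]
      have := mul_le_mul_of_nonneg_left hr.1 hμV.le
      linarith
    have hint : t / 2 * ((clockRate B R t : ℝ) / A) ≤ ∫ s in (0 : ℝ)..t, (clockRate B R s : ℝ) := by
      have hi := fun {a b : ℝ} (ha : 0 ≤ a) (hb : 0 ≤ b) =>
        intervalIntegrable_of_bound_nonneg hg hgK ha hb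
      have ht2 : 0 ≤ t / 2 := by linarith
      have hle : t / 2 ≤ t := by linarith
      rw [← intervalIntegral.integral_add_adjacent_intervals (hi le_rfl ht2) (hi ht2 ht)]
      have h1 : 0 ≤ ∫ s in (0 : ℝ)..(t / 2), (clockRate B R s : ℝ) :=
        intervalIntegral.integral_nonneg ht2 fun s _ => NNReal.coe_nonneg _
      have h2 := intervalIntegral.integral_mono_on (μ := volume)
        (f := fun _ => (clockRate B R t : ℝ) / A) hle intervalIntegrable_const (hi ht2 ht) hγ
      rw [intervalIntegral.integral_const, smul_eq_mul] at h2
      have h3 : t - t / 2 = t / 2 := by ring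
      rw [h3] at h2
      linarith
    have hrate : c₀ ≤ (clockRate B R t : ℝ) * epsCheck B R t := by
      refine clockRate_mul_epsCheck_le hU ?_ (hR.one_le.trans (hR.monotone ht))
      change gU (cU * lam - μU * min t t).toNNReal ≤ gU 0
      rw [min_self, Real.toNNReal_of_nonpos]
      rw [div_lt_iff₀ hμU] at htT
      have : 0 < cU * lam := mul_pos hcU hlam
      linarith
    have h1 := mul_le_mul_of_nonneg_left hint (epsCheck_nonneg (B := B) R t)
    have h2 : t / (2 * A) * c₀ ≤ K := by
      refine le_trans ?_ (h1.trans hK)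
      have h3 := mul_le_mul_of_nonneg_left hrate (show 0 ≤ t / (2 * A) by positivity)
      refine h3.trans (le_of_eq ?_)
      have : A ≠ 0 := by linarith
      field_simp
    have hA0 : 0 < A := by linarith
    have h4 : cU * lam / μU * c₀ ≤ K * A := by
      have h5 : cU * lam / μU ≤ t / 2 := by
        have : 2 * cU * lam / μU = 2 * (cU * lam / μU) := by ring
        linarith
      have h6 : t / 2 * c₀ ≤ K * A := by
        have h7 := mul_le_mul_of_nonneg_right h2 hA0.le
        refine le_trans (le_of_eq ?_) h7
        field_simp
      exact (mul_le_mul_of_nonneg_right h5 hc₀.le).trans h6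
    have h8 : K * A / c₀ * (μU / cU) < lam := hlK
    rw [div_mul_div_comm, div_lt_iff₀ (by positivity)] at h8
    rw [div_mul_eq_mul_div, div_le_iff₀ hμU] at h4
    nlinarith

end Doubling

end HardCore

namespace HardCore

/-- Equivalent to a bound on `1 / (1 - x)`: it is at most `exp (x / (1 - x))`, and `1 / (1 - x) ≤ 1
+ 2 η` in this range. -/
theorem exp_le_one_sub {x η : ℝ} (hx : 0 ≤ x) (hxη : x ≤ η) (hη : η ≤ 1 / 2) :
    Real.exp (-((1 + 2 * η) * x)) ≤ 1 - x := by
  have h1 : 0 < 1 - x := by linarith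
  have h2 : (1 - x)⁻¹ ≤ Real.exp ((1 + 2 * η) * x) := by
    have h3 : x / (1 - x) ≤ (1 + 2 * η) * x := by
      rw [div_le_iff₀ h1]
      have : 1 ≤ (1 + 2 * η) * (1 - x) := by nlinarith
      nlinarith
    refine le_trans ?_ (Real.exp_le_exp.2 h3)
    refine le_trans (le_of_eq ?_) (Real.add_one_le_exp _)
    field_simp
    ring
  rw [Real.exp_neg]
  exact inv_le_of_inv_le₀ h1 h2

/-! ### Survival bounds for a fixed clock -/

section Quenched

variable {W : Type*} [Fintype W] [DecidableEq W] {B : BipartiteGraph W}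
  {R : Rates} {t : ℝ} (hR : R.IsFrozen t) (hU : B.U.Nonempty)
include hR

theorem clockRate_le_mul_of_nonneg {A : ℝ}
    (hA : ∀ s ∈ Set.Icc 0 t, (clockRate B R t : ℝ) ≤ A * clockRate B R s) {s : ℝ} (hs : 0 ≤ s) :
    (clockRate B R t : ℝ) ≤ A * clockRate B R s := by
  rcases le_total s t with h | h
  · exact hA s ⟨hs, h⟩
  · rw [clockRate_of_le hR h]
    exact hA t ⟨hR.nonneg, le_rfl⟩

include hU

variable {ξ : ℕ → ℝ} (hξ : IsClock ξ) {A : ℝ}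
  (hA : ∀ s, 0 ≤ s → (clockRate B R t : ℝ) ≤ A * clockRate B R s)
include hξ hA

theorem successProb_clockSteps_le (n : ℕ) :
    successProb (fun i => clockSteps B R ξ (i + n)) ≤ A * epsCheck B R t := by
  have hγ := clockRate_pos B R hU (ξ (n + 1))
  refine le_of_mul_le_mul_left ((clockRate_mul_successProb_le hR hU n).trans ?_) hγ
  have := mul_le_mul_of_nonneg_right (hA _ (hξ.nonneg (n + 1))) (epsCheck_nonneg (B := B) R t)
  linarith

variable {N : ℕ} (hN : ∀ n, n < N + 1 ↔ ξ n ≤ t)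

/-- Upper bound for the probability that no trial started up to time `t` is successful. -/
theorem quenchedLaw_noSuccessSet_le (hAε : A * epsCheck B R t ≤ 1 / 2) {C : ℕ} (hC : 0 < C) {η : ℝ}
    (hη0 : 0 ≤ η) (hη : η ≤ 1 / 2)
    (hI : ∀ n, n < N + 1 → |∫ ω, (if returnTick (allU B) ω ≤ (C + 1 : ℕ)
        then ((returnTick (allU B) ω).toNat : ℝ) else 0) ∂(failedTrialLaw B R ξ n) - 1| ≤ η)
    (hII : ∀ n, n < N + 1 → C * (failedTrialLaw B R ξ n).real
      {ω | ((C + 1 : ℕ) : ℕ∞) < returnTick (allU B) ω} ≤ η)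
    (hIII : ∀ n, n < N + 1 → ∀ x : Config B, x ≠ allU B → x ≠ allV B →
      (fallBackLaw B R ξ n x).real {ω | (C : ℕ∞) < hitTick (allU B) ω} ≤ η) :
    (quenchedLaw B R ξ 0 (allU B)).real (noSuccessSet B (N + 1))
      ≤ Real.exp (-∑ n ∈ Finset.range N, epsCheck B R (ξ (n + 1)))
        + A * epsCheck B R t * (5 * η) * (N + 1) := by
  have hP := hitsEnds_clockSteps hR hξ hU
  have hε0 := epsCheck_nonneg (B := B) R
  have hle := fun n => successProb_clockSteps_le hR hU hξ hA n
  have hebar : 0 ≤ A * epsCheck B R t := successProb_nonneg.trans (hle 0)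
  have h := survivalProb_le hU hP (N + 1)
    -- The trial started at `ξ N` would contribute `ε̌` at a tick beyond `t`; it is dropped so that
    -- the sum runs over the ticks in the horizon only.
    (fun j => if j < N then epsCheck B R (ξ (j + 1)) else 0) (A * epsCheck B R t) (5 * η) hebar
    (by linarith)
    (fun j _ => by split_ifs <;> simp [hε0])
    (fun j _ => by
      split_ifs
      · exact epsCheck_le_successProb hR hξ hU j
      · exact successProb_nonneg)
    (fun j _ => by
      split_ifs
      · exact (epsCheck_le_successProb hR hξ hU j).trans (hle j)
      · exact hebar)
    (fun j hj => by
      have hr := (failureAfterSet_zero_prob (fun i => clockSteps B R ξ (i + j))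
        (allU_ne_allV hU)).trans (failure_prob hU (hP.tail j))
      -- The trial fails with probability at least `1 - A ε̌(t) ≥ 1/2`, so the conditioning in I is
      -- on a non-null event.
      have hr0 : pathProb (fun i => clockSteps B R ξ (i + j)) (failureAfterSet B 0) (allU B)
          ≠ 0 := by
        rw [hr]
        have := hle j
        intro h0
        linarith
      have h5 := sum_failureAfterSet_le (P := fun i => clockSteps B R ξ (i + j)) hU C
        (N + 1 - 1 - j) hC hη (fun i hi x hxu hxv => by
          have := hitBeforeAfter_le_of_fallBackLaw R ξ (i + j) (hIII (i + j) (by omega) x hxu hxv)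
          simpa only [add_assoc] using this) rfl
        (sum_failureAfter_of_failedTrialLaw R ξ j hr0 (hI j hj))
        (failureAfter_le_of_failedTrialLaw R ξ j (hII j hj))
      refine h5.trans (mul_le_of_le_one_right (by linarith) (pathProb_le_one _ _ _))) (allU B)
  rw [hitBefore_self _ (allU_ne_allV hU), mul_one, Finset.sum_eq_zero (s := Finset.range (N + 1))
    (f := fun c => pathProb (clockSteps B R ξ) (hitBeforeAfter c (allU B) (allV B)) (allU B))
    (fun c _ => hitBeforeAfter_of_eq _ (Or.inl rfl) c), mul_zero, add_zero,
    Finset.sum_range_succ, if_neg (lt_irrefl N), add_zero,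
    Finset.sum_congr rfl fun n hn => if_pos (Finset.mem_range.1 hn)] at h
  rw [quenchedLaw_real]
  simp only [add_zero]
  rw [pathProb_noSuccessSet hU hP]
  refine h.trans (le_of_eq ?_)
  push_cast
  ring

-- The ticks following `ξ n` are consecutive, so `k` of them in the open window force the `k`-th one
-- to lie inside.
omit hR hU hA in
theorem IsClock.lt_of_le_ticksBetween {k n : ℕ} (hk : 0 < k) {δ : ℝ}
    (h : (k : ℕ∞) ≤ ticksBetween ξ (ξ n) (ξ n + δ)) : ξ (n + k) < ξ n + δ := by
  by_contra! hge
  have hsub : {j : ℕ | ξ n < ξ (j + 1) ∧ ξ (j + 1) < ξ n + δ}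
      ⊆ (Finset.Ico n (n + (k - 1)) : Set ℕ) := by
    rintro j ⟨h1, h2⟩
    have h3 := hξ.2.1.lt_iff_lt.1 h1
    have h4 := hξ.2.1.lt_iff_lt.1 (h2.trans_le hge)
    simp only [Finset.coe_Ico, Set.mem_Ico]
    omega
  have h1 := Set.encard_le_encard hsub
  rw [Set.encard_coe_eq_coe_finsetCard, Nat.card_Ico] at h1
  have h2 : (k : ℕ∞) ≤ ((n + (k - 1) - n : ℕ) : ℕ∞) := h.trans h1
  have h3 : k ≤ n + (k - 1) - n := by exact_mod_cast h2
  omega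

omit hA in
/-- A trial that starts at a tick followed by enough further ticks. -/
theorem successProb_le_of_ticksBetween {n k : ℕ} (hk : 0 < k) {δ η : ℝ}
    (hdense : (k : ℕ∞) ≤ ticksBetween ξ (ξ n) (ξ n + δ))
    (hIV : (successfulTrialLaw B R ξ n).real {ω | (k : ℕ∞) < hitTick (allV B) ω} ≤ η)
    (hii : (clockRate B R (ξ (n + 1) + δ) : ℝ) ≤ (1 + η) * clockRate B R (ξ (n + 1))) :
    (1 - η) * successProb (fun i => clockSteps B R ξ (i + n))
      ≤ (1 + η) * epsCheck B R (ξ (n + 1) + δ) := by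
  obtain ⟨k, rfl⟩ := Nat.exists_eq_succ_of_ne_zero hk.ne'
  have h1 := hξ.lt_of_le_ticksBetween hk hdense
  have h2 : ξ n ≤ ξ (n + 1) := hξ.2.1.monotone (Nat.le_succ n)
  -- The window is measured from `ξ (n + 1)` rather than from `ξ n`; this slightly weaker bound is a
  -- function of a single tick, as the concentration estimate requires.
  have h3 := clockRate_mul_successWithin_le hR hξ hU n k (s' := ξ (n + 1) + δ)
    (by rw [← Nat.succ_eq_add_one]; linarith)
  have h4 := successProb_le_of_successfulTrialLaw R ξ n hIV
  have hγ := clockRate_pos B R hU (ξ (n + 1))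
  refine le_of_mul_le_mul_left ?_ hγ
  have h5 := mul_le_mul_of_nonneg_left h4 hγ.le
  have h6 := mul_le_mul_of_nonneg_right hii (epsCheck_nonneg (B := B) R (ξ (n + 1) + δ))
  refine h5.trans (h3.trans (h6.trans (le_of_eq (by ring))))

include hN

/-- Ticks followed by enough others obey the refined bound. The at most `m` sparse ones and the last
tick `N`, whose next tick lies beyond `t`, use the crude bound `A ε̌(t)`, hence the factor `m + 1`.
-/
theorem sum_successProb_le {k m : ℕ} (hk : 0 < k) {δ η : ℝ} (hη0 : 0 ≤ η) (hη : η ≤ 1 / 2)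
    (hm : sparseCount ξ t δ k ≤ m)
    (hIV : ∀ n, ξ n ≤ t → (k : ℕ∞) ≤ ticksBetween ξ (ξ n) (ξ n + δ) →
      (successfulTrialLaw B R ξ n).real {ω | (k : ℕ∞) < hitTick (allV B) ω} ≤ η)
    (hii : ∀ s ∈ Set.Icc 0 t, |(clockRate B R (s + δ) : ℝ) - clockRate B R s|
      ≤ η * clockRate B R s) :
    ∑ n ∈ Finset.range (N + 1), successProb (fun i => clockSteps B R ξ (i + n))
      ≤ (1 + 4 * η) * ∑ n ∈ Finset.range N, epsCheck B R (ξ (n + 1) + δ)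
        + A * epsCheck B R t * (m + 1) := by
  classical
  set S := (Finset.range N).filter fun n => ticksBetween ξ (ξ n) (ξ n + δ) < k with hS
  have hle := fun n => successProb_clockSteps_le hR hU hξ hA n
  have hebar : 0 ≤ A * epsCheck B R t := successProb_nonneg.trans (hle 0)
  have hε0 := epsCheck_nonneg (B := B) R
  have hcard : S.card ≤ m := by
    have hsub : (S : Set ℕ) ⊆ {n : ℕ | ξ n ≤ t ∧ ticksBetween ξ (ξ n) (ξ n + δ) < (k : ℕ∞)} := by
      intro n hn
      rw [hS, Finset.mem_coe, Finset.mem_filter, Finset.mem_range] at hn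
      exact ⟨(hN n).1 (by omega), hn.2⟩
    have h1 := (Set.encard_le_encard hsub).trans hm
    rw [Set.encard_coe_eq_coe_finsetCard] at h1
    exact_mod_cast h1
  have hterm : ∀ n ∈ Finset.range N, successProb (fun i => clockSteps B R ξ (i + n))
      ≤ (1 + 4 * η) * epsCheck B R (ξ (n + 1) + δ)
        + if ticksBetween ξ (ξ n) (ξ n + δ) < k then A * epsCheck B R t else 0 := by
    intro n hn
    rw [Finset.mem_range] at hn
    split_ifs with hsp
    · have := mul_nonneg (show 0 ≤ 1 + 4 * η by linarith) (hε0 (ξ (n + 1) + δ))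
      linarith [hle n]
    · rw [add_zero]
      have h1 := (abs_le.1 (hii (ξ (n + 1)) ⟨hξ.nonneg _, (hN _).1 (by omega)⟩)).2
      have h2 := successProb_le_of_ticksBetween hR hU hξ hk (not_lt.1 hsp)
        (hIV n ((hN n).1 (by omega)) (not_lt.1 hsp)) (by linarith)
      -- The factor `1 + 4 η` absorbs the quotient `(1 + η) / (1 - η)` as long as `η ≤ 1/2`.
      have h3 : 1 + η ≤ (1 - η) * (1 + 4 * η) := by nlinarith
      refine le_of_mul_le_mul_left (a := 1 - η) (h2.trans ?_) (by linarith)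
      rw [← mul_assoc]
      exact mul_le_mul_of_nonneg_right h3 (hε0 _)
  rw [Finset.sum_range_succ]
  have h1 := Finset.sum_le_sum hterm
  rw [Finset.sum_add_distrib, ← Finset.mul_sum, ← Finset.sum_filter, Finset.sum_const,
    nsmul_eq_mul] at h1
  have h2 : (S.card : ℝ) * (A * epsCheck B R t) ≤ m * (A * epsCheck B R t) :=
    mul_le_mul_of_nonneg_right (by exact_mod_cast hcard) hebar
  linarith [hle N]

omit hA hN in
/-- Lower bound for the probability that no trial started up to time `t` is successful. -/
theorem le_quenchedLaw_noSuccessSet {η S : ℝ} (hη : η ≤ 1 / 2)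
    (hle : ∀ n, successProb (fun i => clockSteps B R ξ (i + n)) ≤ η)
    (hS : ∑ n ∈ Finset.range (N + 1), successProb (fun i => clockSteps B R ξ (i + n)) ≤ S) :
    Real.exp (-((1 + 2 * η) * S))
      ≤ (quenchedLaw B R ξ 0 (allU B)).real (noSuccessSet B (N + 1)) := by
  have hP := hitsEnds_clockSteps hR hξ hU
  have h := le_survivalProb hU hP (N + 1) (allU B)
  rw [hitBefore_self _ (allU_ne_allV hU), mul_one] at h
  rw [quenchedLaw_real]
  simp only [add_zero]
  rw [pathProb_noSuccessSet hU hP]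
  refine le_trans ?_ h
  have hη0 : 0 ≤ η := successProb_nonneg.trans (hle 0)
  have h1 : Real.exp (-((1 + 2 * η) * S)) ≤ Real.exp (-((1 + 2 * η)
      * ∑ n ∈ Finset.range (N + 1), successProb (fun i => clockSteps B R ξ (i + n)))) := by
    refine Real.exp_le_exp.2 (neg_le_neg (mul_le_mul_of_nonneg_left hS (by linarith)))
  refine h1.trans ?_
  rw [Finset.mul_sum, ← Finset.sum_neg_distrib, Real.exp_sum]
  exact Finset.prod_le_prod (fun n _ => (Real.exp_pos _).le) fun n _ =>
    exp_le_one_sub successProb_nonneg (hle n) hη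

end Quenched

end HardCore

namespace HardCore

/-! ### Integrating bounds that hold off a bad set -/

section LIntegral

variable {Ω : Type*} [MeasurableSpace Ω] {μ : Measure Ω} [IsProbabilityMeasure μ]
  {q s : Ω → ℝ≥0∞} {Bad : Set Ω} {β c : ℝ}

/-- Neither the integrands nor the bad set need be measurable: the bad set is replaced by a
measurable hull of the same measure, and additivity of the integral is only used with the measurable
summand. -/
theorem toReal_lintegral_le_of_bad (hq : ∀ e, q e ≤ 1) (hβ : 0 ≤ β) (hc : 0 ≤ c)
    (hbad : μ Bad ≤ ENNReal.ofReal β) (h : ∀ e ∉ Bad, q e ≤ ENNReal.ofReal c + s e)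
    (hs : ∫⁻ e, s e ∂μ ≠ ⊤) :
    (∫⁻ e, q e ∂μ).toReal ≤ c + β + (∫⁻ e, s e ∂μ).toReal := by
  set T := toMeasurable μ Bad with hT
  have hTm : MeasurableSet T := measurableSet_toMeasurable μ Bad
  have hle : ∀ e, q e ≤ (ENNReal.ofReal c + T.indicator 1 e) + s e := by
    intro e
    by_cases he : e ∈ T
    · rw [Set.indicator_of_mem he]
      exact (hq e).trans ((self_le_add_left _ _).trans (self_le_add_right _ _))
    · rw [Set.indicator_of_notMem he, add_zero]
      exact h e fun hb => he (subset_toMeasurable μ Bad hb)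
  have h1 := lintegral_mono (μ := μ) hle
  have hm : Measurable fun e => ENNReal.ofReal c + T.indicator (1 : Ω → ℝ≥0∞) e :=
    (measurable_one.indicator hTm).const_add _
  rw [lintegral_add_left hm,
    lintegral_add_left measurable_const, lintegral_const, measure_univ, mul_one,
    lintegral_indicator_one hTm, hT, measure_toMeasurable] at h1
  have h2 : ∫⁻ e, q e ∂μ ≤ ENNReal.ofReal (c + β) + ∫⁻ e, s e ∂μ := by
    rw [ENNReal.ofReal_add hc hβ]
    exact h1.trans (by gcongr)
  have h3 := ENNReal.toReal_mono (ENNReal.add_ne_top.2 ⟨ENNReal.ofReal_ne_top, hs⟩) h2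
  rwa [ENNReal.toReal_add ENNReal.ofReal_ne_top hs, ENNReal.toReal_ofReal (by linarith)] at h3

theorem le_toReal_lintegral_of_bad (hq : ∀ e, q e ≤ 1) (hβ : 0 ≤ β) (hc : 0 ≤ c)
    (hbad : μ Bad ≤ ENNReal.ofReal β) (h : ∀ e ∉ Bad, ENNReal.ofReal c ≤ q e) :
    c * (1 - β) ≤ (∫⁻ e, q e ∂μ).toReal := by
  set T := toMeasurable μ Bad with hT
  have hTm : MeasurableSet T := measurableSet_toMeasurable μ Bad
  have h1 : ENNReal.ofReal c * μ Tᶜ ≤ ∫⁻ e, q e ∂μ := by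
    rw [← lintegral_indicator_const hTm.compl]
    refine lintegral_mono fun e => ?_
    by_cases he : e ∈ T
    · rw [Set.indicator_of_notMem (by simpa using he)]
      exact bot_le
    · rw [Set.indicator_of_mem (by simpa using he)]
      exact h e fun hb => he (subset_toMeasurable μ Bad hb)
  have hfin : ∫⁻ e, q e ∂μ ≠ ⊤ := by
    refine ne_top_of_le_ne_top ENNReal.one_ne_top ((lintegral_mono hq).trans ?_)
    simp
  have h2 := ENNReal.toReal_mono hfin h1
  rw [ENNReal.toReal_mul, ENNReal.toReal_ofReal hc] at h2
  refine le_trans (mul_le_mul_of_nonneg_left ?_ hc) h2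
  have h3 : μ.real Tᶜ = 1 - μ.real T := probReal_compl_eq_one_sub hTm
  have h4 : μ.real T ≤ β := by
    rw [Measure.real, hT, measure_toMeasurable]
    exact ENNReal.toReal_le_of_le_ofReal hβ hbad
  change 1 - β ≤ μ.real Tᶜ
  linarith

end LIntegral

/-! ### Averaging over the clock -/

section Averaged

variable {W : Type*} [Fintype W] [DecidableEq W] {B : BipartiteGraph W}
  {R : Rates} {t : ℝ} (hR : R.IsFrozen t) (hU : B.U.Nonempty)
include hR hU

theorem intervalIntegrable_mul_clockRate {h : ℝ → ℝ} {b : ℝ} (hh : Measurable h)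
    (hh0 : ∀ s, 0 ≤ h s) (hhb : ∀ s, 0 ≤ s → h s ≤ b) :
    IntervalIntegrable (fun s => h s * (clockRate B R s : ℝ)) volume 0 t := by
  obtain ⟨K, hg, hg1, hgK⟩ := clockRate_timeChange_hyps hR hU
  rw [intervalIntegrable_iff]
  refine Measure.integrableOn_of_bounded (M := b * K) (by simp)
    (hh.mul hg.coe_nnreal_real).aestronglyMeasurable ?_
  rw [ae_restrict_iff' measurableSet_uIoc]
  refine ae_of_all _ fun s hs => ?_
  rw [Set.uIoc_of_le hR.nonneg] at hs
  rw [Real.norm_eq_abs, abs_of_nonneg (mul_nonneg (hh0 s) (NNReal.coe_nonneg _))]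
  exact mul_le_mul (hhb s hs.1.le) (hgK s hs.1.le) (NNReal.coe_nonneg _)
    ((hh0 s).trans (hhb s hs.1.le))

/-- By (ii) the factor `γ(s)` may be replaced by `γ(s + δ)`, after which the substitution `s + δ`
leaves the original integral and an overshoot over `[t, t + δ]`. There `γ` is frozen at `γ(t)` and
`γ ε̌` is monotone, so (iii) bounds it. -/
theorem integral_epsCheck_shift_le {δ η : ℝ} (hδ : 0 < δ) (hη0 : 0 ≤ η) (hη : η ≤ 1 / 2)
    (hii : ∀ s ∈ Set.Icc 0 t, |(clockRate B R (s + δ) : ℝ) - clockRate B R s|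
      ≤ η * clockRate B R s)
    (hiii : (clockRate B R t : ℝ) * epsCheck B R (t + δ) * δ
      ≤ η * ∫ s in (0 : ℝ)..t, epsCheck B R s * (clockRate B R s : ℝ)) :
    ∫ s in (0 : ℝ)..t, epsCheck B R (s + δ) * (clockRate B R s : ℝ)
      ≤ (1 + 4 * η) * ∫ s in (0 : ℝ)..t, epsCheck B R s * (clockRate B R s : ℝ) := by
  have ht := hR.nonneg
  have hε0 := epsCheck_nonneg (B := B) R
  have hmono := successRate_mono (B := B) hR hU
  have hmono' : Monotone fun s => epsCheck B R s * (clockRate B R s : ℝ) := by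
    simpa only [mul_comm] using hmono
  have hii' : ∀ {a b : ℝ}, IntervalIntegrable
      (fun s => epsCheck B R s * (clockRate B R s : ℝ)) volume a b := hmono'.intervalIntegrable
  set I := ∫ s in (0 : ℝ)..t, epsCheck B R s * (clockRate B R s : ℝ) with hI
  have hI0 : 0 ≤ I := intervalIntegral.integral_nonneg ht fun s _ =>
    mul_nonneg (hε0 s) (NNReal.coe_nonneg _)
  have h1 : ∫ s in (0 : ℝ)..t, (1 - η) * (epsCheck B R (s + δ) * (clockRate B R s : ℝ))
      ≤ ∫ s in (0 : ℝ)..t, epsCheck B R (s + δ) * (clockRate B R (s + δ) : ℝ) := by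
    refine intervalIntegral.integral_mono_on ht ?_ ?_ fun s hs => ?_
    · exact (intervalIntegrable_mul_clockRate hR hU
        ((measurable_epsCheck hR hU).comp (measurable_id.add_const δ)) (fun s => hε0 _)
        (fun s _ => epsCheck_le_one R _)).const_mul _
    · exact (hmono'.comp (fun a b h => by simpa using h : Monotone fun s => s + δ)).intervalIntegrable
    · have := (abs_le.1 (hii s hs)).1
      have h2 : (1 - η) * (clockRate B R s : ℝ) ≤ clockRate B R (s + δ) := by linarith
      have := mul_le_mul_of_nonneg_left h2 (hε0 (s + δ))
      linarith
  rw [intervalIntegral.integral_const_mul, intervalIntegral.integral_comp_add_right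
    (fun s => epsCheck B R s * (clockRate B R s : ℝ)), zero_add,
    ← intervalIntegral.integral_add_adjacent_intervals (b := t) hii' hii',
    ← intervalIntegral.integral_interval_sub_left hii' hii'
      (a := 0) (b := t) (c := δ), ← hI] at h1
  have h3 : 0 ≤ ∫ s in (0 : ℝ)..δ, epsCheck B R s * (clockRate B R s : ℝ) :=
    intervalIntegral.integral_nonneg hδ.le fun s _ => mul_nonneg (hε0 s) (NNReal.coe_nonneg _)
  have h4 : ∫ s in t..(t + δ), epsCheck B R s * (clockRate B R s : ℝ) ≤ η * I := by
    refine le_trans ?_ hiii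
    have h5 := intervalIntegral.integral_mono_on (μ := volume) (g := fun _ =>
      (clockRate B R t : ℝ) * epsCheck B R (t + δ)) (show t ≤ t + δ by linarith)
      (hii' (a := t) (b := t + δ)) intervalIntegrable_const fun s hs => ?_
    · rw [intervalIntegral.integral_const, smul_eq_mul] at h5
      linarith
    · have h6 := hmono hs.2
      simp only at h6
      rw [clockRate_of_le hR (show t ≤ t + δ by linarith)] at h6
      linarith
  have h7 : 1 + η ≤ (1 - η) * (1 + 4 * η) := by nlinarith
  refine le_of_mul_le_mul_left (a := 1 - η) ?_ (by linarith)
  have h8 := mul_le_mul_of_nonneg_right h7 hI0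
  linarith

variable {A : ℝ} (hA : ∀ s, 0 ≤ s → (clockRate B R t : ℝ) ≤ A * clockRate B R s)
  {K : ℝ} (hK : A * epsCheck B R t * ∫ s in (0 : ℝ)..t, (clockRate B R s : ℝ) ≤ K)
include hA hK

theorem integral_epsCheck_le :
    ∫ s in (0 : ℝ)..t, epsCheck B R s * (clockRate B R s : ℝ) ≤ K := by
  obtain ⟨Kb, hg, hg1, hgK⟩ := clockRate_timeChange_hyps hR hU
  refine le_trans ?_ hK
  rw [← intervalIntegral.integral_const_mul]
  refine intervalIntegral.integral_mono_on hR.nonneg ?_ ?_ fun s hs => ?_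
  · exact intervalIntegrable_mul_clockRate hR hU (measurable_epsCheck hR hU)
      (epsCheck_nonneg R) fun s _ => epsCheck_le_one R s
  · exact (intervalIntegrable_of_bound_nonneg hg hgK le_rfl hR.nonneg).const_mul _
  · exact mul_le_mul_of_nonneg_right (epsCheck_le_of_clockRate_le hR hU (hA s hs.1))
      (NNReal.coe_nonneg _)

/-- Upper bound for the tail of the crossover time. -/
theorem crossoverTail_le {C : ℕ} (hC : 0 < C) {Ξ : Set (ℕ → ℝ)} {η : ℝ}
    (hη0 : 0 < η) (hη : η ≤ 1 / 2) (hε : A * epsCheck B R t ≤ 1 / 2)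
    (hsmall : A * epsCheck B R t * K ≤ η ^ 3)
    (hΞ : expNoise {e | clock B R e ∉ Ξ} ≤ ENNReal.ofReal η)
    (hI : ∀ ξ ∈ Ξ, IsClock ξ → ∀ n, ξ n ≤ t →
      |∫ ω, (if returnTick (allU B) ω ≤ (C + 1 : ℕ)
        then ((returnTick (allU B) ω).toNat : ℝ) else 0) ∂(failedTrialLaw B R ξ n) - 1| ≤ η)
    (hII : ∀ ξ ∈ Ξ, IsClock ξ → ∀ n, ξ n ≤ t → C * (failedTrialLaw B R ξ n).real
      {ω | ((C + 1 : ℕ) : ℕ∞) < returnTick (allU B) ω} ≤ η)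
    (hIII : ∀ ξ ∈ Ξ, IsClock ξ → ∀ n, ξ n ≤ t → ∀ x : Config B, x ≠ allU B → x ≠ allV B →
      (fallBackLaw B R ξ n x).real {ω | (C : ℕ∞) < hitTick (allU B) ω} ≤ η) :
    crossoverTail B R t
      ≤ Real.exp (-((∫ s in (0 : ℝ)..t, epsCheck B R s * (clockRate B R s : ℝ)) - η))
        + 5 * η * (K + 1) + 3 * η + lastExcursionProb B R t := by
  have ht := hR.nonneg
  set I := ∫ s in (0 : ℝ)..t, epsCheck B R s * (clockRate B R s : ℝ) with hIdef
  set ε := A * epsCheck B R t with hεdef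
  have hε0 : 0 ≤ ε := (epsCheck_nonneg R t).trans (epsCheck_le_of_clockRate_le hR hU (hA t ht))
  have hIK : I ≤ K := integral_epsCheck_le hR hU hA hK
  have hI0 : 0 ≤ I := intervalIntegral.integral_nonneg ht fun s _ =>
    mul_nonneg (epsCheck_nonneg R s) (NNReal.coe_nonneg _)
  have hK0 : 0 ≤ K := hI0.trans hIK
  -- Chebyshev with deviation `η`: the variance is at most the supremum `ε` of the summands times
  -- their integrated mean `z`, and `ε K ≤ η ^ 3`.
  have hvar : ∀ z ≤ K, ε * z / η ^ 2 ≤ η := by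
    intro z hz
    rw [div_le_iff₀ (by positivity)]
    have := mul_le_mul_of_nonneg_left hz hε0
    calc ε * z ≤ η ^ 3 := by linarith
      _ = η * η ^ 2 := by ring
  have hc1 := (measure_abs_clock_sum_sub_integral_le hR hU (measurable_epsCheck hR hU)
    (epsCheck_nonneg R) (fun s hs => epsCheck_le_of_clockRate_le hR hU (hA s hs)) hη0).trans
    (ENNReal.ofReal_le_ofReal (hvar _ hIK))
  -- Applied to the constant function `ε`, concentration controls `ε` times the number of ticks,
  -- which is needed for the error term proportional to `N + 1`.
  have hc2 := (measure_abs_clock_sum_sub_integral_le (B := B) hR hU (h := fun _ => ε) (hbar := ε)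
    measurable_const (fun _ => hε0) (fun s hs => le_rfl) hη0).trans
    (ENNReal.ofReal_le_ofReal (hvar _ (by rwa [intervalIntegral.integral_const_mul])))
  set S1 := {e | ∃ N, (∀ n, n < N + 1 ↔ clock B R e n ≤ t) ∧
      η < |∑ n ∈ Finset.range N, epsCheck B R (clock B R e (n + 1)) - I|} with hS1
  set S2 := {e | ∃ N, (∀ n, n < N + 1 ↔ clock B R e n ≤ t) ∧
      η < |∑ n ∈ Finset.range N, ε - ∫ s in (0 : ℝ)..t, ε * (clockRate B R s : ℝ)|} with hS2
  set S0 := {e | ¬ IsClock (clock B R e)} with hS0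
  have h0 : expNoise S0 = 0 := ae_iff.1 (ae_isClock hR hU)
  have hbad : expNoise (S0 ∪ {e | clock B R e ∉ Ξ} ∪ S1 ∪ S2) ≤ ENNReal.ofReal (3 * η) := by
    refine (measure_union_le _ _).trans ?_
    refine (add_le_add_left (measure_union_le _ _) _).trans ?_
    refine (add_le_add_left (add_le_add_left (measure_union_le _ _) _) _).trans ?_
    rw [h0, zero_add]
    refine (add_le_add (add_le_add hΞ hc1) hc2).trans (le_of_eq ?_)
    rw [← ENNReal.ofReal_add hη0.le hη0.le, ← ENNReal.ofReal_add (by linarith) hη0.le]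
    congr 1; ring
  have hfin : ∫⁻ e, quenchedLaw B R (clock B R e) 0 (allU B)
      {ω | firstSuccess B (clock B R e) ω ≤ ENNReal.ofReal t ∧
        ENNReal.ofReal t < hitTime (allV B) (clock B R e) ω 0} ∂expNoise ≠ ⊤ := by
    refine ne_top_of_le_ne_top ENNReal.one_ne_top ((lintegral_mono fun e => prob_le_one).trans ?_)
    simp
  have hmain := toReal_lintegral_le_of_bad (μ := expNoise) (q := fun e =>
    quenchedLaw B R (clock B R e) 0 (allU B)
      {ω | ENNReal.ofReal t < hitTime (allV B) (clock B R e) ω 0})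
    (c := Real.exp (-(I - η)) + 5 * η * (K + 1)) (fun e => prob_le_one)
    (by linarith : (0 : ℝ) ≤ 3 * η) (by positivity) hbad (fun e he => ?_) hfin
  · exact hmain
  · simp only [Set.mem_union, not_or, hS0, hS1, hS2, Set.mem_ofPred_eq, not_not, not_exists,
      not_and, not_lt] at he
    obtain ⟨⟨⟨hξ, heΞ⟩, he1⟩, he2⟩ := he
    obtain ⟨N, hN⟩ := hξ.exists_tickCount ht
    refine (quenchedLaw_le_noSuccess hξ R hN).trans (add_le_add_left ?_ _)
    rw [← ofReal_measureReal (measure_ne_top _ _)]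
    refine ENNReal.ofReal_le_ofReal ?_
    refine (quenchedLaw_noSuccessSet_le hR hU hξ hA hε hC hη0.le hη
      (fun n hn => hI _ heΞ hξ n ((hN n).1 hn)) (fun n hn => hII _ heΞ hξ n ((hN n).1 hn))
      (fun n hn => hIII _ heΞ hξ n ((hN n).1 hn))).trans ?_
    have h1 := (abs_le.1 (he1 N hN)).1
    have h2 := (abs_le.1 (he2 N hN)).2
    rw [Finset.sum_const, Finset.card_range, nsmul_eq_mul,
      intervalIntegral.integral_const_mul] at h2
    refine add_le_add (Real.exp_le_exp.2 (by linarith)) ?_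
    have h3 : ε * (N + 1) ≤ K + 1 := by linarith
    have := mul_le_mul_of_nonneg_left h3 (show 0 ≤ 5 * η by linarith)
    linarith

/-- Lower bound for the tail of the crossover time. -/
theorem le_crossoverTail {k m : ℕ} (hk : 0 < k) {δ η : ℝ} (hδ : 0 < δ)
    (hη0 : 0 < η) (hη : η ≤ 1 / 2) (hε : A * epsCheck B R t * (m + 1) ≤ η)
    (hsmall : 3 * (A * epsCheck B R t * K) ≤ η ^ 3)
    (hiv : expNoise {e | (m : ℕ∞) < sparseCount (clock B R e) t δ k} ≤ ENNReal.ofReal η)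
    (hii : ∀ s ∈ Set.Icc 0 t, |(clockRate B R (s + δ) : ℝ) - clockRate B R s|
      ≤ η * clockRate B R s)
    (hiii : (clockRate B R t : ℝ) * epsCheck B R (t + δ) * δ
      ≤ η * ∫ s in (0 : ℝ)..t, epsCheck B R s * (clockRate B R s : ℝ))
    (hIV : ∀ ξ, IsClock ξ → ∀ n, ξ n ≤ t → (k : ℕ∞) ≤ ticksBetween ξ (ξ n) (ξ n + δ) →
      (successfulTrialLaw B R ξ n).real {ω | (k : ℕ∞) < hitTick (allV B) ω} ≤ η) :
    Real.exp (-((1 + 2 * η) * ((1 + 4 * η) * ((1 + 4 * η)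
        * (∫ s in (0 : ℝ)..t, epsCheck B R s * (clockRate B R s : ℝ)) + η) + η))) * (1 - 2 * η)
      ≤ crossoverTail B R t := by
  have ht := hR.nonneg
  have hJ := integral_epsCheck_shift_le hR hU hδ hη0.le hη hii hiii
  set I := ∫ s in (0 : ℝ)..t, epsCheck B R s * (clockRate B R s : ℝ) with hIdef
  set J := ∫ s in (0 : ℝ)..t, epsCheck B R (s + δ) * (clockRate B R s : ℝ) with hJdef
  set ε := A * epsCheck B R t with hεdef
  have hε0 : 0 ≤ ε := (epsCheck_nonneg R t).trans (epsCheck_le_of_clockRate_le hR hU (hA t ht))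
  have hIK : I ≤ K := integral_epsCheck_le hR hU hA hK
  have hI0 : 0 ≤ I := intervalIntegral.integral_nonneg ht fun s _ =>
    mul_nonneg (epsCheck_nonneg R s) (NNReal.coe_nonneg _)
  have hvar : ε * J / η ^ 2 ≤ η := by
    rw [div_le_iff₀ (by positivity)]
    -- From `J ≤ (1 + 4 η) I` with `η ≤ 1/2` and `I ≤ K`; this is the origin of the factor 3 in
    -- `hsmall`.
    have h1 : J ≤ 3 * K := by nlinarith
    have := mul_le_mul_of_nonneg_left h1 hε0
    calc ε * J ≤ η ^ 3 := by linarith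
      _ = η * η ^ 2 := by ring
  have hc1 := (measure_abs_clock_sum_sub_integral_le hR hU
    ((measurable_epsCheck hR hU).comp (measurable_id.add_const δ)) (fun s => epsCheck_nonneg R _)
    (fun s hs => epsCheck_le_of_clockRate_le hR hU (hA (s + δ) (by linarith))) hη0).trans
    (ENNReal.ofReal_le_ofReal hvar)
  set S1 := {e | ∃ N, (∀ n, n < N + 1 ↔ clock B R e n ≤ t) ∧
      η < |∑ n ∈ Finset.range N, epsCheck B R (clock B R e (n + 1) + δ) - J|} with hS1
  set S0 := {e | ¬ IsClock (clock B R e)} with hS0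
  have h0 : expNoise S0 = 0 := ae_iff.1 (ae_isClock hR hU)
  have hbad : expNoise (S0 ∪ {e | (m : ℕ∞) < sparseCount (clock B R e) t δ k} ∪ S1)
      ≤ ENNReal.ofReal (2 * η) := by
    refine (measure_union_le _ _).trans ?_
    refine (add_le_add_left (measure_union_le _ _) _).trans ?_
    rw [h0, zero_add]
    refine (add_le_add hiv hc1).trans (le_of_eq ?_)
    rw [← ENNReal.ofReal_add hη0.le hη0.le]
    congr 1; ring
  refine le_toReal_lintegral_of_bad (μ := expNoise) (q := fun e =>
    quenchedLaw B R (clock B R e) 0 (allU B)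
      {ω | ENNReal.ofReal t < hitTime (allV B) (clock B R e) ω 0})
    (fun e => prob_le_one) (by linarith : (0 : ℝ) ≤ 2 * η) (Real.exp_pos _).le hbad fun e he => ?_
  simp only [Set.mem_union, not_or, hS0, hS1, Set.mem_ofPred_eq, not_not, not_exists,
    not_and, not_lt] at he
  obtain ⟨⟨hξ, hem⟩, he1⟩ := he
  obtain ⟨N, hN⟩ := hξ.exists_tickCount ht
  refine le_trans ?_ (noSuccess_le_quenchedLaw hξ hU R hN)
  rw [← ofReal_measureReal (measure_ne_top _ _)]
  refine ENNReal.ofReal_le_ofReal ?_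
  have h1 := (abs_le.1 (he1 N hN)).2
  have hsum := sum_successProb_le hR hU hξ hA hN hk hη0.le hη hem (fun n => hIV _ hξ n) hii
  have hεη : ε ≤ η := (le_mul_of_one_le_right hε0 (by linarith [Nat.cast_nonneg (α := ℝ) m])).trans
    hε
  refine le_quenchedLaw_noSuccessSet hR hU hξ hη
    (fun n => (successProb_clockSteps_le hR hU hξ hA n).trans hεη) (hsum.trans ?_)
  have h2 : ∑ n ∈ Finset.range N, epsCheck B R (clock B R e (n + 1) + δ)
      ≤ (1 + 4 * η) * I + η := by linarith
  have := mul_le_mul_of_nonneg_left h2 (show 0 ≤ 1 + 4 * η by linarith)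
  linarith

end Averaged

end HardCore

namespace HardCore

/-! ### From estimates with fixed `η` to the limit -/

section Asymptotics

theorem tendsto_max_zero_of_forall_le {x : ℕ → ℝ} {c : ℝ}
    (h : ∀ η > 0, η ≤ 1 / 4 → ∀ᶠ i in atTop, x i ≤ c * η) :
    Tendsto (fun i => max 0 (x i)) atTop (𝓝 0) := by
  rw [tendsto_order]
  refine ⟨fun a ha => Eventually.of_forall fun i => ha.trans_le (le_max_left _ _), fun a ha => ?_⟩
  have hc : 0 < |c| + 1 := by positivity
  filter_upwards [h (min (1 / 4) (a / (2 * (|c| + 1)))) (by positivity) (min_le_left _ _)] with i hi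
  refine max_lt ha (hi.trans_lt ?_)
  have h1 : min (1 / 4) (a / (2 * (|c| + 1))) ≤ a / (2 * (|c| + 1)) := min_le_right _ _
  have h0 : 0 ≤ min (1 / 4) (a / (2 * (|c| + 1))) := by positivity
  calc c * min (1 / 4) (a / (2 * (|c| + 1))) ≤ (|c| + 1) * (a / (2 * (|c| + 1))) :=
        mul_le_mul ((le_abs_self c).trans (by linarith)) h1 h0 hc.le
    _ = a / 2 := by field_simp
    _ < a := by linarith

theorem tendsto_of_le_exp {T I last : ℕ → ℝ} {K : ℝ} (hI0 : ∀ᶠ i in atTop, 0 ≤ I i)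
    (hlast : Tendsto last atTop (𝓝 0))
    (h : ∀ η > 0, η ≤ 1 / 4 → ∀ᶠ i in atTop,
      T i ≤ Real.exp (-(I i - η)) + 5 * η * (K + 1) + 3 * η + last i) :
    Tendsto (fun i => max 0 (T i - Real.exp (-I i))) atTop (𝓝 0) := by
  refine tendsto_max_zero_of_forall_le (c := 2 + 5 * (K + 1) + 3 + 1) fun η hη0 hη => ?_
  filter_upwards [h η hη0 hη, hlast.eventually_le_const hη0, hI0] with i hi hl h0
  have h1 : Real.exp (-(I i - η)) = Real.exp (-I i) * Real.exp η := by
    rw [← Real.exp_add]; ring_nf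
  have h2 := (abs_le.1 (Real.abs_exp_sub_one_le (x := η) (by rw [abs_of_pos hη0]; linarith))).2
  rw [abs_of_pos hη0] at h2
  have h3 : Real.exp (-I i) ≤ 1 := Real.exp_le_one_iff.2 (by linarith)
  have h4 : Real.exp (-I i) * (Real.exp η - 1) ≤ 1 * (2 * η) :=
    mul_le_mul h3 h2 (by linarith [Real.add_one_le_exp η]) zero_le_one
  nlinarith

theorem tendsto_of_exp_le {T I : ℕ → ℝ} {K : ℝ} (hI0 : ∀ᶠ i in atTop, 0 ≤ I i)
    (hIK : ∀ᶠ i in atTop, I i ≤ K)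
    (h : ∀ η > 0, η ≤ 1 / 4 → ∀ᶠ i in atTop, Real.exp (-((1 + 2 * η) * ((1 + 4 * η)
      * ((1 + 4 * η) * I i + η) + η))) * (1 - 2 * η) ≤ T i) :
    Tendsto (fun i => max 0 (1 - T i / Real.exp (-I i))) atTop (𝓝 0) := by
  refine tendsto_max_zero_of_forall_le (c := 20 * K + 5 + 2) fun η hη0 hη => ?_
  filter_upwards [h η hη0 hη, hI0, hIK] with i hi h0 hK
  -- For `η ≤ 1/4` the product of the three factors is at most `1 + 20 η` and the additive
  -- corrections sum to at most `5 η`. Boundedness of `I` by `K` is what turns the relative error in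
  -- the exponent into an additive one.
  have h1 : (1 + 2 * η) * ((1 + 4 * η) * ((1 + 4 * η) * I i + η) + η)
      ≤ I i + (20 * K + 5) * η := by
    have e1 : (1 + 2 * η) * ((1 + 4 * η) * (1 + 4 * η)) ≤ 1 + 20 * η := by nlinarith [sq_nonneg η]
    have e2 : (1 + 2 * η) * ((1 + 4 * η) * η + η) ≤ 5 * η := by nlinarith
    have e3 := mul_le_mul_of_nonneg_right e1 h0
    have e4 : η * I i ≤ η * K := mul_le_mul_of_nonneg_left hK hη0.le
    nlinarith
  have h2 : Real.exp (-I i) * (1 - (20 * K + 5) * η) ≤ Real.exp (-((1 + 2 * η) * ((1 + 4 * η)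
      * ((1 + 4 * η) * I i + η) + η))) := by
    have h3 : Real.exp (-(I i + (20 * K + 5) * η)) ≤ Real.exp (-((1 + 2 * η) * ((1 + 4 * η)
      * ((1 + 4 * η) * I i + η) + η))) := Real.exp_le_exp.2 (neg_le_neg h1)
    refine le_trans ?_ h3
    rw [neg_add, Real.exp_add]
    refine mul_le_mul_of_nonneg_left ?_ (Real.exp_pos _).le
    have := Real.add_one_le_exp (-((20 * K + 5) * η))
    linarith
  have hp := Real.exp_pos (-I i)
  have h4 : (1 - (20 * K + 5 + 2) * η) * Real.exp (-I i) ≤ T i := by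
    refine le_trans ?_ ((mul_le_mul_of_nonneg_right h2 (by linarith : 0 ≤ 1 - 2 * η)).trans hi)
    have hK0 : 0 ≤ K := h0.trans hK
    have : 1 - (20 * K + 5 + 2) * η ≤ (1 - (20 * K + 5) * η) * (1 - 2 * η) := by
      have : 0 ≤ (20 * K + 5) * η * (2 * η) := by positivity
      linarith
    have := mul_le_mul_of_nonneg_left this hp.le
    linarith
  have h5 := (le_div_iff₀ hp).2 h4
  linarith

/-- From `1 + x m ≤ exp (x m)` and `(1 - x) ^ m ≤ exp (-x m)` one gets `x m ≤ (1 - x) ^ (-m) - 1`.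
This converts (v) into `m ε̌(t) → 0`. -/
theorem tendsto_mul_of_tendsto_one_sub_pow {ι : Type*} {f : Filter ι} {x : ι → ℝ} {m : ι → ℕ}
    (hx0 : ∀ i, 0 ≤ x i) (hx1 : ∀ i, x i ≤ 1)
    (h : Tendsto (fun i => (1 - x i) ^ m i) f (𝓝 1)) :
    Tendsto (fun i => x i * m i) f (𝓝 0) := by
  have h1 : Tendsto (fun i => ((1 - x i) ^ m i)⁻¹ - 1) f (𝓝 0) := by
    simpa using (h.inv₀ one_ne_zero).sub_const 1
  refine squeeze_zero' (Eventually.of_forall fun i => mul_nonneg (hx0 i) (Nat.cast_nonneg _)) ?_ h1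
  filter_upwards [h.eventually_const_lt one_pos] with i hi
  rw [le_sub_iff_add_le]
  refine (Real.add_one_le_exp _).trans ?_
  rw [← inv_inv (Real.exp (x i * m i))]
  refine inv_anti₀ hi ?_
  rw [← Real.exp_neg, mul_comm, ← mul_neg, Real.exp_nat_mul]
  refine pow_le_pow_left₀ (sub_nonneg.2 (hx1 i)) ?_ _
  have := Real.add_one_le_exp (-x i)
  linarith

end Asymptotics

/-! ### Conclusion along a sequence -/

section Conclusion

variable {W : Type*} [Fintype W] [DecidableEq W] {B : BipartiteGraph W} (hU : B.U.Nonempty)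
  {R : ℝ → Rates} {t : ℝ → ℝ} {C k m : ℝ → ℕ} {δ : ℝ → ℝ} {Ξ : ℝ → Set (ℕ → ℝ)}
  (hG : GoodParameters B R t C k m δ Ξ) {ν : ℕ → ℝ} (hν : Tendsto ν atTop atTop)
  (hfr : ∀ᶠ i in atTop, (R (ν i)).IsFrozen (t (ν i)))
  {A K : ℝ} (hA : ∀ᶠ i in atTop, ∀ s ∈ Set.Icc 0 (t (ν i)),
    (clockRate B (R (ν i)) (t (ν i)) : ℝ) ≤ A * clockRate B (R (ν i)) s)
  (hK : ∀ᶠ i in atTop, A * epsCheck B (R (ν i)) (t (ν i))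
    * (∫ s in (0 : ℝ)..t (ν i), (clockRate B (R (ν i)) s : ℝ)) ≤ K)
include hG

theorem GoodParameters.tendsto_epsCheck :
    Tendsto (fun lam => epsCheck B (R lam) (t lam)) atTop (𝓝 0) := by
  refine squeeze_zero (fun lam => epsCheck_nonneg _ _) (fun lam => ?_) hG.cond_i
  exact le_mul_of_one_le_right (epsCheck_nonneg _ _) (by exact_mod_cast hG.C_pos lam)

include hU hν hfr hA hK

theorem eventually_crossoverTail_le {η : ℝ} (hη0 : 0 < η) (hη : η ≤ 1 / 4) :
    ∀ᶠ i in atTop, crossoverTail B (R (ν i)) (t (ν i))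
      ≤ Real.exp (-((∫ s in (0 : ℝ)..t (ν i), epsCheck B (R (ν i)) s
        * (clockRate B (R (ν i)) s : ℝ)) - η))
        + 5 * η * (K + 1) + 3 * η + lastExcursionProb B (R (ν i)) (t (ν i)) := by
  have hε := (hG.tendsto_epsCheck.comp hν).const_mul A
  rw [mul_zero] at hε
  have hεK := hε.mul_const K
  rw [zero_mul] at hεK
  have hΞ : ∀ᶠ lam in atTop,
      1 - ENNReal.ofReal η ≤ expNoise {e | clock B (R lam) e ∈ Ξ lam} :=
    hG.highProb_Ξ.eventually_const_le
      (ENNReal.sub_lt_self ENNReal.one_ne_top one_ne_zero (by simpa using hη0))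
  filter_upwards [hfr, hA, hK, hε.eventually_le_const (show (0 : ℝ) < 1 / 2 by norm_num),
    hεK.eventually_le_const (show 0 < η ^ 3 by positivity), hν.eventually hΞ,
    hν.eventually (hG.cond_I η hη0), hν.eventually (hG.cond_II η hη0),
    hν.eventually (hG.cond_III η hη0)] with i hR hAi hKi h1 h2 h3 hI hII hIII
  refine crossoverTail_le hR hU (fun s hs => clockRate_le_mul_of_nonneg hR hAi hs) hKi
    (hG.C_pos (ν i)) hη0 (by linarith) h1 h2 ?_ hI hII hIII
  have hm : MeasurableSet {e | clock B (R (ν i)) e ∈ Ξ (ν i)} :=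
    measurable_clock hR hU (hG.measurable_Ξ (ν i))
  change expNoise {e | clock B (R (ν i)) e ∈ Ξ (ν i)}ᶜ ≤ _
  rw [prob_compl_eq_one_sub hm]
  exact tsub_le_iff_tsub_le.1 h3

theorem eventually_le_crossoverTail {η : ℝ} (hη0 : 0 < η) (hη : η ≤ 1 / 4) :
    ∀ᶠ i in atTop, Real.exp (-((1 + 2 * η) * ((1 + 4 * η) * ((1 + 4 * η)
        * (∫ s in (0 : ℝ)..t (ν i), epsCheck B (R (ν i)) s * (clockRate B (R (ν i)) s : ℝ)) + η)
        + η))) * (1 - 2 * η) ≤ crossoverTail B (R (ν i)) (t (ν i)) := by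
  have hε0 := hG.tendsto_epsCheck.comp hν
  have hε := hε0.const_mul A
  have hεK := (hε.mul_const K).const_mul 3
  simp only [mul_zero, zero_mul] at hεK
  have hmε := (tendsto_mul_of_tendsto_one_sub_pow (fun lam => epsCheck_nonneg (B := B) _ _)
    (fun lam => epsCheck_le_one _ _) hG.cond_v).comp hν
  have hεm := (hmε.add hε0).const_mul A
  simp only [mul_zero, add_zero] at hεm
  filter_upwards [hfr, hA, hK, hεm.eventually_le_const hη0,
    hεK.eventually_le_const (show 0 < η ^ 3 by positivity),
    hν.eventually (hG.cond_iv.eventually_le_const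
      (show 0 < ENNReal.ofReal η by simpa using hη0)),
    hν.eventually (hG.cond_ii η hη0), hν.eventually (hG.cond_iii.bound hη0),
    hν.eventually (hG.cond_IV η hη0)] with i hR hAi hKi h1 h2 hiv hii hiii hIV
  refine le_crossoverTail hR hU (fun s hs => clockRate_le_mul_of_nonneg hR hAi hs) hKi
    (hG.k_pos (ν i)) (hG.δ_pos (ν i)) hη0 (by linarith) ?_ h2 hiv hii ?_ hIV
  · simp only [Function.comp] at h1
    linarith
  · have hI0 : 0 ≤ ∫ s in (0 : ℝ)..t (ν i), epsCheck B (R (ν i)) s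
        * (clockRate B (R (ν i)) s : ℝ) :=
      intervalIntegral.integral_nonneg hR.nonneg fun s _ =>
        mul_nonneg (epsCheck_nonneg _ s) (NNReal.coe_nonneg _)
    rw [Real.norm_eq_abs, Real.norm_eq_abs, abs_of_nonneg hI0] at hiii
    exact (le_abs_self _).trans hiii

/-- The tail of the crossover time is asymptotically exponential in the integrated success rate. -/
theorem exists_crossoverTail_asymptotics
    (hlast : Tendsto (fun i => lastExcursionProb B (R (ν i)) (t (ν i))) atTop (𝓝 0)) :
    ∃ a b a' : ℕ → ℝ, Tendsto a atTop (𝓝 0) ∧ Tendsto b atTop (𝓝 0) ∧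
      Tendsto a' atTop (𝓝 0) ∧ ∀ᶠ i in atTop,
        crossoverTail B (R (ν i)) (t (ν i))
          ≤ (1 - a i) * Real.exp (-∫ s in (0 : ℝ)..t (ν i),
              epsCheck B (R (ν i)) s * (clockRate B (R (ν i)) s : ℝ)) + b i ∧
        (1 - a' i) * Real.exp (-∫ s in (0 : ℝ)..t (ν i),
              epsCheck B (R (ν i)) s * (clockRate B (R (ν i)) s : ℝ))
          ≤ crossoverTail B (R (ν i)) (t (ν i)) := by
  set I : ℕ → ℝ := fun i => ∫ s in (0 : ℝ)..t (ν i),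
    epsCheck B (R (ν i)) s * (clockRate B (R (ν i)) s : ℝ) with hI
  set T : ℕ → ℝ := fun i => crossoverTail B (R (ν i)) (t (ν i)) with hT
  have hI0 : ∀ᶠ i in atTop, 0 ≤ I i := hfr.mono fun i hR =>
    intervalIntegral.integral_nonneg hR.nonneg fun s _ =>
      mul_nonneg (epsCheck_nonneg _ s) (NNReal.coe_nonneg _)
  have hIK : ∀ᶠ i in atTop, I i ≤ K := by
    filter_upwards [hfr, hA, hK] with i hR hAi hKi
    exact integral_epsCheck_le hR hU (fun s hs => clockRate_le_mul_of_nonneg hR hAi hs) hKi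
  -- The upper error is taken entirely additive and the lower one entirely multiplicative, as the
  -- positive parts of the actual deviations; the two inequalities are then automatic and only the
  -- limits carry content.
  refine ⟨fun _ => 0, fun i => max 0 (T i - Real.exp (-I i)),
    fun i => max 0 (1 - T i / Real.exp (-I i)), tendsto_const_nhds,
    tendsto_of_le_exp hI0 hlast
      fun η hη0 hη => eventually_crossoverTail_le hU hG hν hfr hA hK hη0 hη,
    tendsto_of_exp_le hI0 hIK
      fun η hη0 hη => eventually_le_crossoverTail hU hG hν hfr hA hK hη0 hη,
    Eventually.of_forall fun i => ⟨?_, ?_⟩⟩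
  · have := le_max_right 0 (T i - Real.exp (-I i))
    change T i ≤ (1 - 0) * Real.exp (-I i) + max 0 (T i - Real.exp (-I i))
    linarith
  · change (1 - max 0 (1 - T i / Real.exp (-I i))) * Real.exp (-I i) ≤ T i
    rw [← le_div_iff₀ (Real.exp_pos _)]
    have := le_max_right 0 (1 - T i / Real.exp (-I i))
    linarith

end Conclusion

end HardCore

theorem mainTheorem5 {W : Type*} [Fintype W] [DecidableEq W] (B : HardCore.BipartiteGraph W)
    (hU : B.U.Nonempty) (hV : (B.Uᶜ).Nonempty)
    (gU gV : ℝ≥0 → ℝ≥0) (hgU : Monotone gU) (hgV : Monotone gV)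
    (hgU_large : (fun _ : ℝ≥0 => (1 : ℝ)) =o[atTop] fun x => (gU x : ℝ))
    (hgUV : (fun x => (gU x : ℝ)) =o[atTop] fun x => (gV x : ℝ))
    (cU cV μU μV : ℝ) (hcU : 0 < cU) (hcV : 0 < cV) (hμU : 0 < μU) (hμV : 0 < μV)
    (M : ℝ → ℝ) (hM : Tendsto M atTop atTop)
    (R : ℝ → ℝ → HardCore.Rates)
    (hR : ∀ lam τ, R lam τ = HardCore.frozenRates gU gV cU cV μU μV lam (M lam * τ))
    (hlast : HardCore.ShortLastExcursion B R M) :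
    ∀ l : ℕ → ℝ, Tendsto l atTop atTop → ∃ φ : ℕ → ℕ, StrictMono φ ∧
      ∃ D : Set ℝ, D.Countable ∧ ∀ τ : ℝ, 0 ≤ τ → τ ∉ D →
        -- parameters can be chosen for the time horizon `M τ`
        (∃ (C k m : ℝ → ℕ) (δ : ℝ → ℝ) (Ξ : ℝ → Set (ℕ → ℝ)),
          HardCore.GoodParameters B (fun lam => R lam τ) (fun lam => M lam * τ) C k m δ Ξ) →
        -- `ε̌(M τ) ∫_0^{M τ} γ = O(1)`
        ((fun i => HardCore.epsCheck B (R (l (φ i)) τ) (M (l (φ i)) * τ) *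
            ∫ s in (0 : ℝ)..(M (l (φ i)) * τ), (HardCore.clockRate B (R (l (φ i)) τ) s : ℝ))
          =O[atTop] fun _ => (1 : ℝ)) →
        -- either `g_V(2x) = O(g_V(x))`, or `γ(M τ) = O(γ(s))` uniformly in `s ∈ [0, M τ]`
        (((fun x => (gV (2 * x) : ℝ)) =O[atTop] fun x => (gV x : ℝ)) ∨
          ∃ A : ℝ, ∀ᶠ i in atTop, ∀ s ∈ Set.Icc 0 (M (l (φ i)) * τ),
            (HardCore.clockRate B (R (l (φ i)) τ) (M (l (φ i)) * τ) : ℝ)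
              ≤ A * HardCore.clockRate B (R (l (φ i)) τ) s) →
        ∃ a b a' : ℕ → ℝ, Tendsto a atTop (𝓝 0) ∧ Tendsto b atTop (𝓝 0) ∧
          Tendsto a' atTop (𝓝 0) ∧ ∀ᶠ i in atTop,
            HardCore.crossoverTail B (R (l (φ i)) τ) (M (l (φ i)) * τ)
              ≤ (1 - a i) * Real.exp (-∫ s in (0 : ℝ)..(M (l (φ i)) * τ),
                  HardCore.epsCheck B (R (l (φ i)) τ) s *
                    (HardCore.clockRate B (R (l (φ i)) τ) s : ℝ)) + b i ∧
            (1 - a' i) * Real.exp (-∫ s in (0 : ℝ)..(M (l (φ i)) * τ),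
                  HardCore.epsCheck B (R (l (φ i)) τ) s *
                    (HardCore.clockRate B (R (l (φ i)) τ) s : ℝ))
              ≤ HardCore.crossoverTail B (R (l (φ i)) τ) (M (l (φ i)) * τ) := by
  intro l hl
  -- The subsequence and the exceptional set are those of condition V; everything else holds for
  -- every fixed `τ` along the whole sequence.
  obtain ⟨φ, hφ, D, hD, hlim⟩ := hlast l hl
  refine ⟨φ, hφ, D, hD, fun τ hτ0 hτ hG hO hrate => ?_⟩
  obtain ⟨C, k, m, δ, Ξ, hG⟩ := hG
  have hν : Tendsto (fun i => l (φ i)) atTop atTop := hl.comp hφ.tendsto_atTop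
  have hlarge := HardCore.eventually_one_le_of_isLittleO hgU_large hgUV
  have ht0 : ∀ᶠ i in atTop, 0 ≤ M (l (φ i)) * τ :=
    (hν.eventually (hM.eventually_ge_atTop 0)).mono fun i hi => mul_nonneg hi hτ0
  have hfr : ∀ᶠ i in atTop, (R (l (φ i)) τ).IsFrozen (M (l (φ i)) * τ) := by
    filter_upwards [hν.eventually (HardCore.eventually_isFrozen_frozenRates (cU := cU) hgU hgV hcV
      hμU hμV hlarge), ht0] with i hi h0
    rw [hR]
    exact hi _ h0
  obtain ⟨K, hK⟩ := hO.bound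
  have hK' : ∀ᶠ i in atTop, HardCore.epsCheck B (R (l (φ i)) τ) (M (l (φ i)) * τ) *
      (∫ s in (0 : ℝ)..(M (l (φ i)) * τ), (HardCore.clockRate B (R (l (φ i)) τ) s : ℝ)) ≤ K := by
    filter_upwards [hK] with i hi
    rw [norm_one, mul_one] at hi
    exact (le_abs_self _).trans hi
  obtain ⟨A, hA⟩ : ∃ A : ℝ, ∀ᶠ i in atTop, ∀ s ∈ Set.Icc 0 (M (l (φ i)) * τ),
      (HardCore.clockRate B (R (l (φ i)) τ) (M (l (φ i)) * τ) : ℝ)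
        ≤ A * HardCore.clockRate B (R (l (φ i)) τ) s := by
    rcases hrate with hdoub | hA
    · obtain ⟨A, hA⟩ := HardCore.exists_clockRate_le_of_doubling hU hgU hgV hcU hcV hμU hμV hlarge
        hdoub K
      refine ⟨A, ?_⟩
      filter_upwards [hν.eventually hA, ht0, hK'] with i hi h0 hKi
      rw [hR] at hKi ⊢
      exact hi _ h0 hKi
    · exact hA
  -- A nonnegative constant is needed so that the bound on `ε̌ ∫ γ` can be multiplied by it.
  have hA' : ∀ᶠ i in atTop, ∀ s ∈ Set.Icc 0 (M (l (φ i)) * τ),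
      (HardCore.clockRate B (R (l (φ i)) τ) (M (l (φ i)) * τ) : ℝ)
        ≤ max A 0 * HardCore.clockRate B (R (l (φ i)) τ) s :=
    hA.mono fun i hi s hs =>
      (hi s hs).trans (mul_le_mul_of_nonneg_right (le_max_left _ _) (NNReal.coe_nonneg _))
  refine HardCore.exists_crossoverTail_asymptotics (R := fun lam => R lam τ)
    (t := fun lam => M lam * τ) (K := max A 0 * K) hU hG hν hfr hA' ?_ (hlim τ hτ0 hτ)
  filter_upwards [hK'] with i hi
  rw [mul_assoc]
  exact mul_le_mul_of_nonneg_left hi (le_max_right _ _)
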